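/- Let $\mathbb K$ be a field of characteristic $0$ and let $V$ be a finite-dimensional $\mathbb Z$-graded vector space over $\mathbb K$ with a homogeneous basis $(x^i)$; write $W[s]^d:=W^{d+s}$. Let $\mathcal O_V=\widehat{\odot^\bullet}V$ be the algebra of graded-commutative formal power series in the $x^i$, a (completed) graded commutative and cocommutative bialgebra in which the $x^i$ are primitive; $\mathcal O_V^{\otimes m}$ denotes completed tensor powers and $\Delta^{n-1}:\mathcal O_V\to\mathcal O_V^{\otimes n}$ the iterated coproduct. Let $\mathrm{Hom}_{poly}(\mathcal O_V^{\otimes m},\mathcal O_V^{\otimes n})$ be the span of the polydifferential operators $$f_1\otimes\cdots\otimes f_m\longmapsto P\cdot\Delta^{n-1}\Big(\frac{\partial^{|I_1|}f_1}{\partial x^{I_1}}\Big)\cdots\Delta^{n-1}\Big(\frac{\partial^{|I_m|}f_m}{\partial x^{I_m}}\Big),\qquad P\in\mathcal O_V^{\otimes n},$$ with arbitrary multi-indices $I_1,\dots,I_m$ (with the Koszul sign rule). For $k\in\mathbb Z$ let $$\mathfrak{gs}^k(\mathcal O_V)=\prod_{m,n\ge1}\Big(\mathrm{Hom}_{poly}(\mathcal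 O_V^{\otimes m},\mathcal O_V^{\otimes n})[2-m-n]\Big)^k,$$ so that a homogeneous operator of internal degree $e$ with $m$ inputs and $n$ outputs has degree $e+m+n-2$. For $f$ with $m$ inputs and $n$ outputs let $d_{\mathfrak{gs}}f=d_1f+(-1)^m d_2f$, where, with the Koszul sign rule, $$(d_1f)(v_0,\dots,v_m)=\Delta^{n-1}(v_0)\cdot f(v_1,\dots,v_m)-\sum_{i=0}^{m-1}(-1)^i f(v_0,\dots,v_iv_{i+1},\dots,v_m)+(-1)^{m+1}f(v_0,\dots,v_{m-1})\cdot\Delta^{n-1}(v_m),$$ and $d_2f:\mathcal O_V^{\otimes m}\to\mathcal O_V^{\otimes (n+1)}$ is given by the dual formula $$d_2f=(\mu\otimes f)\circ\Delta_{\mathcal O_V^{\otimes m}}-\sum_{j=0}^{n-1}(-1)^j(\mathrm{id}^{\otimes j}\otimes\Delta\otimes\mathrm{id}^{\otimes n-1-j})\circ f+(-1)^{n+1}(f\otimes\mu)\circ\Delta_{\mathcal O_V^{\otimes m}},$$ where $\mu:\mathcal O_V^{\otimes m}\to\mathcal O_V$ is the iterated product and $\Delta_{\mathcal O_V^{\otimes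 m}}$ is the coproduct of the bialgebra $\mathcal O_V^{\otimes m}$. Then $(\mathfrak{gs}^\bullet(\mathcal O_V),d_{\mathfrak{gs}})$ is a cochain complex (the Gerstenhaber–Schack complex of polydifferential operators of the bialgebra $\mathcal O_V$), and its cohomology is isomorphic, as a graded vector space, to $\mathcal O_{\mathcal V}[2]$, where $$\mathcal O_{\mathcal V}=\widehat{\odot^{\ge1}}(V[-1])\,\widehat\otimes\,\widehat{\odot^{\ge1}}(V^*[-1])$$ is the graded space of formal power series in the shifted coordinates of $V$ and $V^*$ each of whose monomials contains at least one variable of each of the two kinds. That is, $H^k(\mathfrak{gs}^\bullet(\mathcal O_V),d_{\mathfrak{gs}})\cong(\mathcal O_{\mathcal V})^{k+2}$ for every $k\in\mathbb Z$. -/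

import Mathlib

/-!
Graded-commutative formal power series, the bialgebra `O_V` of formal functions on a
finite-dimensional graded vector space, its completed tensor powers, polydifferential operators,
and the Gerstenhaber–Schack complex of polydifferential operators.
-/

noncomputable section

namespace GerstenhaberSchack

/-! ### Formal power series in graded-commuting variables -/

section Series

/-- The exponents of the monomials in variables `x s` of degrees `deg s`: since the variables of odd
degree anticommute and the characteristic is not two, these have exponent at most one. -/
def Admissible {σ : Type*} (deg : σ → ℤ) (a : σ → ℕ) : Prop :=
  ∀ s, Odd (deg s) → a s ≤ 1

/-- The completed graded symmetric algebra on finitely many variables `x s` of degrees `deg s`: the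
formal series `∑ F(a) x^a`, where `x^a` is the product of the `(x s) ^ (a s)` in increasing order of
`s`, and `x s * x t = (-1) ^ (deg s * deg t) x t * x s`. -/
def Series (K : Type*) {σ : Type*} (deg : σ → ℤ) : Type _ :=
  {a : σ → ℕ // Admissible deg a} → K

variable {K : Type*} [Field K] {σ : Type*} {deg : σ → ℤ}

instance : AddCommGroup (Series K deg) :=
  inferInstanceAs (AddCommGroup ({a : σ → ℕ // Admissible deg a} → K))

instance : Module K (Series K deg) :=
  inferInstanceAs (Module K ({a : σ → ℕ // Admissible deg a} → K))

open Classical in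
/-- The coefficient at `x^a`; it is zero if `x^a` is not an admissible monomial. -/
def coeff (F : Series K deg) (a : σ → ℕ) : K :=
  if h : Admissible deg a then F ⟨a, h⟩ else 0

/-- The series with prescribed coefficients at the admissible monomials. -/
def ofCoeff (g : (σ → ℕ) → K) : Series K deg := fun a => g a.1

lemma coeff_add (F G : Series K deg) (a : σ → ℕ) : coeff (F + G) a = coeff F a + coeff G a := by
  unfold coeff
  split_ifs
  · rfl
  · simp

lemma coeff_smul (c : K) (F : Series K deg) (a : σ → ℕ) : coeff (c • F) a = c * coeff F a := by
  unfold coeff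
  split_ifs
  · rfl
  · simp

lemma ofCoeff_add (g h : (σ → ℕ) → K) :
    (ofCoeff (fun a => g a + h a) : Series K deg) = ofCoeff g + ofCoeff h := rfl

lemma ofCoeff_smul (c : K) (g : (σ → ℕ) → K) :
    (ofCoeff (fun a => c * g a) : Series K deg) = c • ofCoeff g := rfl

/-- The sign `(-1) ^ d` of a degree `d`. -/
def sgn (K : Type*) [Field K] (d : ℤ) : K := (-1) ^ d.natAbs

variable [Fintype σ]

/-- The degree of the monomial `x^a`. -/
def degree (deg : σ → ℤ) (a : σ → ℕ) : ℤ := ∑ s, (a s : ℤ) * deg s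

/-- A series all of whose monomials have degree `d`. -/
def IsHomogeneous (F : Series K deg) (d : ℤ) : Prop :=
  ∀ a, coeff F a ≠ 0 → degree deg a = d

variable [LinearOrder σ]

/-- The Koszul sign in `x^a * x^b = koszul a b • x^(a+b)`. -/
def koszul (K : Type*) [Field K] (deg : σ → ℤ) (a b : σ → ℕ) : K :=
  ∏ s, ∏ t with t < s, sgn K ((a s * deg s) * (b t * deg t))

instance : Mul (Series K deg) :=
  ⟨fun F G => ofCoeff fun c =>
    ∑ a ∈ Finset.Iic c, koszul K deg a (c - a) * (coeff F a * coeff G (c - a))⟩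

instance : One (Series K deg) :=
  ⟨ofCoeff fun a => if a = 0 then 1 else 0⟩

/-- The variable `x s`. -/
def var (s : σ) : Series K deg := ofCoeff fun a => if a = Pi.single s 1 then 1 else 0

/-- Multiplication by `P` from the left. -/
def mulLeft (P : Series K deg) : Series K deg →ₗ[K] Series K deg where
  toFun F := P * F
  map_add' F G := by
    change ofCoeff _ = ofCoeff _ + ofCoeff _
    rw [← ofCoeff_add]
    congr 1
    funext c
    simp only [coeff_add, mul_add, Finset.sum_add_distrib]
  map_smul' c F := by
    change ofCoeff _ = c • ofCoeff _
    rw [← ofCoeff_smul]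
    congr 1
    funext b
    simp only [coeff_smul, Finset.mul_sum]
    refine Finset.sum_congr rfl fun a _ => ?_
    ring

/-- The (left) partial derivative `∂ / ∂ (x s)`, a graded derivation of degree `-deg s`. -/
def partialD (s : σ) : Series K deg →ₗ[K] Series K deg where
  toFun F := ofCoeff fun a =>
    (∏ t with t < s, sgn K (deg s * (a t * deg t))) * (a s + 1) * coeff F (a + Pi.single s 1)
  map_add' F G := by
    rw [← ofCoeff_add]
    congr 1
    funext a
    simp only [coeff_add, mul_add]
  map_smul' c F := by
    simp only [RingHom.id_apply]
    rw [← ofCoeff_smul]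
    congr 1
    funext a
    simp only [coeff_smul]
    ring

/-- The iterated derivative `∂^|I| / ∂ x^I`. -/
def iteratedPartial (I : σ → ℕ) : Module.End K (Series K deg) :=
  (((Finset.univ : Finset σ).sort (· ≤ ·)).map fun s => (partialD s : Module.End K _) ^ I s).prod

end Series

/-! ### The bialgebra `O_V` and its completed tensor powers -/

section Tensor

variable {K : Type*} [Field K] {ι : Type*} {deg : ι → ℤ}

/-- Let `V` be the graded vector space with homogeneous basis `x i` of degrees `deg i`. The variable
`x (k, i)` of the `n`-fold completed tensor power of `O_V` is
`1 ⊗ ⋯ ⊗ x i ⊗ ⋯ ⊗ 1`, with `x i` in the `k`-th factor. -/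
def tensorDeg (deg : ι → ℤ) (n : ℕ) : Fin n ×ₗ ι → ℤ := fun t => deg (ofLex t).2

/-- The `n`-fold completed tensor power of `O_V`, with its graded algebra structure. The ordered
monomials are `x^(a 0) ⊗ ⋯ ⊗ x^(a (n-1))`. -/
abbrev OTensor (K : Type*) {ι : Type*} (deg : ι → ℤ) (n : ℕ) : Type _ := Series K (tensorDeg deg n)

/-- The exponent of the first tensor factor of a monomial. -/
def headExp {n : ℕ} (a : Fin (n + 1) ×ₗ ι → ℕ) : ι → ℕ := fun i => a (toLex (0, i))

/-- The exponent of the other tensor factors. -/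
def tailExp {n : ℕ} (a : Fin (n + 1) ×ₗ ι → ℕ) : Fin n ×ₗ ι → ℕ :=
  fun t => a (toLex ((ofLex t).1.succ, (ofLex t).2))

/-- The exponent of `x^c ⊗ x^a`. -/
def consExp {n : ℕ} (c : ι → ℕ) (a : Fin n ×ₗ ι → ℕ) : Fin (n + 1) ×ₗ ι → ℕ :=
  fun t => Fin.cases (c (ofLex t).2) (fun k => a (toLex (k, (ofLex t).2))) (ofLex t).1

/-- The exponent of the last tensor factor of a monomial. -/
def lastExp {n : ℕ} (a : Fin (n + 1) ×ₗ ι → ℕ) : ι → ℕ := fun i => a (toLex (Fin.last n, i))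

/-- The exponent of the other tensor factors. -/
def initExp {n : ℕ} (a : Fin (n + 1) ×ₗ ι → ℕ) : Fin n ×ₗ ι → ℕ :=
  fun t => a (toLex ((ofLex t).1.castSucc, (ofLex t).2))

/-- The exponent of `x^a ⊗ x^c`. -/
def snocExp {n : ℕ} (a : Fin n ×ₗ ι → ℕ) (c : ι → ℕ) : Fin (n + 1) ×ₗ ι → ℕ :=
  fun t => Fin.lastCases (motive := fun _ => ℕ) (c (ofLex t).2)
    (fun k => a (toLex (k, (ofLex t).2))) (ofLex t).1

variable [Fintype ι] [LinearOrder ι]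

/-- The product over `(k, i)`, in increasing order, of the `c (k, i)`-th powers of
`∑ l ∈ r k, x (l, i)`. -/
def substMonomial (K : Type*) [Field K] (deg : ι → ℤ) {p q : ℕ} (r : Fin p → Finset (Fin q))
    (c : Fin p ×ₗ ι → ℕ) : OTensor K deg q :=
  (((Finset.univ : Finset (Fin p ×ₗ ι)).sort (· ≤ ·)).flatMap fun t =>
    List.replicate (c t) (∑ l ∈ r (ofLex t).1, var (toLex (l, (ofLex t).2)))).prod

/-- The continuous algebra homomorphism from the `p`-th to the `q`-th completed tensor power of `O_V`
that sends `x (k, i)` to `∑ l ∈ r k, x (l, i)`. The sum below is over the monomials `x^c` of the same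
polynomial degree as `x^a`; no others contribute to the coefficient at `x^a`.

All structure maps of the bialgebra `O_V` are of this form. The multiplication of two factors merges
two slots into one. The comultiplication, which makes every `x i` primitive, is the algebra
homomorphism sending `x i` to `x i ⊗ 1 + 1 ⊗ x i`, and the iterated comultiplication
`Δ^(n-1) : O_V → O_V^{⊗ n}` sends `x i` to `∑ l, x (l, i)`. -/
def slotMap {p q : ℕ} (r : Fin p → Finset (Fin q)) : OTensor K deg p →ₗ[K] OTensor K deg q where
  toFun F := ofCoeff fun a =>
    ∑ c ∈ Finset.piAntidiag Finset.univ (∑ t, a t), coeff F c * coeff (substMonomial K deg r c) a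
  map_add' F G := by
    rw [← ofCoeff_add]
    congr 1
    funext a
    simp only [coeff_add, add_mul, Finset.sum_add_distrib]
  map_smul' c F := by
    simp only [RingHom.id_apply]
    rw [← ofCoeff_smul]
    congr 1
    funext a
    simp only [coeff_smul, Finset.mul_sum, mul_assoc]

/-- Multiplication of the (adjacent) tensor factors `j` and `j + 1`:
`id^{⊗ j} ⊗ μ ⊗ id^{⊗ (p-1-j)}`. -/
def multAt {p : ℕ} (j : Fin p) : OTensor K deg (p + 1) →ₗ[K] OTensor K deg p :=
  slotMap fun k => {j.predAbove k}

/-- Comultiplication of the tensor factor `j`: `id^{⊗ j} ⊗ Δ ⊗ id^{⊗ (q-1-j)}`. -/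
def comultAt {q : ℕ} (j : Fin q) : OTensor K deg q →ₗ[K] OTensor K deg (q + 1) :=
  slotMap fun k => Finset.univ.filter fun l => j.predAbove l = k

/-- `w₀ ⊗ w ↦ Δ^(q-1)(w₀) · w`, the product being that of the algebra `O_V^{⊗ q}`. -/
def leftAct (q : ℕ) : OTensor K deg (q + 1) →ₗ[K] OTensor K deg q :=
  slotMap fun k => Fin.cases (motive := fun _ => Finset (Fin q)) Finset.univ (fun j => {j}) k

/-- `w ⊗ w₀ ↦ w · Δ^(q-1)(w₀)`. -/
def rightAct (q : ℕ) : OTensor K deg (q + 1) →ₗ[K] OTensor K deg q :=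
  slotMap fun k => Fin.lastCases (motive := fun _ => Finset (Fin q)) Finset.univ (fun j => {j}) k

/-- The left coaction `v₁ ⊗ ⋯ ⊗ v_p ↦ ∑ ± (v₁' ⋯ v_p') ⊗ (v₁'' ⊗ ⋯ ⊗ v_p'')`, where
`Δ v = ∑ v' ⊗ v''`; it is an algebra homomorphism. -/
def leftCoact (p : ℕ) : OTensor K deg p →ₗ[K] OTensor K deg (p + 1) :=
  slotMap fun k => {0, k.succ}

/-- The right coaction `v₁ ⊗ ⋯ ⊗ v_p ↦ ∑ ± (v₁' ⊗ ⋯ ⊗ v_p') ⊗ (v₁'' ⋯ v_p'')`. -/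
def rightCoact (p : ℕ) : OTensor K deg p →ₗ[K] OTensor K deg (p + 1) :=
  slotMap fun k => {k.castSucc, Fin.last p}

/-- The operator `id ⊗ f`, with the Koszul sign `(id ⊗ f)(v ⊗ w) = (-1)^(|f| |v|) v ⊗ f(w)`: the
series `∑_c x^c ⊗ F_c` goes to `∑_c ± x^c ⊗ f(F_c)`. The two signs in the formula produce the Koszul
sign for each homogeneous component of `f`. -/
def idTensor {p q : ℕ} (f : OTensor K deg p →ₗ[K] OTensor K deg q) :
    OTensor K deg (p + 1) →ₗ[K] OTensor K deg (q + 1) where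
  toFun F := ofCoeff fun b =>
    sgn K (degree deg (headExp b) * degree (tensorDeg deg q) (tailExp b)) *
      coeff (f (ofCoeff fun a =>
        sgn K (degree deg (headExp b) * degree (tensorDeg deg p) a) *
          coeff F (consExp (headExp b) a))) (tailExp b)
  map_add' F G := by
    rw [← ofCoeff_add]
    congr 1
    funext b
    simp only [coeff_add, mul_add, ofCoeff_add, map_add]
  map_smul' c F := by
    simp only [RingHom.id_apply]
    rw [← ofCoeff_smul]
    congr 1
    funext b
    simp only [coeff_smul, mul_left_comm _ c, ofCoeff_smul, map_smul]

/-- The operator `f ⊗ id`: the series `∑_c F_c ⊗ x^c` goes to `∑_c f(F_c) ⊗ x^c`. -/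
def tensorId {p q : ℕ} (f : OTensor K deg p →ₗ[K] OTensor K deg q) :
    OTensor K deg (p + 1) →ₗ[K] OTensor K deg (q + 1) where
  toFun F := ofCoeff fun b =>
    coeff (f (ofCoeff fun a => coeff F (snocExp a (lastExp b)))) (initExp b)
  map_add' F G := by
    rw [← ofCoeff_add]
    congr 1
    funext b
    simp only [coeff_add, ofCoeff_add, map_add]
  map_smul' c F := by
    simp only [RingHom.id_apply]
    rw [← ofCoeff_smul]
    congr 1
    funext b
    simp only [coeff_smul, ofCoeff_smul, map_smul]

lemma idTensor_apply {p q : ℕ} (f : OTensor K deg p →ₗ[K] OTensor K deg q)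
    (F : OTensor K deg (p + 1)) : idTensor f F = ofCoeff fun b =>
    sgn K (degree deg (headExp b) * degree (tensorDeg deg q) (tailExp b)) *
      coeff (f (ofCoeff fun a =>
        sgn K (degree deg (headExp b) * degree (tensorDeg deg p) a) *
          coeff F (consExp (headExp b) a))) (tailExp b) := rfl

lemma tensorId_apply {p q : ℕ} (f : OTensor K deg p →ₗ[K] OTensor K deg q)
    (F : OTensor K deg (p + 1)) : tensorId f F = ofCoeff fun b =>
    coeff (f (ofCoeff fun a => coeff F (snocExp a (lastExp b)))) (initExp b) := rfl

lemma idTensor_add {p q : ℕ} (f g : OTensor K deg p →ₗ[K] OTensor K deg q) :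
    idTensor (f + g) = idTensor f + idTensor g := by
  refine LinearMap.ext fun F => ?_
  rw [LinearMap.add_apply, idTensor_apply, idTensor_apply, idTensor_apply, ← ofCoeff_add]
  congr 1
  funext b
  simp only [LinearMap.add_apply, coeff_add, mul_add]

lemma idTensor_smul {p q : ℕ} (c : K) (f : OTensor K deg p →ₗ[K] OTensor K deg q) :
    idTensor (c • f) = c • idTensor f := by
  refine LinearMap.ext fun F => ?_
  rw [LinearMap.smul_apply, idTensor_apply, idTensor_apply, ← ofCoeff_smul]
  congr 1
  funext b
  simp only [LinearMap.smul_apply, coeff_smul, mul_left_comm _ c]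

lemma tensorId_add {p q : ℕ} (f g : OTensor K deg p →ₗ[K] OTensor K deg q) :
    tensorId (f + g) = tensorId f + tensorId g := by
  refine LinearMap.ext fun F => ?_
  rw [LinearMap.add_apply, tensorId_apply, tensorId_apply, tensorId_apply, ← ofCoeff_add]
  congr 1
  funext b
  simp only [LinearMap.add_apply, coeff_add]

lemma tensorId_smul {p q : ℕ} (c : K) (f : OTensor K deg p →ₗ[K] OTensor K deg q) :
    tensorId (c • f) = c • tensorId f := by
  refine LinearMap.ext fun F => ?_
  rw [LinearMap.smul_apply, tensorId_apply, tensorId_apply, ← ofCoeff_smul]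
  congr 1
  funext b
  simp only [LinearMap.smul_apply, coeff_smul]

/-! ### Polydifferential operators -/

/-- The polydifferential operator
`f₁ ⊗ ⋯ ⊗ f_m ↦ P · Δ^(n-1)(∂^|I₁| f₁ / ∂ x^I₁) ⋯ Δ^(n-1)(∂^|I_m| f_m / ∂ x^I_m)`
with coefficient `P` in `O_V^{⊗ n}`. The map in the middle is the algebra homomorphism
`f₁ ⊗ ⋯ ⊗ f_m ↦ Δ^(n-1)(f₁) ⋯ Δ^(n-1)(f_m)`. -/
def polyOp {m n : ℕ} (P : OTensor K deg n) (I : Fin m ×ₗ ι → ℕ) :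
    OTensor K deg m →ₗ[K] OTensor K deg n :=
  mulLeft P ∘ₗ slotMap (fun _ => Finset.univ) ∘ₗ iteratedPartial I

/-- `Hom_poly(O_V^{⊗ m}, O_V^{⊗ n})`, spanned by the polydifferential operators. -/
def HomPoly (K : Type*) [Field K] (deg : ι → ℤ) (m n : ℕ) :
    Submodule K (OTensor K deg m →ₗ[K] OTensor K deg n) :=
  Submodule.span K (Set.range fun t : OTensor K deg n × (Fin m ×ₗ ι → ℕ) => polyOp t.1 t.2)

/-- The operator `f` is homogeneous of degree `e`. -/
def HasDegree {m n : ℕ} (f : OTensor K deg m →ₗ[K] OTensor K deg n) (e : ℤ) : Prop :=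
  ∀ (F : OTensor K deg m) (d : ℤ), IsHomogeneous F d → IsHomogeneous (f F) (d + e)

lemma isHomogeneous_add {σ : Type*} [Fintype σ] {dg : σ → ℤ} {F G : Series K dg} {d : ℤ}
    (hF : IsHomogeneous F d) (hG : IsHomogeneous G d) : IsHomogeneous (F + G) d := by
  intro a ha
  rw [coeff_add] at ha
  by_cases h : coeff F a = 0
  · exact hG a fun h' => ha (by rw [h, h', add_zero])
  · exact hF a h

lemma isHomogeneous_smul {σ : Type*} [Fintype σ] {dg : σ → ℤ} {F : Series K dg} {d : ℤ} (c : K)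
    (hF : IsHomogeneous F d) : IsHomogeneous (c • F) d := by
  intro a ha
  rw [coeff_smul] at ha
  exact hF a (right_ne_zero_of_mul ha)

lemma isHomogeneous_zero {σ : Type*} [Fintype σ] {dg : σ → ℤ} {d : ℤ} :
    IsHomogeneous (0 : Series K dg) d := by
  have h := coeff_smul (0 : K) (0 : Series K dg)
  intro a ha
  simp only [smul_zero, zero_mul] at h
  exact absurd (h a) ha

/-! ### The Gerstenhaber–Schack complex -/

/-- The Hochschild-type part of the differential: `(d₁ f)(v₀, …, v_p)` equals
`Δ^(q-1)(v₀) · f(v₁, …, v_p) - ∑ (-1)^i f(v₀, …, v_i v_{i+1}, …, v_p)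
  + (-1)^(p+1) f(v₀, …, v_{p-1}) · Δ^(q-1)(v_p)`. -/
def dMult {p q : ℕ} :
    (OTensor K deg p →ₗ[K] OTensor K deg q) →ₗ[K] (OTensor K deg (p + 1) →ₗ[K] OTensor K deg q) where
  toFun f := leftAct q ∘ₗ idTensor f - (∑ i : Fin p, (-1 : K) ^ (i : ℕ) • f ∘ₗ multAt i)
    + (-1 : K) ^ (p + 1) • rightAct q ∘ₗ tensorId f
  map_add' f g := by
    simp only [idTensor_add, tensorId_add, LinearMap.comp_add, LinearMap.add_comp, smul_add,
      Finset.sum_add_distrib]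
    abel
  map_smul' c f := by
    simp only [idTensor_smul, tensorId_smul, LinearMap.comp_smul, LinearMap.smul_comp,
      RingHom.id_apply, smul_add, smul_sub, Finset.smul_sum, smul_comm c]

/-- The dual, coHochschild-type part `d₂` of the differential. -/
def dComult {p q : ℕ} :
    (OTensor K deg p →ₗ[K] OTensor K deg q) →ₗ[K] (OTensor K deg p →ₗ[K] OTensor K deg (q + 1)) where
  toFun f := idTensor f ∘ₗ leftCoact p - (∑ j : Fin q, (-1 : K) ^ (j : ℕ) • comultAt j ∘ₗ f)
    + (-1 : K) ^ (q + 1) • tensorId f ∘ₗ rightCoact p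
  map_add' f g := by
    simp only [idTensor_add, tensorId_add, LinearMap.comp_add, LinearMap.add_comp, smul_add,
      Finset.sum_add_distrib]
    abel
  map_smul' c f := by
    simp only [idTensor_smul, tensorId_smul, LinearMap.comp_smul, LinearMap.smul_comp,
      RingHom.id_apply, smul_add, smul_sub, Finset.smul_sum, smul_comm c]

/-- The families `(f m n)` of linear maps `f m n : O_V^{⊗ (m+1)} → O_V^{⊗ (n+1)}`, `m, n ≥ 0`. -/
abbrev Families (K : Type*) [Field K] {ι : Type*} (deg : ι → ℤ) : Type _ :=
  ∀ m n : ℕ, OTensor K deg (m + 1) →ₗ[K] OTensor K deg (n + 1)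

/-- The part of the Gerstenhaber–Schack differential that raises the number of inputs. -/
def gsD₁ (K : Type*) [Field K] (deg : ι → ℤ) : Families K deg →ₗ[K] Families K deg where
  toFun f := fun m n => match m with
    | 0 => 0
    | m + 1 => dMult (f m n)
  map_add' f g := by
    funext m n
    cases m with
    | zero => simp
    | succ m => exact map_add dMult (f m n) (g m n)
  map_smul' c f := by
    funext m n
    cases m with
    | zero => simp
    | succ m => exact map_smul dMult c (f m n)

/-- The part of the Gerstenhaber–Schack differential that raises the number of outputs; the sign
`(-1)^(number of inputs)` makes it anticommute with the other part. -/
def gsD₂ (K : Type*) [Field K] (deg : ι → ℤ) : Families K deg →ₗ[K] Families K deg where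
  toFun f := fun m n => match n with
    | 0 => 0
    | n + 1 => (-1 : K) ^ (m + 1) • dComult (f m n)
  map_add' f g := by
    funext m n
    cases n with
    | zero => simp
    | succ n =>
      change (-1 : K) ^ (m + 1) • dComult (f m n + g m n) =
        (-1 : K) ^ (m + 1) • dComult (f m n) + (-1 : K) ^ (m + 1) • dComult (g m n)
      rw [map_add, smul_add]
  map_smul' c f := by
    funext m n
    cases n with
    | zero => simp
    | succ n =>
      change (-1 : K) ^ (m + 1) • dComult (c • f m n) = c • (-1 : K) ^ (m + 1) • dComult (f m n)
      rw [map_smul, smul_comm]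

/-- The Gerstenhaber–Schack differential. -/
def gsD (K : Type*) [Field K] (deg : ι → ℤ) : Families K deg →ₗ[K] Families K deg :=
  gsD₁ K deg + gsD₂ K deg

/-- The degree `k` part of the (completed) graded vector space
`⨁_{m, n ≥ 1} Hom_poly(O_V^{⊗ m}, O_V^{⊗ n})[2 - m - n]`, where `W[s]^i = W^(i+s)`: an operator of
degree `e` with `m` inputs and `n` outputs has degree `e + m + n - 2`. (The indices below are one
less than the numbers of inputs and outputs.) -/
def gs (K : Type*) [Field K] (deg : ι → ℤ) (k : ℤ) : Submodule K (Families K deg) where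
  carrier := {f | ∀ m n : ℕ, f m n ∈ HomPoly K deg (m + 1) (n + 1) ∧ HasDegree (f m n) (k - m - n)}
  add_mem' hf hg m n :=
    ⟨add_mem (hf m n).1 (hg m n).1, fun F d hF =>
      isHomogeneous_add ((hf m n).2 F d hF) ((hg m n).2 F d hF)⟩
  zero_mem' _ _ := ⟨zero_mem _, fun _ _ _ => isHomogeneous_zero⟩
  smul_mem' c _ hf m n :=
    ⟨Submodule.smul_mem _ c (hf m n).1, fun F d hF => isHomogeneous_smul c ((hf m n).2 F d hF)⟩

/-- The cocycles of degree `k`. -/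
def gsCocycles (K : Type*) [Field K] (deg : ι → ℤ) (k : ℤ) : Submodule K (Families K deg) :=
  gs K deg k ⊓ LinearMap.ker (gsD K deg)

/-- The coboundaries of degree `k`. -/
def gsCoboundaries (K : Type*) [Field K] (deg : ι → ℤ) (k : ℤ) : Submodule K (Families K deg) :=
  (gs K deg (k - 1)).map (gsD K deg)

/-- The cohomology of the Gerstenhaber–Schack complex in degree `k`: cocycles modulo coboundaries. -/
abbrev gsCohomology (K : Type*) [Field K] (deg : ι → ℤ) (k : ℤ) : Type _ :=
  gsCocycles K deg k ⧸ (gsCoboundaries K deg k).submoduleOf (gsCocycles K deg k)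

end Tensor

/-! ### Formal functions on `V[-1] ⊕ V*[-1]` -/

section Target

variable {ι : Type*}

/-- The degrees of the variables `s x i` (basis of `V[-1]`) and `s p i` (basis of `V*[-1]`), where
`p i` is the basis of `V*` dual to `x i`, of degree `-deg i`, and `W[-1]^d = W^(d-1)`. -/
def shiftedDeg (deg : ι → ℤ) : ι ⊕ ι → ℤ := Sum.elim (fun i => deg i + 1) (fun i => -deg i + 1)

variable [Fintype ι]

/-- The degree `k` part of the completed tensor product of the completed symmetric algebras, both
without constant term, on `V[-1]` and on `V*[-1]`: the formal series, homogeneous of degree `k`, in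
the variables `s x i` and `s p i`, all of whose monomials contain at least one of the first kind and
at least one of the second. -/
def shiftedFunctions (K : Type*) [Field K] (deg : ι → ℤ) (k : ℤ) :
    Submodule K (Series K (shiftedDeg deg)) where
  carrier := {F | IsHomogeneous F k ∧
    ∀ a, coeff F a ≠ 0 → (∃ i, a (Sum.inl i) ≠ 0) ∧ ∃ i, a (Sum.inr i) ≠ 0}
  add_mem' {F G} hF hG := by
    refine ⟨isHomogeneous_add hF.1 hG.1, fun a ha => ?_⟩
    rw [coeff_add] at ha
    by_cases h : coeff F a = 0
    · exact hG.2 a fun h' => ha (by rw [h, h', add_zero])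
    · exact hF.2 a h
  zero_mem' := by
    refine ⟨isHomogeneous_zero, fun a ha => absurd ?_ ha⟩
    have h := coeff_smul (0 : K) (0 : Series K (shiftedDeg deg)) a
    simpa only [smul_zero, zero_mul] using h
  smul_mem' c F hF := by
    refine ⟨isHomogeneous_smul c hF.1, fun a ha => ?_⟩
    rw [coeff_smul] at ha
    exact hF.2 a (right_ne_zero_of_mul ha)

end Target

end GerstenhaberSchack

end

noncomputable section

namespace GerstenhaberSchack

/-! ### Signs -/

section Signs

variable {K : Type*} [Field K]

/-! Taking symbols turns the complex into a tensor product of two cobar complexes. A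
polydifferential operator is encoded by `P ⊗ G`: `P` is its coefficient in the output tensor power,
and `G` is a polynomial in the variables of the input tensor power, with `x^I` standing for `∂^I`.
This encoding is faithful and detects degrees, because evaluation at monomials is triangular
(`mem_homPoly_iff`, `opOfSymbol_injective`, `mem_symbolDegree_of_hasDegree`). By the chain rule,
multiplying two inputs is dual to comultiplying the symbol. Hence `d₁` acts on `G` alone and `d₂` on
`P` alone, each as the cobar differential (`dMult_symbolOp`, `dComult_symbolOp`). In particular `d²
= 0` reduces to `cobar_cobar`.

The cobar complex splits by multidegree `β`, the exponents of the `x i` summed over all tensor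
factors. Polarization `polar` turns a series of multidegree `β` into a function on words of length
`N = |β|`: a word says in which tensor factor each of the `N` derivatives is taken. Restitution is a
one-sided inverse, and both maps respect the differentials. So the part of multidegree `β` is a
retract of the relative cochains of the cube of dimension `N` modulo its boundary, whose cohomology
is a line in dimension `N`. `wordHtpy_spec` contracts these cochains by induction on `N`: the cube
is a prism over a smaller cube, partial shuffle sums contract the cochains that need not vanish on
the top of the prism, and the defect on the top is corrected by the contraction of the smaller cube.

The form dual to the surviving line is antisymmetrized evaluation at permutations. Polarized series
obey Koszul signs, so the form vanishes as soon as a variable of even degree is repeated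
(`cobarForm_eq_zero`). Otherwise it takes the value one on an explicit cocycle
(`cobarForm_cocycle`). The classes in the `n`-th tensor power are therefore the monomials of
polynomial degree `n` in variables of shifted parity (`cobarHtpy_spec`).

The contractions of the two cobar complexes combine to one of the total complex, up to the product
of the projections (`symbolHtpy_spec`). A surviving pair `(α, β)` with `|α|` outputs and `|β|`
inputs is a monomial in the shifted coordinates of `V` and `V*`. Both parts are nonempty because
there is at least one output and one input, and the shifts account for the degree `k + 2`.

Most identities between maps of series are proved by coinduction (`eq_zero_of_coinduction`): in
characteristic zero, two families of series agree if their constant terms agree and the differences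
are stable under derivatives up to linear combinations. -/

lemma sgn_of_even {d : ℤ} (h : Even d) : sgn K d = 1 :=
  (Int.natAbs_even.2 h).neg_one_pow

lemma sgn_of_odd {d : ℤ} (h : Odd d) : sgn K d = -1 :=
  (Int.natAbs_odd.2 h).neg_one_pow

@[simp] lemma sgn_zero : sgn K 0 = 1 := by simp [sgn]

lemma sgn_add (a b : ℤ) : sgn K (a + b) = sgn K a * sgn K b := by
  rcases Int.even_or_odd a with ha | ha <;> rcases Int.even_or_odd b with hb | hb
  · rw [sgn_of_even ha, sgn_of_even hb, sgn_of_even (ha.add hb), one_mul]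
  · rw [sgn_of_even ha, sgn_of_odd hb, sgn_of_odd (ha.add_odd hb), one_mul]
  · rw [sgn_of_odd ha, sgn_of_even hb, sgn_of_odd (ha.add_even hb), mul_one]
  · rw [sgn_of_odd ha, sgn_of_odd hb, sgn_of_even (ha.add_odd hb)]; ring

@[simp] lemma sgn_mul_self (a : ℤ) : sgn K a * sgn K a = 1 := by
  rw [← sgn_add, sgn_of_even (Even.add_self a)]

lemma sgn_sum {α : Type*} (s : Finset α) (f : α → ℤ) :
    sgn K (∑ x ∈ s, f x) = ∏ x ∈ s, sgn K (f x) := by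
  classical
  induction s using Finset.induction_on with
  | empty => simp
  | insert a s ha ih => rw [Finset.sum_insert ha, Finset.prod_insert ha, sgn_add, ih]

end Signs

/-! ### Coefficients -/

section Series

set_option linter.unusedSectionVars false

variable {K : Type*} [Field K] {σ : Type*} {deg : σ → ℤ}

lemma coeff_of_not_admissible {F : Series K deg} {a : σ → ℕ} (h : ¬ Admissible deg a) :
    coeff F a = 0 := dif_neg h

lemma coeff_ofCoeff {g : (σ → ℕ) → K} {a : σ → ℕ} (h : Admissible deg a) :
    coeff (ofCoeff g : Series K deg) a = g a := dif_pos h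

/-- `ofCoeff` forgets the values at inadmissible exponents; when those are zero anyway, coefficient
formulas hold for every exponent and need no side condition afterwards. -/
lemma coeff_ofCoeff_of_imp {g : (σ → ℕ) → K} {a : σ → ℕ} (h : ¬ Admissible deg a → g a = 0) :
    coeff (ofCoeff g : Series K deg) a = g a := by
  by_cases ha : Admissible deg a
  · exact coeff_ofCoeff ha
  · rw [coeff_of_not_admissible ha, h ha]

lemma series_ext {F G : Series K deg} (h : ∀ a, Admissible deg a → coeff F a = coeff G a) :
    F = G := by
  funext a
  have := h a.1 a.2
  simpa [coeff, a.2] using this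

variable (K deg) in
/-- The coefficient at `x^a` as a linear form. -/
def coeffL (a : σ → ℕ) : Series K deg →ₗ[K] K where
  toFun F := coeff F a
  map_add' F G := coeff_add F G a
  map_smul' c F := coeff_smul c F a

@[simp] lemma coeffL_apply (a : σ → ℕ) (F : Series K deg) : coeffL K deg a F = coeff F a := rfl

@[simp] lemma coeff_zero (a : σ → ℕ) : coeff (0 : Series K deg) a = 0 :=
  map_zero (coeffL K deg a)

lemma coeff_sub (F G : Series K deg) (a : σ → ℕ) : coeff (F - G) a = coeff F a - coeff G a :=
  map_sub (coeffL K deg a) F G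

lemma coeff_sum {α : Type*} (s : Finset α) (F : α → Series K deg) (a : σ → ℕ) :
    coeff (∑ x ∈ s, F x) a = ∑ x ∈ s, coeff (F x) a :=
  map_sum (coeffL K deg a) F s

lemma Admissible.of_le {a b : σ → ℕ} (h : Admissible deg b) (hab : a ≤ b) : Admissible deg a :=
  fun s hs => (hab s).trans (h s hs)

lemma admissible_zero : Admissible deg (0 : σ → ℕ) := fun _ _ => Nat.zero_le _

variable [Fintype σ]

lemma degree_add (a b : σ → ℕ) : degree deg (a + b) = degree deg a + degree deg b := by
  simp [degree, add_mul, Finset.sum_add_distrib]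

@[simp] lemma degree_zero : degree deg (0 : σ → ℕ) = 0 := by simp [degree]

lemma degree_single [DecidableEq σ] (s : σ) : degree deg (Pi.single s 1) = deg s := by
  rw [degree, Finset.sum_eq_single s] <;> simp +contextual

/-- The operator that multiplies the coefficient at `x^a` by `(-1) ^ (d * degree a)`. -/
def tw (d : ℤ) : Series K deg →ₗ[K] Series K deg where
  toFun F := ofCoeff fun a => sgn K (d * degree deg a) * coeff F a
  map_add' F G := by simp only [coeff_add, mul_add, ofCoeff_add]
  map_smul' c F := by simp only [coeff_smul, mul_left_comm _ c, ofCoeff_smul, RingHom.id_apply]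

lemma coeff_tw (d : ℤ) (F : Series K deg) (a : σ → ℕ) :
    coeff (tw d F) a = sgn K (d * degree deg a) * coeff F a := by
  refine coeff_ofCoeff_of_imp (g := fun a => sgn K (d * degree deg a) * coeff F a) fun h => ?_
  rw [coeff_of_not_admissible h, mul_zero]

lemma tw_tw (d : ℤ) (F : Series K deg) : tw d (tw d F) = F :=
  series_ext fun a _ => by rw [coeff_tw, coeff_tw, ← mul_assoc, sgn_mul_self, one_mul]

lemma tw_add_tw (d e : ℤ) (F : Series K deg) : tw (d + e) F = tw d (tw e F) :=
  series_ext fun a _ => by rw [coeff_tw, coeff_tw, coeff_tw, add_mul, sgn_add, mul_assoc]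

@[simp] lemma tw_zero (F : Series K deg) : tw 0 F = F :=
  series_ext fun a _ => by rw [coeff_tw, zero_mul, sgn_zero, one_mul]

/-! ### Signs from reordering monomials. -/

variable [LinearOrder σ]

/-- The sign produced by moving `x s` past the variables before `s` in `x^a`. -/
def lam (K : Type*) [Field K] (deg : σ → ℤ) (s : σ) (a : σ → ℕ) : K :=
  ∏ t with t < s, sgn K (deg s * (a t * deg t))

lemma lam_add (s : σ) (a b : σ → ℕ) : lam K deg s (a + b) = lam K deg s a * lam K deg s b := by
  simp only [lam, ← Finset.prod_mul_distrib, ← sgn_add]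
  refine Finset.prod_congr rfl fun t _ => ?_
  congr 1
  push_cast [Pi.add_apply]
  ring

lemma lam_mul_self (s : σ) (a : σ → ℕ) : lam K deg s a * lam K deg s a = 1 := by
  simp [lam, ← Finset.prod_mul_distrib]

lemma lam_ne_zero (s : σ) (a : σ → ℕ) : lam K deg s a ≠ 0 := fun h => by
  simpa [h] using lam_mul_self (K := K) (deg := deg) s a

@[simp] lemma lam_zero (s : σ) : lam K deg s 0 = 1 := by simp [lam]

lemma lam_single (s t : σ) :
    lam K deg s (Pi.single t 1) = if t < s then sgn K (deg s * deg t) else 1 := by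
  rw [lam]
  split_ifs with h
  · rw [Finset.prod_eq_single t] <;> simp +contextual [h]
  · refine Finset.prod_eq_one fun u hu => ?_
    have : u ≠ t := by rintro rfl; exact h (by simpa using hu)
    simp [this]

lemma koszul_add_left (a a' b : σ → ℕ) :
    koszul K deg (a + a') b = koszul K deg a b * koszul K deg a' b := by
  simp only [koszul, ← Finset.prod_mul_distrib, ← sgn_add]
  refine Finset.prod_congr rfl fun s _ => Finset.prod_congr rfl fun t _ => ?_
  congr 1
  push_cast [Pi.add_apply]
  ring

lemma koszul_add_right (a b b' : σ → ℕ) :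
    koszul K deg a (b + b') = koszul K deg a b * koszul K deg a b' := by
  simp only [koszul, ← Finset.prod_mul_distrib, ← sgn_add]
  refine Finset.prod_congr rfl fun s _ => Finset.prod_congr rfl fun t _ => ?_
  congr 1
  push_cast [Pi.add_apply]
  ring

@[simp] lemma koszul_zero_left (b : σ → ℕ) : koszul K deg 0 b = 1 := by simp [koszul]

@[simp] lemma koszul_zero_right (a : σ → ℕ) : koszul K deg a 0 = 1 := by simp [koszul]

lemma koszul_single_left (s : σ) (b : σ → ℕ) : koszul K deg (Pi.single s 1) b = lam K deg s b := by
  rw [koszul, Finset.prod_eq_single s]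
  · simp [lam]
  · intro u _ hu
    simp [hu]
  · simp

/-- Moving `x s` through `x^a` from the right to its place, and on to the left end. -/
lemma koszul_single_right (s : σ) (a : σ → ℕ) :
    lam K deg s a * koszul K deg a (Pi.single s 1) =
      sgn K (deg s * degree deg a) * sgn K (deg s * (a s * deg s)) := by
  have h1 : koszul K deg a (Pi.single s 1) = ∏ t with s < t, sgn K (deg s * (a t * deg t)) := by
    rw [koszul, Finset.prod_filter]
    refine Finset.prod_congr rfl fun u _ => ?_
    split_ifs with h
    · rw [Finset.prod_eq_single s]
      · simp [mul_comm]
      · intro v _ hv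
        simp [hv]
      · simp [h]
    · refine Finset.prod_eq_one fun v hv => ?_
      have : v ≠ s := by rintro rfl; exact h (by simpa using hv)
      simp [this]
  have h2 : sgn K (deg s * degree deg a) = ∏ t, sgn K (deg s * (a t * deg t)) := by
    rw [degree, Finset.mul_sum, sgn_sum]
  rw [h1, h2, lam, Finset.prod_filter, Finset.prod_filter, ← Finset.prod_mul_distrib,
    ← Finset.prod_erase_mul _ _ (Finset.mem_univ s)]
  conv_rhs => rw [← Finset.prod_erase_mul _ _ (Finset.mem_univ s), mul_assoc, sgn_mul_self]
  simp only [lt_self_iff_false, if_false, mul_one]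
  refine Finset.prod_congr rfl fun t ht => ?_
  rcases lt_or_gt_of_ne (Finset.ne_of_mem_erase ht) with h | h
  · simp [h, h.not_gt]
  · simp [h, h.not_gt]

/-! ### Products, derivatives and the principle of coinduction. -/

lemma coeff_mul {F G : Series K deg} {c : σ → ℕ} (hc : Admissible deg c) :
    coeff (F * G) c =
      ∑ a ∈ Finset.Iic c, koszul K deg a (c - a) * (coeff F a * coeff G (c - a)) :=
  coeff_ofCoeff hc

lemma coeff_partialD (s : σ) (F : Series K deg) (a : σ → ℕ) :
    coeff (partialD s F) a = lam K deg s a * (a s + 1) * coeff F (a + Pi.single s 1) := by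
  refine coeff_ofCoeff_of_imp
    (g := fun a => lam K deg s a * (a s + 1) * coeff F (a + Pi.single s 1)) fun h => ?_
  rw [coeff_of_not_admissible fun h' => h (h'.of_le le_self_add), mul_zero]

lemma coeff_one (a : σ → ℕ) : coeff (1 : Series K deg) a = if a = 0 then 1 else 0 := by
  refine coeff_ofCoeff_of_imp (g := fun a => if a = 0 then 1 else 0) fun h => if_neg ?_
  rintro rfl
  exact h admissible_zero

lemma admissible_single (s : σ) : Admissible deg (Pi.single s 1) := fun t _ => by
  rw [Pi.single_apply]; split_ifs <;> simp

lemma coeff_var (s : σ) (a : σ → ℕ) :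
    coeff (var s : Series K deg) a = if a = Pi.single s 1 then 1 else 0 := by
  refine coeff_ofCoeff_of_imp (g := fun a => if a = Pi.single s 1 then 1 else 0)
    fun h => if_neg ?_
  rintro rfl
  exact h (admissible_single s)

variable (K deg) in
/-- The multiplication as a bilinear map. -/
def mulB : Series K deg →ₗ[K] Series K deg →ₗ[K] Series K deg :=
  LinearMap.mk₂ K (fun F G => F * G)
    (fun F F' G => series_ext fun c hc => by
      simp only [coeff_mul hc, coeff_add, add_mul, mul_add, Finset.sum_add_distrib])
    (fun k F G => series_ext fun c hc => by
      simp only [coeff_mul hc, coeff_smul, Finset.mul_sum]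
      exact Finset.sum_congr rfl fun _ _ => by ring)
    (fun F G G' => map_add (mulLeft F) G G')
    (fun k F G => map_smul (mulLeft F) k G)

lemma mulLeft_apply (F G : Series K deg) : mulLeft F G = F * G := rfl

lemma add_mul' (F F' G : Series K deg) : (F + F') * G = F * G + F' * G :=
  LinearMap.map_add₂ (mulB K deg) F F' G

lemma mul_add' (F G G' : Series K deg) : F * (G + G') = F * G + F * G' :=
  map_add (mulB K deg F) G G'

lemma smul_mul' (k : K) (F G : Series K deg) : (k • F) * G = k • (F * G) :=
  LinearMap.map_smul₂ (mulB K deg) k F G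

lemma mul_smul' (k : K) (F G : Series K deg) : F * (k • G) = k • (F * G) :=
  map_smul (mulB K deg F) k G

lemma zero_mul' (G : Series K deg) : 0 * G = 0 := LinearMap.map_zero₂ (mulB K deg) G

lemma mul_zero' (F : Series K deg) : F * 0 = 0 := map_zero (mulB K deg F)

lemma sub_mul' (F F' G : Series K deg) : (F - F') * G = F * G - F' * G :=
  LinearMap.map_sub₂ (mulB K deg) F F' G

lemma sum_mul' {α : Type*} (s : Finset α) (F : α → Series K deg) (G : Series K deg) :
    (∑ x ∈ s, F x) * G = ∑ x ∈ s, F x * G :=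
  LinearMap.map_sum₂ (mulB K deg) s F G

lemma mul_sum' {α : Type*} (s : Finset α) (F : Series K deg) (G : α → Series K deg) :
    F * (∑ x ∈ s, G x) = ∑ x ∈ s, F * G x :=
  map_sum (mulB K deg F) G s

lemma mul_one' (F : Series K deg) : F * 1 = F := by
  refine series_ext fun c hc => ?_
  rw [coeff_mul hc, Finset.sum_eq_single c]
  · simp [coeff_one]
  · intro a ha hac
    have : c - a ≠ 0 := fun h => hac (le_antisymm (Finset.mem_Iic.1 ha) (tsub_eq_zero_iff_le.1 h))
    simp [coeff_one, this]
  · simp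

lemma one_mul' (F : Series K deg) : 1 * F = F := by
  refine series_ext fun c hc => ?_
  rw [coeff_mul hc, Finset.sum_eq_single 0]
  · simp [coeff_one]
  · intro a _ ha
    simp [coeff_one, ha]
  · simp

lemma coeff_zero_mul (F G : Series K deg) : coeff (F * G) 0 = coeff F 0 * coeff G 0 := by
  rw [coeff_mul admissible_zero, Finset.sum_eq_single 0]
  · simp
  · intro a ha ha'
    exact absurd (le_antisymm (Finset.mem_Iic.1 ha) bot_le) ha'
  · simp

lemma sub_single_add {a : σ → ℕ} {s : σ} (h : a s ≠ 0) : a - Pi.single s 1 + Pi.single s 1 = a := by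
  refine tsub_add_cancel_of_le fun t => ?_
  rw [Pi.single_apply]
  split_ifs with ht
  · subst ht; exact Nat.one_le_iff_ne_zero.2 h
  · exact Nat.zero_le _

/-- The reindexing for terms of the Leibniz rule in which the derivative falls on the first factor;
its companion below serves the second factor. -/
lemma sum_Iic_add_single (s : σ) (c : σ → ℕ) (f : (σ → ℕ) → K) (hf : ∀ a, a s = 0 → f a = 0) :
    ∑ a ∈ Finset.Iic (c + Pi.single s 1), f a = ∑ a ∈ Finset.Iic c, f (a + Pi.single s 1) := by
  symm
  refine Finset.sum_bij_ne_zero (fun a _ _ => a + Pi.single s 1) ?_ ?_ ?_ ?_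
  · intro a ha _
    exact Finset.mem_Iic.2 (add_le_add_left (Finset.mem_Iic.1 ha) _)
  · intro a _ _ b _ _ h
    exact add_right_cancel h
  · intro b hb hb0
    have h0 : b s ≠ 0 := fun h => hb0 (hf b h)
    refine ⟨b - Pi.single s 1, ?_, ?_, sub_single_add h0⟩
    · exact Finset.mem_Iic.2 (tsub_le_iff_right.2 (Finset.mem_Iic.1 hb))
    · rwa [sub_single_add h0]
  · intro a _ _; rfl

lemma sum_Iic_add_single' (s : σ) (c : σ → ℕ) (f : (σ → ℕ) → K)
    (hf : ∀ a, a s = c s + 1 → f a = 0) :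
    ∑ a ∈ Finset.Iic (c + Pi.single s 1), f a = ∑ a ∈ Finset.Iic c, f a := by
  symm
  refine Finset.sum_subset (Finset.Iic_subset_Iic.2 le_self_add) fun a ha ha' => hf a ?_
  rw [Finset.mem_Iic] at ha ha'
  have h1 : a s ≤ c s + 1 := by simpa using ha s
  by_contra h2
  refine ha' fun t => ?_
  by_cases ht : t = s
  · subst ht; exact Nat.lt_succ_iff.1 (lt_of_le_of_ne h1 h2)
  · simpa [Pi.single_apply, ht] using ha t

lemma coeff_var_mul (s : σ) (G : Series K deg) {c : σ → ℕ} (hc : Admissible deg c) :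
    coeff (var s * G) c =
      if c s = 0 then 0 else lam K deg s (c - Pi.single s 1) * coeff G (c - Pi.single s 1) := by
  rw [coeff_mul hc]
  split_ifs with h
  · refine Finset.sum_eq_zero fun a ha => ?_
    have : a ≠ Pi.single s 1 := by
      rintro rfl
      have := Finset.mem_Iic.1 ha s
      simp [h] at this
    simp [coeff_var, this]
  · rw [Finset.sum_eq_single (Pi.single s 1)]
    · simp [coeff_var, koszul_single_left]
    · intro a _ ha
      simp [coeff_var, ha]
    · intro h'
      exact absurd (Finset.mem_Iic.2 ((sub_single_add h).symm ▸ le_add_self)) h'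

/-- The graded Leibniz rule. -/
theorem partialD_mul (s : σ) (F G : Series K deg) :
    partialD s (F * G) = partialD s F * G + tw (deg s) F * partialD s G := by
  refine series_ext fun c hc => ?_
  rw [coeff_add, coeff_mul hc, coeff_mul hc, coeff_partialD]
  have hsub : ∀ a ∈ Finset.Iic c, c + Pi.single s 1 - a = (c - a) + Pi.single s 1 := fun a ha =>
    tsub_add_eq_add_tsub (Finset.mem_Iic.1 ha) |>.symm
  -- If `c + e_s` is inadmissible, the left side vanishes for lack of a coefficient, and the two
  -- sums on the right have to cancel.
  by_cases hce : Admissible deg (c + Pi.single s 1)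
  · rw [coeff_mul hce, mul_assoc, Finset.mul_sum]
    -- The factor `c s + 1` is the exponent of `x s` in the product monomial, hence the sum of its
    -- exponents in the two factors. This splits the sum into the two halves of the Leibniz rule.
    have hsplit : ∀ a ∈ Finset.Iic (c + Pi.single s 1),
        ((c s : K) + 1) * (koszul K deg a (c + Pi.single s 1 - a) *
          (coeff F a * coeff G (c + Pi.single s 1 - a))) =
        (a s : K) * (koszul K deg a (c + Pi.single s 1 - a) *
          (coeff F a * coeff G (c + Pi.single s 1 - a))) +
        (((c + Pi.single s 1 - a : σ → ℕ) s : ℕ) : K) * (koszul K deg a (c + Pi.single s 1 - a) *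
          (coeff F a * coeff G (c + Pi.single s 1 - a))) := by
      intro a ha
      rw [← add_mul]
      congr 1
      have : a s ≤ c s + 1 := by simpa using Finset.mem_Iic.1 ha s
      have h2 : c s + 1 = a s + (c + Pi.single s 1 - a : σ → ℕ) s := by
        simp only [Pi.sub_apply, Pi.add_apply, Pi.single_eq_same]
        omega
      rw [← Nat.cast_add, ← h2, Nat.cast_succ]
    rw [Finset.sum_congr rfl hsplit, Finset.sum_add_distrib, mul_add]
    congr 1
    · rw [sum_Iic_add_single s c _ (fun a ha => by rw [ha]; simp), Finset.mul_sum]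
      refine Finset.sum_congr rfl fun a ha => ?_
      rw [coeff_partialD, add_tsub_add_eq_tsub_right, koszul_add_left, koszul_single_left]
      have hc' : lam K deg s c = lam K deg s a * lam K deg s (c - a) := by
        rw [← lam_add, add_tsub_cancel_of_le (Finset.mem_Iic.1 ha)]
      have h1 := lam_mul_self (K := K) (deg := deg) s (c - a)
      have h3 : (((a + Pi.single s 1 : σ → ℕ) s : ℕ) : K) = a s + 1 := by simp
      rw [hc', h3]
      linear_combination (lam K deg s a * (a s + 1) * koszul K deg a (c - a) *
        coeff F (a + Pi.single s 1) * coeff G (c - a)) * h1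
    · rw [sum_Iic_add_single' s c _ (fun a ha => by simp [ha]), Finset.mul_sum]
      refine Finset.sum_congr rfl fun a ha => ?_
      rw [coeff_partialD, coeff_tw, hsub a ha, koszul_add_right]
      -- Moving `x s` past its own powers in `x^a` costs a sign only if `x s` is odd and occurs in
      -- `a`; then the coefficient of `G` is inadmissible and the term is zero.
      by_cases hs : a s ≠ 0 ∧ Odd (deg s)
      · have h0 : coeff G (c - a + Pi.single s 1) = 0 := by
          refine coeff_of_not_admissible fun h => ?_
          have h1 := hce s hs.2
          have h2 : a s ≤ c s := Finset.mem_Iic.1 ha s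
          simp only [Pi.add_apply, Pi.single_eq_same] at h1
          omega
        simp [h0]
      · have hev : sgn K (deg s * (a s * deg s)) = 1 := by
          rw [not_and_or, not_not, Int.not_odd_iff_even] at hs
          rcases hs with hs | hs
          · simp [hs]
          · exact sgn_of_even (hs.mul_right _)
        have hk := koszul_single_right (K := K) (deg := deg) s a
        rw [hev, mul_one] at hk
        have hc' : lam K deg s c = lam K deg s a * lam K deg s (c - a) := by
          rw [← lam_add, add_tsub_cancel_of_le (Finset.mem_Iic.1 ha)]
        have h3 : ((((c - a + Pi.single s 1 : σ → ℕ)) s : ℕ) : K) = ((c - a) s : ℕ) + 1 := by simp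
        rw [hc', h3]
        linear_combination (lam K deg s (c - a) * (((c - a) s : ℕ) + 1) * koszul K deg a (c - a) *
          coeff F a * coeff G (c - a + Pi.single s 1)) * hk
  · rw [coeff_of_not_admissible hce, mul_zero]
    obtain ⟨hodd, hcs⟩ : Odd (deg s) ∧ c s = 1 := by
      by_contra hcon
      refine hce fun t ht => ?_
      by_cases hts : t = s
      · subst hts
        have h0 : c t = 0 := by
          by_contra h0
          exact hcon ⟨ht, le_antisymm (hc t ht) (Nat.one_le_iff_ne_zero.2 h0)⟩
        simp [h0]
      · simpa [Pi.single_apply, hts] using hc t ht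
    have hinadm : ∀ (H : Series K deg) (a : σ → ℕ), a s ≠ 0 → coeff H (a + Pi.single s 1) = 0 := by
      intro H a ha
      refine coeff_of_not_admissible fun h => ?_
      have := h s hodd
      simp only [Pi.add_apply, Pi.single_eq_same] at this
      omega
    -- Write `c = c' + e_s` with `x s` odd and absent from `c'`. After reindexing, both sums run
    -- over `a ≤ c'` and involve the same product of coefficients with opposite signs.
    obtain ⟨c', rfl⟩ : ∃ c' : σ → ℕ, c = c' + Pi.single s 1 :=
      ⟨_, (sub_single_add (a := c) (s := s) (by rw [hcs]; exact one_ne_zero)).symm⟩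
    have hc's : c' s = 0 := by simpa using hcs
    rw [sum_Iic_add_single' s c', sum_Iic_add_single s c', ← Finset.sum_add_distrib]
    · refine (Finset.sum_eq_zero fun a ha => ?_).symm
      have has : a s = 0 := by exact Nat.le_zero.1 (hc's ▸ Finset.mem_Iic.1 ha s)
      have hsub' : c' + Pi.single s 1 - a = (c' - a) + Pi.single s 1 :=
        tsub_add_eq_add_tsub (Finset.mem_Iic.1 ha) |>.symm
      rw [add_tsub_add_eq_tsub_right, hsub', koszul_add_left, koszul_add_right, koszul_single_left,
        coeff_partialD, coeff_partialD, coeff_tw, degree_add, degree_single, mul_add (deg s), sgn_add,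
        sgn_of_odd (hodd.mul hodd)]
      have hk := koszul_single_right (K := K) (deg := deg) s a
      rw [has, Nat.cast_zero, zero_mul, mul_zero, sgn_zero, mul_one] at hk
      have h1 := lam_mul_self (K := K) (deg := deg) s (c' - a)
      have h4 : (c' - a) s = 0 := by simp [hc's]
      rw [has, h4]
      linear_combination (koszul K deg a (c' - a) * coeff F (a + Pi.single s 1) *
        coeff G (c' - a + Pi.single s 1)) * hk - (koszul K deg a (c' - a) *
        coeff F (a + Pi.single s 1) * coeff G (c' - a + Pi.single s 1) *
        sgn K (deg s * degree deg a)) * h1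
    · intro a ha
      rw [coeff_partialD, hinadm G _ (by simp [ha, hc's])]
      simp
    · intro a ha
      rw [coeff_partialD, hinadm F a (by omega)]
      simp

lemma partialD_one (s : σ) : partialD s (1 : Series K deg) = 0 :=
  series_ext fun a _ => by
    have : a + Pi.single s 1 ≠ 0 := fun h => by simpa using congrFun h s
    rw [coeff_partialD, coeff_one, if_neg this, mul_zero, coeff_zero]

lemma partialD_var (s t : σ) :
    partialD s (var t : Series K deg) = if s = t then 1 else 0 :=
  series_ext fun a _ => by
    rw [coeff_partialD, coeff_var]
    by_cases hst : s = t
    · subst hst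
      rw [if_pos rfl, coeff_one]
      by_cases ha : a = 0
      · simp [ha]
      · simp [ha]
    · rw [if_neg hst, coeff_zero, if_neg, mul_zero]
      intro h
      simpa [Pi.single_apply, hst] using congrFun h s

lemma tw_var (d : ℤ) (s : σ) :
    tw d (var s : Series K deg) = sgn K (d * deg s) • var s :=
  series_ext fun a _ => by
    rw [coeff_tw, coeff_smul, coeff_var]
    split_ifs with h
    · rw [h, degree_single]
    · simp

lemma tw_mul (d : ℤ) (F G : Series K deg) : tw d (F * G) = tw d F * tw d G :=
  series_ext fun c hc => by
    rw [coeff_tw, coeff_mul hc, coeff_mul hc, Finset.mul_sum]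
    refine Finset.sum_congr rfl fun a ha => ?_
    have h : degree deg c = degree deg a + degree deg (c - a) := by
      rw [← degree_add, add_tsub_cancel_of_le (Finset.mem_Iic.1 ha)]
    rw [coeff_tw, coeff_tw, h, mul_add, sgn_add]
    ring

lemma partialD_tw (s : σ) (d : ℤ) (F : Series K deg) :
    partialD s (tw d F) = sgn K (d * deg s) • tw d (partialD s F) :=
  series_ext fun a _ => by
    rw [coeff_smul, coeff_tw, coeff_partialD, coeff_partialD, coeff_tw, degree_add, degree_single,
      mul_add d, sgn_add]
    ring

lemma partialD_comm (s t : σ) (F : Series K deg) :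
    partialD s (partialD t F) = sgn K (deg s * deg t) • partialD t (partialD s F) := by
  by_cases hst : s = t
  · subst hst
    rcases Int.even_or_odd (deg s) with h | h
    · rw [sgn_of_even (h.mul_right _), one_smul]
    · suffices partialD s (partialD s F) = 0 by rw [this, smul_zero]
      refine series_ext fun a _ => ?_
      rw [coeff_partialD, coeff_partialD, coeff_zero, coeff_of_not_admissible]
      · simp
      · intro h'
        have := h' s h
        simp at this
  · refine series_ext fun a _ => ?_
    simp only [coeff_smul, coeff_partialD, lam_add, lam_single, Pi.add_apply,
      Pi.single_eq_of_ne hst, Pi.single_eq_of_ne (Ne.symm hst), add_zero]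
    rw [add_right_comm a]
    rcases lt_or_gt_of_ne hst with h | h
    · rw [if_neg h.not_gt, if_pos h, mul_comm (deg t)]
      ring
    · rw [if_neg h.not_gt, if_pos h]
      linear_combination (-(lam K deg s a * (a s + 1) * (lam K deg t a * (a t + 1) *
        coeff F (a + Pi.single t 1 + Pi.single s 1)))) * sgn_mul_self (K := K) (deg s * deg t)

/-- A series is determined by the constant terms of its iterated derivatives: the principle of
coinduction. -/
theorem eq_zero_of_coinduction [CharZero K] (Z : Set (Series K deg))
    (h0 : ∀ F ∈ Z, coeff F 0 = 0)
    (h1 : ∀ F ∈ Z, ∀ s, partialD s F ∈ Submodule.span K Z) {F : Series K deg} (hF : F ∈ Z) :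
    F = 0 := by
  have h0' : ∀ F ∈ Submodule.span K Z, coeff F 0 = 0 := fun F hF => by
    have : Submodule.span K Z ≤ LinearMap.ker (coeffL K deg 0) := Submodule.span_le.2 h0
    exact this hF
  have h1' : ∀ F ∈ Submodule.span K Z, ∀ s, partialD s F ∈ Submodule.span K Z := fun F hF s => by
    have : Submodule.span K Z ≤ (Submodule.span K Z).comap (partialD s) :=
      Submodule.span_le.2 fun F hF => h1 F hF s
    exact this hF
  have key : ∀ (N : ℕ) (a : σ → ℕ), ∑ t, a t = N → ∀ F ∈ Submodule.span K Z, coeff F a = 0 := by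
    intro N
    induction N with
    | zero =>
      intro a ha F hF
      obtain rfl : a = 0 := by
        funext t
        exact Finset.sum_eq_zero_iff.1 ha t (Finset.mem_univ t)
      exact h0' F hF
    | succ N ih =>
      intro a ha F hF
      obtain ⟨s, hs⟩ : ∃ s, a s ≠ 0 := by
        by_contra! h
        simp [h] at ha
      have h2 := ih (a - Pi.single s 1) (by
        have h3 := congrArg (fun b : σ → ℕ => ∑ t, b t) (sub_single_add hs)
        simp only [Pi.add_apply, Finset.sum_add_distrib, Finset.sum_pi_single', Finset.mem_univ,
          if_true] at h3
        simp only [Pi.sub_apply] at h3 ⊢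
        omega) _ (h1' F hF s)
      rw [coeff_partialD, sub_single_add hs] at h2
      -- Characteristic zero enters here: a coefficient of positive polynomial degree is recovered
      -- from the derivative only if the exponent is invertible.
      have h4 : (((a - Pi.single s 1 : σ → ℕ) s : ℕ) : K) + 1 ≠ 0 := Nat.cast_add_one_ne_zero _
      exact (mul_eq_zero.1 h2).resolve_left (mul_ne_zero (lam_ne_zero _ _) h4)
  exact series_ext fun a _ => by rw [key _ a rfl F (Submodule.subset_span hF), coeff_zero]

end Series

end GerstenhaberSchack

end

noncomputable section

namespace GerstenhaberSchack

/-! ### Substitution homomorphisms between tensor powers. -/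

section Tensor

set_option linter.unusedSectionVars false

variable {K : Type*} [Field K] {ι : Type*} {deg : ι → ℤ} [Fintype ι] [LinearOrder ι]

/-- The partial derivative in the variable `x i` of the tensor factor `k`. -/
abbrev pd {n : ℕ} (k : Fin n) (i : ι) : OTensor K deg n →ₗ[K] OTensor K deg n :=
  partialD (toLex (k, i))

/-- The variable `x i` of the tensor factor `k`. -/
abbrev xv {n : ℕ} (k : Fin n) (i : ι) : OTensor K deg n := var (toLex (k, i))

@[simp] lemma tensorDeg_toLex (n : ℕ) (k : Fin n) (i : ι) :
    tensorDeg deg n (toLex (k, i)) = deg i := rfl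

lemma sum_lex {M : Type*} [AddCommMonoid M] {n : ℕ} (f : Fin n ×ₗ ι → M) :
    ∑ t, f t = ∑ k, ∑ i, f (toLex (k, i)) := by
  rw [← Fintype.sum_prod_type' (f := fun k i => f (toLex (k, i)))]
  exact (Fintype.sum_equiv toLex _ _ fun _ => rfl).symm

/-! ### The chain rule -/

section Chain

variable {p q : ℕ} (r : Fin p → Finset (Fin q))

variable (K deg) in
/-- The image of the variable `t` under `slotMap r`. -/
def slotVar (t : Fin p ×ₗ ι) : OTensor K deg q := ∑ l ∈ r (ofLex t).1, xv l (ofLex t).2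

variable (K deg) in
/-- The part of `substMonomial` belonging to the variables in a list. -/
def substProd (L : List (Fin p ×ₗ ι)) (c : Fin p ×ₗ ι → ℕ) : OTensor K deg q :=
  (L.flatMap fun t => List.replicate (c t) (slotVar K deg r t)).prod

/-- Powers are written as powers of a left multiplication operator, so that associativity of the
product of series is never used. -/
lemma prod_replicate_append {σ : Type*} [Fintype σ] [LinearOrder σ] {dg : σ → ℤ} (b : ℕ)
    (x : Series K dg) (l : List (Series K dg)) :
    (List.replicate b x ++ l).prod = ((mulLeft x : Module.End K (Series K dg)) ^ b) l.prod := by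
  induction b with
  | zero => simp
  | succ b ih =>
    rw [List.replicate_succ, List.cons_append, List.prod_cons, ih, pow_succ']
    rfl

lemma substProd_cons (t : Fin p ×ₗ ι) (L : List (Fin p ×ₗ ι)) (c : Fin p ×ₗ ι → ℕ) :
    substProd K deg r (t :: L) c =
      ((mulLeft (slotVar K deg r t) : Module.End K _) ^ c t) (substProd K deg r L c) := by
  rw [substProd, List.flatMap_cons, prod_replicate_append]
  rfl

lemma substProd_congr {L : List (Fin p ×ₗ ι)} {c c' : Fin p ×ₗ ι → ℕ} (h : ∀ t ∈ L, c t = c' t) :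
    substProd K deg r L c = substProd K deg r L c' := by
  rw [substProd, substProd]
  congr 1
  exact List.flatMap_congr fun t ht => by rw [h t ht]

variable (K) in
/-- The derivative of `slotVar`. -/
def slotCoeff (s : Fin q ×ₗ ι) (t : Fin p ×ₗ ι) : K :=
  if (ofLex s).1 ∈ r (ofLex t).1 ∧ (ofLex s).2 = (ofLex t).2 then 1 else 0

/-- All variables in `slotVar` have the degree of `t`, so the twist in the graded Leibniz rule
reduces to one scalar sign. -/
lemma partialD_slotVar_mul (s : Fin q ×ₗ ι) (t : Fin p ×ₗ ι) (G : OTensor K deg q) :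
    partialD s (slotVar K deg r t * G) = slotCoeff K r s t • G +
      sgn K (tensorDeg deg q s * tensorDeg deg p t) • (slotVar K deg r t * partialD s G) := by
  rw [partialD_mul, ← smul_mul']
  congr 1
  · have : partialD s (slotVar K deg r t) = slotCoeff K r s t • 1 := by
      obtain ⟨s, rfl⟩ := toLex.surjective s
      rw [slotVar, map_sum]
      simp only [partialD_var, EmbeddingLike.apply_eq_iff_eq]
      by_cases h : s.1 ∈ r (ofLex t).1 ∧ s.2 = (ofLex t).2
      · have hs : slotCoeff K r (toLex s) t = 1 := if_pos h
        rw [hs, Finset.sum_eq_single s.1]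
        · rw [if_pos (show s = (s.1, (ofLex t).2) from Prod.ext rfl h.2), one_smul]
        · intro l _ hl
          rw [if_neg]
          rintro rfl
          exact hl rfl
        · exact fun h' => absurd h.1 h'
      · have hs : slotCoeff K r (toLex s) t = 0 := if_neg h
        rw [hs, zero_smul]
        refine Finset.sum_eq_zero fun l hl => if_neg ?_
        rintro rfl
        exact h ⟨hl, rfl⟩
    rw [this, smul_mul', one_mul']
  · congr 1
    rw [slotVar, map_sum, Finset.smul_sum]
    refine Finset.sum_congr rfl fun l _ => ?_
    rw [tw_var]
    rfl

/-- A nonzero `slotCoeff` forces the two variables to have the same index in `ι`, hence the same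
degree. Signs of the target may thus be computed in the source. -/
lemma slotCoeff_mul_congr {s : Fin q ×ₗ ι} {t : Fin p ×ₗ ι} (f : ℤ → K) :
    slotCoeff K r s t * f (tensorDeg deg q s) = slotCoeff K r s t * f (tensorDeg deg p t) := by
  rw [slotCoeff]
  split_ifs with h
  · rw [tensorDeg, tensorDeg, h.2]
  · simp

/-- For an even variable all signs are trivial and this is the usual power rule; an odd variable
occurs at most once, so its case is covered by `b ≤ 1`. -/
lemma partialD_slotVar_pow (s : Fin q ×ₗ ι) (t : Fin p ×ₗ ι) (b : ℕ)
    (hb : Odd (tensorDeg deg p t) → b ≤ 1) (G : OTensor K deg q) :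
    partialD s (((mulLeft (slotVar K deg r t) : Module.End K _) ^ b) G) =
      (slotCoeff K r s t * b) • ((mulLeft (slotVar K deg r t) : Module.End K _) ^ (b - 1)) G +
      sgn K (tensorDeg deg q s * (b * tensorDeg deg p t)) •
        ((mulLeft (slotVar K deg r t) : Module.End K _) ^ b) (partialD s G) := by
  induction b with
  | zero => simp
  | succ b ih =>
    rw [pow_succ', Module.End.mul_apply, mulLeft_apply, partialD_slotVar_mul,
      ih fun h => (hb h).trans' (Nat.le_succ b)]
    rcases Nat.eq_zero_or_pos b with rfl | hpos
    · simp [mulLeft_apply]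
    · have hev : Even (tensorDeg deg p t) := by
        by_contra h
        have := hb (Int.not_even_iff_odd.1 h)
        omega
      obtain ⟨b, rfl⟩ : ∃ b', b = b' + 1 := ⟨b - 1, by omega⟩
      rw [sgn_of_even (hev.mul_left _), sgn_of_even ((hev.mul_left _).mul_left _),
        sgn_of_even ((hev.mul_left _).mul_left _)]
      simp only [Nat.add_sub_cancel, pow_succ', Module.End.mul_apply, mulLeft_apply, mul_add',
        mul_smul', one_smul, Nat.cast_add, Nat.cast_one, mul_add, add_smul, mul_one]
      abel

/-- The list is increasing, so the variables that the derivative has passed before reaching `t` are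
exactly those below `t`; this is what turns the accumulated sign into `lam` later. -/
lemma partialD_substProd (s : Fin q ×ₗ ι) (L : List (Fin p ×ₗ ι)) (hL : L.Pairwise (· < ·))
    (c : Fin p ×ₗ ι → ℕ) (hc : Admissible (tensorDeg deg p) c) :
    partialD s (substProd K deg r L c) = ∑ t ∈ L.toFinset, (slotCoeff K r s t *
      (∏ u ∈ L.toFinset with u < t, sgn K (tensorDeg deg q s * (c u * tensorDeg deg p u))) * c t) •
        substProd K deg r L (c - Pi.single t 1) := by
  induction L with
  | nil => simp [substProd, partialD_one]
  | cons t L ih =>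
    obtain ⟨ht, hL⟩ := List.pairwise_cons.1 hL
    have htL : t ∉ L.toFinset := fun h => (ht t (List.mem_toFinset.1 h)).false
    rw [substProd_cons, partialD_slotVar_pow r s t (c t) (hc t), ih hL, List.toFinset_cons,
      Finset.sum_insert htL]
    congr 1
    · have h1 : {u ∈ insert t L.toFinset | u < t} = (∅ : Finset _) := by
        refine Finset.filter_eq_empty_iff.2 fun u hu => ?_
        rcases Finset.mem_insert.1 hu with rfl | hu
        · exact lt_irrefl u
        · exact (ht u (List.mem_toFinset.1 hu)).not_gt
      rw [h1, Finset.prod_empty, mul_one, substProd_cons]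
      congr 1
      rw [Pi.sub_apply, Pi.single_eq_same]
      congr 1
      refine substProd_congr r fun u hu => ?_
      have : u ≠ t := (ht u hu).ne'
      simp [this]
    · rw [map_sum, Finset.smul_sum]
      refine Finset.sum_congr rfl fun u hu => ?_
      have hut := ht u (List.mem_toFinset.1 hu)
      rw [map_smul, smul_smul, substProd_cons]
      congr 1
      · rw [Finset.filter_insert, if_pos hut, Finset.prod_insert]
        · ring
        · exact fun h => htL (Finset.mem_filter.1 h).1
      · congr 2
        simp [hut.ne]

lemma partialD_substMonomial (s : Fin q ×ₗ ι) (c : Fin p ×ₗ ι → ℕ)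
    (hc : Admissible (tensorDeg deg p) c) :
    partialD s (substMonomial K deg r c) = ∑ t, (slotCoeff K r s t *
      lam K (tensorDeg deg p) t c * c t) • substMonomial K deg r (c - Pi.single t 1) := by
  have h := partialD_substProd (K := K) r s _ (Finset.sortedLT_sort Finset.univ).pairwise c hc
  rw [Finset.sort_toFinset] at h
  refine h.trans (Finset.sum_congr rfl fun t _ => ?_)
  congr 2
  exact slotCoeff_mul_congr r fun d => ∏ u with u < t, sgn K (d * (c u * tensorDeg deg p u))

lemma coeff_slotMap (F : OTensor K deg p) (a : Fin q ×ₗ ι → ℕ) :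
    coeff (slotMap r F) a = ∑ c ∈ Finset.piAntidiag Finset.univ (∑ t, a t),
      coeff F c * coeff (substMonomial K deg r c) a := by
  refine coeff_ofCoeff_of_imp (g := fun a => ∑ c ∈ Finset.piAntidiag Finset.univ (∑ t, a t),
      coeff F c * coeff (substMonomial K deg r c) a) fun h => ?_
  exact Finset.sum_eq_zero fun c _ => by rw [coeff_of_not_admissible h, mul_zero]

lemma sum_piAntidiag_succ {σ : Type*} [Fintype σ] [DecidableEq σ] (t : σ) (N : ℕ)
    (f : (σ → ℕ) → K) (hf : ∀ c, c t = 0 → f c = 0) :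
    ∑ c ∈ Finset.piAntidiag Finset.univ (N + 1), f c =
      ∑ c ∈ Finset.piAntidiag Finset.univ N, f (c + Pi.single t 1) := by
  symm
  refine Finset.sum_bij_ne_zero (fun c _ _ => c + Pi.single t 1) ?_ ?_ ?_ ?_
  · intro c hc _
    rw [Finset.mem_piAntidiag] at hc ⊢
    simp [Finset.sum_add_distrib, hc.1]
  · intro c _ _ c' _ _ h
    exact add_right_cancel h
  · intro c hc h0
    have h : c t ≠ 0 := fun h => h0 (hf c h)
    have h2 : c - Pi.single t 1 + Pi.single t 1 = c := by
      refine tsub_add_cancel_of_le fun u => ?_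
      rw [Pi.single_apply]
      split_ifs with hu
      · subst hu; exact Nat.one_le_iff_ne_zero.2 h
      · exact Nat.zero_le _
    refine ⟨c - Pi.single t 1, ?_, by rwa [h2], h2⟩
    rw [Finset.mem_piAntidiag] at hc ⊢
    have h3 := congrArg (fun b : σ → ℕ => ∑ t, b t) h2
    simp only [Pi.add_apply, Finset.sum_add_distrib, Finset.sum_pi_single', Finset.mem_univ,
      if_true, hc.1] at h3
    exact ⟨by simpa using h3, fun _ _ => Finset.mem_univ _⟩
  · intro _ _ _; rfl

/-- The chain rule. -/
theorem pd_slotMap (l : Fin q) (i : ι) (F : OTensor K deg p) :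
    pd l i (slotMap r F) = ∑ k with l ∈ r k, slotMap r (pd k i F) := by
  refine series_ext fun a ha => ?_
  have hsum : ∑ t, (a + Pi.single (toLex (l, i)) 1 : Fin q ×ₗ ι → ℕ) t = ∑ t, a t + 1 := by
    simp [Finset.sum_add_distrib]
  have h1 : coeff (pd l i (slotMap r F)) a =
      ∑ c ∈ Finset.piAntidiag Finset.univ (∑ t, a t + 1), coeff F c *
        coeff (partialD (toLex (l, i)) (substMonomial K deg r c)) a := by
    rw [coeff_partialD, coeff_slotMap, hsum, Finset.mul_sum]
    refine Finset.sum_congr rfl fun c _ => ?_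
    rw [coeff_partialD]
    ring
  -- Differentiating the substituted monomial requires admissible exponents; at the others the
  -- coefficient of `F` already vanishes.
  have h2 : ∀ c, coeff F c * coeff (partialD (toLex (l, i)) (substMonomial K deg r c)) a =
      ∑ t, slotCoeff K r (toLex (l, i)) t * (lam K (tensorDeg deg p) t c * c t *
        coeff F c * coeff (substMonomial K deg r (c - Pi.single t 1)) a) := by
    intro c
    by_cases hc : Admissible (tensorDeg deg p) c
    · rw [partialD_substMonomial r _ c hc, coeff_sum, Finset.mul_sum]
      refine Finset.sum_congr rfl fun t _ => ?_
      rw [coeff_smul]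
      ring
    · simp [coeff_of_not_admissible hc]
  rw [h1, Finset.sum_congr rfl fun c _ => h2 c, Finset.sum_comm, coeff_sum, sum_lex]
  simp only [← Finset.mul_sum]
  -- Lowering the exponent of `t` by one identifies the sum with a coefficient of the substituted
  -- derivative: the factor `lam * c t` is that of `partialD`.
  have h3 : ∀ t : Fin p ×ₗ ι, ∑ c ∈ Finset.piAntidiag Finset.univ (∑ t, a t + 1),
      (lam K (tensorDeg deg p) t c * c t *
        coeff F c * coeff (substMonomial K deg r (c - Pi.single t 1)) a) =
      coeff (slotMap r (partialD t F)) a := by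
    intro t
    rw [sum_piAntidiag_succ t _ _ (fun c hc => by simp [hc]), coeff_slotMap]
    refine Finset.sum_congr rfl fun c _ => ?_
    rw [coeff_partialD, add_tsub_cancel_right, lam_add, lam_single, if_neg (lt_irrefl t)]
    simp
  simp only [h3]
  rw [Finset.sum_filter]
  refine Finset.sum_congr rfl fun k _ => ?_
  rw [Finset.sum_eq_single i]
  · simp [slotCoeff]
  · intro j _ hj
    simp [slotCoeff, hj.symm]
  · simp

lemma coeff_zero_slotMap (F : OTensor K deg p) : coeff (slotMap r F) 0 = coeff F 0 := by
  rw [coeff_slotMap, Finset.sum_eq_single 0]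
  · have : substMonomial K deg r 0 = 1 := by
      rw [substMonomial, List.flatMap_eq_nil_iff.2 fun t _ => by simp]
      rfl
    rw [this, coeff_one, if_pos rfl, mul_one]
  · intro c hc h
    simp only [Pi.zero_apply, Finset.sum_const_zero, Finset.piAntidiag_zero,
      Finset.mem_singleton] at hc
    exact absurd hc h
  · simp

end Chain

/-! ### Structure of the algebra homomorphisms -/

/-- The `ι`-multidegree of a monomial. -/
def wt {n : ℕ} (a : Fin n ×ₗ ι → ℕ) : ι → ℕ := fun i => ∑ k, a (toLex (k, i))

lemma wt_add {n : ℕ} (a b : Fin n ×ₗ ι → ℕ) : wt (a + b) = wt a + wt b := by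
  funext i
  simp [wt, Finset.sum_add_distrib]

@[simp] lemma wt_zero {n : ℕ} : wt (0 : Fin n ×ₗ ι → ℕ) = 0 := by
  funext i
  simp [wt]

@[simp] lemma wt_single {n : ℕ} (k : Fin n) (i : ι) :
    wt (Pi.single (toLex (k, i)) 1 : Fin n ×ₗ ι → ℕ) = Pi.single i 1 := by
  funext j
  rw [wt, Finset.sum_eq_single k]
  · simp [Pi.single_apply, EmbeddingLike.apply_eq_iff_eq]
  · intro l _ hl
    simp [EmbeddingLike.apply_eq_iff_eq, hl]
  · simp

lemma degree_wt {n : ℕ} (a : Fin n ×ₗ ι → ℕ) :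
    degree (tensorDeg deg n) a = degree deg (wt a) := by
  rw [degree, sum_lex, Finset.sum_comm, degree]
  refine Finset.sum_congr rfl fun i _ => ?_
  simp [wt, Finset.sum_mul]

lemma sum_wt {n : ℕ} (a : Fin n ×ₗ ι → ℕ) : ∑ i, wt a i = ∑ t, a t := by
  rw [sum_lex, Finset.sum_comm]
  rfl

/-- The operator that multiplies the coefficient at `x^a` by a function of the multidegree. -/
def mw {n : ℕ} (g : (ι → ℕ) → K) : OTensor K deg n →ₗ[K] OTensor K deg n where
  toFun F := ofCoeff fun a => g (wt a) * coeff F a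
  map_add' F G := by simp only [coeff_add, mul_add, ofCoeff_add]
  map_smul' c F := by simp only [coeff_smul, mul_left_comm _ c, ofCoeff_smul, RingHom.id_apply]

lemma coeff_mw {n : ℕ} (g : (ι → ℕ) → K) (F : OTensor K deg n) (a : Fin n ×ₗ ι → ℕ) :
    coeff (mw g F) a = g (wt a) * coeff F a := by
  refine coeff_ofCoeff_of_imp (g := fun a => g (wt a) * coeff F a) fun h => ?_
  rw [coeff_of_not_admissible h, mul_zero]

lemma tw_eq_mw {n : ℕ} (d : ℤ) (F : OTensor K deg n) :
    tw d F = mw (fun β => sgn K (d * degree deg β)) F :=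
  series_ext fun a _ => by rw [coeff_tw, coeff_mw, degree_wt]

lemma pd_mw {n : ℕ} (g : (ι → ℕ) → K) (k : Fin n) (i : ι) (F : OTensor K deg n) :
    pd k i (mw g F) = mw (fun β => g (β + Pi.single i 1)) (pd k i F) :=
  series_ext fun a _ => by
    rw [coeff_mw, coeff_partialD, coeff_partialD, coeff_mw, wt_add, wt_single]
    ring

/-! ### Multiplicativity and composition of substitutions, by coinduction. -/

variable [CharZero K]

lemma eq_of_coinduction {n : ℕ} {α : Type*} (A B : α → OTensor K deg n)
    (h0 : ∀ x, coeff (A x) 0 = coeff (B x) 0)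
    (h1 : ∀ x (k : Fin n) (i : ι), pd k i (A x) - pd k i (B x) ∈
      Submodule.span K (Set.range fun y => A y - B y)) (x : α) : A x = B x := by
  refine sub_eq_zero.1 (eq_zero_of_coinduction (Set.range fun y => A y - B y) ?_ ?_ ⟨x, rfl⟩)
  · rintro _ ⟨y, rfl⟩
    rw [coeff_sub, h0, sub_self]
  · rintro _ ⟨y, rfl⟩ s
    obtain ⟨⟨k, i⟩, rfl⟩ := toLex.surjective s
    rw [map_sub]
    exact h1 y k i

variable {p q : ℕ}

/-- A substitution preserves the multidegree. The coinduction runs over pairs `(g, F)`, since a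
derivative translates `g`. -/
lemma slotMap_mw (r : Fin p → Finset (Fin q)) (g : (ι → ℕ) → K) (F : OTensor K deg p) :
    slotMap r (mw g F) = mw g (slotMap r F) := by
  refine eq_of_coinduction (fun x : ((ι → ℕ) → K) × OTensor K deg p => slotMap r (mw x.1 x.2))
    (fun x => mw x.1 (slotMap r x.2)) ?_ ?_ (g, F)
  · rintro ⟨g, F⟩
    simp [coeff_zero_slotMap, coeff_mw]
  · rintro ⟨g, F⟩ l i
    simp only [pd_slotMap, pd_mw, map_sum]
    rw [← Finset.sum_sub_distrib]
    exact Submodule.sum_mem _ fun k _ => Submodule.subset_span ⟨(_, pd k i F), rfl⟩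

lemma slotMap_tw (r : Fin p → Finset (Fin q)) (d : ℤ) (F : OTensor K deg p) :
    slotMap r (tw d F) = tw d (slotMap r F) := by
  rw [tw_eq_mw, slotMap_mw, tw_eq_mw]

/-- Both sides have the same constant term, and the chain rule with the Leibniz rule expresses their
derivatives by the same formula. The coinduction is over all pairs, because derivatives introduce
`tw` of the first factor. -/
lemma slotMap_mul (r : Fin p → Finset (Fin q)) (F G : OTensor K deg p) :
    slotMap r (F * G) = slotMap r F * slotMap r G := by
  refine eq_of_coinduction (fun x : OTensor K deg p × OTensor K deg p => slotMap r (x.1 * x.2))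
    (fun x => slotMap r x.1 * slotMap r x.2) ?_ ?_ (F, G)
  · rintro ⟨F, G⟩
    simp [coeff_zero_slotMap, coeff_zero_mul]
  · rintro ⟨F, G⟩ l i
    simp only [pd_slotMap, partialD_mul, map_add, sum_mul', mul_sum', Finset.sum_add_distrib]
    rw [add_sub_add_comm, ← Finset.sum_sub_distrib, ← Finset.sum_sub_distrib]
    refine Submodule.add_mem _ (Submodule.sum_mem _ fun k _ => ?_)
      (Submodule.sum_mem _ fun k _ => ?_)
    · exact Submodule.subset_span ⟨(pd k i F, G), rfl⟩
    · rw [← slotMap_tw]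
      exact Submodule.subset_span ⟨(tw (deg i) F, pd k i G), rfl⟩

lemma slotMap_one (r : Fin p → Finset (Fin q)) : slotMap r (1 : OTensor K deg p) = 1 := by
  refine eq_of_coinduction (fun _ : Unit => slotMap r (1 : OTensor K deg p)) (fun _ => 1) ?_ ?_ ()
  · intro _
    simp [coeff_zero_slotMap, coeff_one]
  · intro _ l i
    simp [pd_slotMap, partialD_one]

lemma slotMap_xv (r : Fin p → Finset (Fin q)) (k : Fin p) (i : ι) :
    slotMap r (xv k i : OTensor K deg p) = ∑ l ∈ r k, xv l i := by
  refine eq_of_coinduction (fun _ : Unit => slotMap r (xv k i : OTensor K deg p))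
    (fun _ => ∑ l ∈ r k, xv l i) ?_ ?_ ()
  · have h : ∀ {n : ℕ} (k : Fin n), coeff (xv k i : OTensor K deg n) 0 = 0 := fun k => by
      rw [coeff_var, if_neg]
      intro h
      simpa using congrFun h (toLex (k, i))
    intro _
    simp [coeff_zero_slotMap, coeff_sum, h]
  · intro _ l j
    convert Submodule.zero_mem _
    rw [sub_eq_zero]
    simp only [pd_slotMap, partialD_var, map_sum, EmbeddingLike.apply_eq_iff_eq, Prod.mk.injEq]
    by_cases hj : j = i
    · subst hj
      simp only [and_true, apply_ite (slotMap r), slotMap_one, map_zero]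
      simp
    · simp [hj]

/-- The composite sends `x (k, i)` to the sum of the `x (l, i)` weighted by the number of
intermediate slots; the hypothesis says that these weights are `0` or `1`. -/
lemma slotMap_comp {m : ℕ} (r : Fin p → Finset (Fin q)) (r' : Fin q → Finset (Fin m))
    (r'' : Fin p → Finset (Fin m))
    (h : ∀ k l, (Finset.univ.filter fun j => j ∈ r k ∧ l ∈ r' j).card = if l ∈ r'' k then 1 else 0)
    (F : OTensor K deg p) : slotMap r' (slotMap r F) = slotMap r'' F := by
  refine eq_of_coinduction (fun F : OTensor K deg p => slotMap r' (slotMap r F))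
    (fun F => slotMap r'' F) ?_ ?_ F
  · intro F
    simp [coeff_zero_slotMap]
  · intro F l i
    have h1 : pd l i (slotMap r' (slotMap r F)) =
        ∑ k with l ∈ r'' k, slotMap r' (slotMap r (pd k i F)) := by
      simp only [pd_slotMap, map_sum, Finset.sum_filter]
      simp only [← Finset.sum_filter (p := fun j => l ∈ r' j)]
      rw [Finset.sum_comm]
      refine Finset.sum_congr rfl fun k _ => ?_
      trans ∑ j with l ∈ r' j, if j ∈ r k then slotMap r' (slotMap r (pd k i F)) else 0
      · exact Finset.sum_congr rfl fun j _ => by split_ifs <;> simp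
      rw [← Finset.sum_filter, Finset.filter_filter, Finset.sum_const]
      have h2 : (Finset.univ.filter fun j => l ∈ r' j ∧ j ∈ r k) =
          Finset.univ.filter fun j => j ∈ r k ∧ l ∈ r' j := by ext; simp [and_comm]
      rw [h2, h k l]
      split_ifs <;> simp
    rw [h1, pd_slotMap, ← Finset.sum_sub_distrib]
    exact Submodule.sum_mem _ fun k _ => Submodule.subset_span ⟨pd k i F, rfl⟩

/-- The coefficients of `slotMap r F` only depend on those of `F` of the same multidegree. -/
lemma coeff_slotMap_congr (r : Fin p → Finset (Fin q)) {F G : OTensor K deg p}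
    {a : Fin q ×ₗ ι → ℕ} (h : ∀ c, wt c = wt a → coeff F c = coeff G c) :
    coeff (slotMap r F) a = coeff (slotMap r G) a := by
  classical
  have h1 : mw (fun β => if β = wt a then 1 else 0) F =
      mw (fun β => if β = wt a then 1 else 0) G := series_ext fun c _ => by
    rw [coeff_mw, coeff_mw]
    split_ifs with hc
    · rw [h c hc]
    · rw [zero_mul, zero_mul]
  have h2 := congrArg (fun H => coeff (slotMap r H) a) h1
  simpa [slotMap_mw, coeff_mw] using h2

end Tensor

end GerstenhaberSchack

end

noncomputable section

namespace GerstenhaberSchack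

/-! ### Cochains on words

The functions on words in the letters `1, …, n` of a fixed length `N` are the relative simplicial
cochains of dimension `n` of the cube of dimension `N` modulo its boundary. -/

section Words

set_option linter.unusedSectionVars false

variable {K : Type*} [Field K]

variable (K) in
/-- The functions on words. -/
abbrev Words : Type _ := List ℕ → K

/-- The map on letters underlying the coface `i`. -/
def face (i l : ℕ) : ℕ := if l ≤ i then l else l - 1

/-- The map on letters underlying the codegeneracy `j`. -/
def degen (j l : ℕ) : ℕ := if l ≤ j then l else l + 1

/-- Pull-back along a map of letters. -/
def pull (g : ℕ → ℕ) : Words K →ₗ[K] Words K := LinearMap.funLeft K K (List.map g)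

lemma pull_apply (g : ℕ → ℕ) (φ : Words K) (w : List ℕ) : pull g φ w = φ (w.map g) := rfl

lemma pull_pull (g g' : ℕ → ℕ) (φ : Words K) : pull g (pull g' φ) = pull (g' ∘ g) φ := by
  funext w
  simp [pull_apply]

lemma pull_id (φ : Words K) : pull id φ = φ := by
  funext w
  simp [pull_apply]

/-- The part of a function on words that belongs to the first letter `l`. -/
def slice (l : ℕ) : Words K →ₗ[K] Words K := LinearMap.funLeft K K (List.cons l)

lemma slice_pull (l : ℕ) (g : ℕ → ℕ) (φ : Words K) :
    slice l (pull g φ) = pull g (slice (g l) φ) := rfl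

lemma words_ext {φ ψ : Words K} (h0 : φ [] = ψ []) (h : ∀ l, slice l φ = slice l ψ) : φ = ψ := by
  funext w
  cases w with
  | nil => exact h0
  | cons l w => exact congrFun (h l) w

/-- The function on words with prescribed slices. -/
def ofSlices {V : Type*} [AddCommGroup V] [Module K V] (f : ℕ → V →ₗ[K] Words K) :
    V →ₗ[K] Words K where
  toFun v := fun w => match w with
    | [] => 0
    | l :: w => f l v w
  map_add' φ ψ := by
    funext w
    cases w <;> simp
  map_smul' c φ := by
    funext w
    cases w <;> simp

lemma slice_ofSlices {V : Type*} [AddCommGroup V] [Module K V] (f : ℕ → V →ₗ[K] Words K) (l : ℕ)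
    (v : V) : slice l (ofSlices f v) = f l v := rfl

lemma ofSlices_nil {V : Type*} [AddCommGroup V] [Module K V] (f : ℕ → V →ₗ[K] Words K) (v : V) :
    ofSlices f v [] = 0 := rfl

/-- The alternating sum of the cofaces `i`, `a ≤ i < b`. -/
def delI (a b : ℕ) : Words K →ₗ[K] Words K :=
  ∑ i ∈ Finset.Ico a b, (-1 : K) ^ i • pull (face i)

/-- The alternating sum of the first `c` cofaces; the differential in dimension `n` is
`del (n + 2)`. -/
def del (c : ℕ) : Words K →ₗ[K] Words K := delI 0 c

lemma delI_apply (a b : ℕ) (φ : Words K) :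
    delI a b φ = ∑ i ∈ Finset.Ico a b, (-1 : K) ^ i • pull (face i) φ := by
  simp [delI]

lemma del_apply (c : ℕ) (φ : Words K) :
    del c φ = ∑ i ∈ Finset.range c, (-1 : K) ^ i • pull (face i) φ := by
  rw [del, delI_apply, Finset.range_eq_Ico]

lemma del_add_delI {a b : ℕ} (h : a ≤ b) (φ : Words K) : del a φ + delI a b φ = del b φ := by
  rw [del, del, delI_apply, delI_apply, delI_apply]
  exact Finset.sum_Ico_consecutive _ (Nat.zero_le a) h

lemma delI_self (a : ℕ) (φ : Words K) : delI a a φ = 0 := by simp [delI]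

/-- The involution `(i, j) ↔ (j - 1, i)` for `i < j` preserves the terms and reverses the sign. It
serves both the simplicial `d² = 0` and the antisymmetry of two shuffles. -/
lemma sum_alternating_eq_zero {M : Type*} [AddCommGroup M] [Module K M] (n : ℕ) (f : ℕ → ℕ → M)
    (hf : ∀ i j, i < j → f i j = f (j - 1) i) :
    ∑ i ∈ Finset.range n, ∑ j ∈ Finset.range (n + 1), ((-1 : K) ^ i * (-1) ^ j) • f i j = 0 := by
  rw [← Finset.sum_product']
  refine Finset.sum_involution
    (fun x _ => if x.1 < x.2 then (x.2 - 1, x.1) else (x.2, x.1 + 1)) ?_ ?_ ?_ ?_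
  · rintro ⟨i, j⟩ _
    by_cases h : i < j
    · obtain ⟨j, rfl⟩ : ∃ j', j = j' + 1 := ⟨j - 1, by omega⟩
      simp only [h, if_true, Nat.add_sub_cancel]
      rw [hf i (j + 1) h, Nat.add_sub_cancel, ← add_smul]
      convert zero_smul K _
      ring
    · simp only [h, if_false]
      rw [hf j (i + 1) (by omega), Nat.add_sub_cancel, ← add_smul]
      convert zero_smul K _
      ring
  · rintro ⟨i, j⟩ _ _
    by_cases h : i < j
    · simp only [h, if_true, ne_eq, Prod.mk.injEq]; omega
    · simp only [h, if_false, ne_eq, Prod.mk.injEq]; omega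
  · rintro ⟨i, j⟩ hx
    simp only [Finset.mem_product, Finset.mem_range] at hx ⊢
    by_cases h : i < j
    · simp only [h, if_true]; omega
    · simp only [h, if_false]; omega
  · rintro ⟨i, j⟩ _
    by_cases h : i < j
    · have h' : ¬ (j - 1 < i) := by omega
      simp only [h, if_true, h', if_false, Prod.mk.injEq, true_and]; omega
    · have h' : j < i + 1 := by omega
      simp only [h, if_false, h', if_true, Nat.add_sub_cancel]

lemma face_comp_face {i j : ℕ} (h : i < j) : face i ∘ face j = face (j - 1) ∘ face i := by
  funext l
  simp only [face, Function.comp_apply]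
  split_ifs <;> omega

lemma del_del (c : ℕ) (φ : Words K) : del (c + 1) (del c φ) = 0 := by
  simp only [del_apply, map_sum, map_smul, Finset.smul_sum, smul_smul]
  refine sum_alternating_eq_zero (K := K) c
    (fun i j => pull (face j) (pull (face i) φ)) fun i j h => ?_
  simp only [pull_pull]
  rw [face_comp_face h]

/-- The cofaces `i ≤ j` lower the first letter `j + 1` to `j`, the later ones leave it alone. -/
lemma slice_del {j c : ℕ} (h : j + 1 ≤ c) (φ : Words K) :
    slice (j + 1) (del c φ) = del (j + 1) (slice j φ) + delI (j + 1) c (slice (j + 1) φ) := by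
  rw [← del_add_delI h, map_add]
  congr 1
  · simp only [del_apply, map_sum, map_smul, slice_pull]
    refine Finset.sum_congr rfl fun i hi => ?_
    rw [face, if_neg (by simpa using hi), Nat.add_sub_cancel]
  · simp only [delI_apply, map_sum, map_smul, slice_pull]
    refine Finset.sum_congr rfl fun i hi => ?_
    rw [face, if_pos (Finset.mem_Ico.1 hi).1]

lemma slice_del_of_lt {l c : ℕ} (h : c < l) (φ : Words K) :
    slice l (del c φ) = del c (slice (l - 1) φ) := by
  simp only [del_apply, map_sum, map_smul, slice_pull]
  refine Finset.sum_congr rfl fun i hi => ?_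
  rw [face, if_neg]
  rw [Finset.mem_range] at hi
  omega

lemma slice_zero_del (c : ℕ) (φ : Words K) : slice 0 (del c φ) = del c (slice 0 φ) := by
  simp only [del_apply, map_sum, map_smul, slice_pull]
  rfl

/-- The codegeneracy cancels the first coface of the range and passes through the others with a
shift of the index; the shift gives the minus sign. -/
lemma degen_delI {m c : ℕ} (h : m + 1 ≤ c) (φ : Words K) :
    pull (degen m) (delI (m + 1) (c + 1) φ) =
      (-1 : K) ^ (m + 1) • φ - delI (m + 1) c (pull (degen m) φ) := by
  have h1 : face (m + 1) ∘ degen m = id := by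
    funext l
    simp only [face, degen, Function.comp_apply, id]
    split_ifs <;> omega
  simp only [delI_apply, map_sum, map_smul, pull_pull]
  rw [Finset.sum_eq_sum_Ico_succ_bot (by omega), h1, pull_id, sub_eq_add_neg,
    ← Finset.sum_neg_distrib, Finset.sum_Ico_add' (fun i => (-1 : K) ^ i • pull (face i ∘ degen m) φ)
      (m + 1) c 1 |>.symm]
  congr 1
  refine Finset.sum_congr rfl fun i hi => ?_
  rw [← neg_smul, pow_succ, mul_neg_one]
  congr 3
  funext l
  simp only [face, degen, Function.comp_apply]
  rw [Finset.mem_Ico] at hi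
  split_ifs <;> omega

/-- Here the codegeneracy cancels the last coface, and the earlier ones keep their index. The
identity term is what cancels against the one of `degen_delI` in a shuffle sum. -/
lemma degen_del (m : ℕ) (φ : Words K) :
    pull (degen (m + 1)) (del (m + 2) φ) =
      del (m + 1) (pull (degen m) φ) + (-1 : K) ^ (m + 1) • φ := by
  have h1 : face (m + 1) ∘ degen (m + 1) = id := by
    funext l
    simp only [face, degen, Function.comp_apply, id]
    split_ifs <;> omega
  simp only [del_apply, map_sum, map_smul, pull_pull]
  rw [Finset.sum_range_succ, h1, pull_id]
  congr 1
  refine Finset.sum_congr rfl fun i hi => ?_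
  congr 3
  funext l
  simp only [face, degen, Function.comp_apply]
  rw [Finset.mem_range] at hi
  split_ifs <;> omega

/-- A partial shuffle sum; `shuf n` lowers the dimension `n` and the length of words by one. -/
def shuf (l : ℕ) : Words K →ₗ[K] Words K :=
  ∑ j ∈ Finset.range l, (-1 : K) ^ j • (pull (degen j) ∘ₗ slice (j + 1))

lemma shuf_apply (l : ℕ) (φ : Words K) :
    shuf l φ = ∑ j ∈ Finset.range l, (-1 : K) ^ j • pull (degen j) (slice (j + 1) φ) := by
  simp [shuf]

lemma shuf_zero (φ : Words K) : shuf 0 φ = 0 := by simp [shuf]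

lemma shuf_succ (l : ℕ) (φ : Words K) :
    shuf (l + 1) φ = shuf l φ + (-1 : K) ^ l • pull (degen l) (slice (l + 1) φ) := by
  rw [shuf_apply, Finset.sum_range_succ, ← shuf_apply]

/-- Geometrically, a prism is cut into simplices and consecutive simplices share a wall. Each
interior wall occurs twice, through the two identities `face ∘ degen = id`, with opposite signs. The
first wall is zero by `h0`, and the last one is the slice on the right. -/
lemma shuf_del {n m : ℕ} (h : m ≤ n) (φ : Words K) (h0 : slice 0 φ = 0) :
    shuf (m + 1) (del (n + 2) φ) = - slice (m + 1) φ - del (n + 1) (shuf m φ) -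
      (-1 : K) ^ m • delI (m + 1) (n + 1) (pull (degen m) (slice (m + 1) φ)) := by
  induction m with
  | zero =>
    rw [shuf_succ, shuf_zero, shuf_zero, slice_del (by omega), h0, map_zero, map_zero, zero_add,
      zero_add, degen_delI (by omega)]
    simp
  | succ m ih =>
    rw [shuf_succ, ih (by omega), slice_del (by omega), map_add, degen_del, degen_delI (by omega),
      shuf_succ m, map_add, map_smul, ← del_add_delI (show m + 1 ≤ n + 1 by omega)
      (pull (degen m) (slice (m + 1) φ))]
    have h1 : (-1 : K) ^ (m + 1) * (-1) ^ (m + 1) = 1 := by rw [← mul_pow]; simp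
    have h2 : (-1 : K) ^ (m + 1) * (-1) ^ (m + 1 + 1) = -1 := by
      rw [pow_succ _ (m + 1), ← mul_assoc, h1, one_mul]
    simp only [smul_add, smul_sub, smul_smul, h1, h2, one_smul, neg_smul]
    rw [pow_succ (-1 : K) m, mul_neg_one]
    simp only [neg_smul]
    abel

/-- The functions supported on the words of length `N` in the letters `1, …, n`. -/
def wordsOn (K : Type*) [Field K] (N n : ℕ) : Submodule K (Words K) where
  carrier := {φ | ∀ w, φ w ≠ 0 → w.length = N ∧ ∀ l ∈ w, 1 ≤ l ∧ l ≤ n}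
  add_mem' {φ ψ} hφ hψ w hw := by
    by_cases h : φ w = 0
    · exact hψ w fun h' => hw (by simp [h, h'])
    · exact hφ w h
  zero_mem' w hw := absurd rfl hw
  smul_mem' c φ hφ w hw := hφ w fun h => hw (by simp [h])

lemma mem_wordsOn_succ {N n : ℕ} {φ : Words K} : φ ∈ wordsOn K (N + 1) n ↔
    φ [] = 0 ∧ (∀ l, slice l φ ∈ wordsOn K N n) ∧ ∀ l, ¬ (1 ≤ l ∧ l ≤ n) → slice l φ = 0 := by
  constructor
  · intro h
    refine ⟨?_, fun l w hw => ?_, fun l hl => ?_⟩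
    · by_contra h0
      simpa using (h [] h0).1
    · have := h (l :: w) hw
      exact ⟨by simpa using this.1, fun l' hl' => this.2 l' (List.mem_cons_of_mem _ hl')⟩
    · funext w
      by_contra h0
      exact hl ((h (l :: w) h0).2 l List.mem_cons_self)
  · rintro ⟨h0, h1, h2⟩ w hw
    cases w with
    | nil => exact absurd h0 hw
    | cons l w =>
      have := h1 l w hw
      refine ⟨by simp [this.1], fun l' hl' => ?_⟩
      rcases List.mem_cons.1 hl' with rfl | hl'
      · by_contra hl
        exact hw (congrFun (h2 _ hl) w)
      · exact this.2 l' hl'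

lemma pull_mem {g : ℕ → ℕ} {N n m : ℕ} (hg : ∀ l, 1 ≤ g l ∧ g l ≤ n → 1 ≤ l ∧ l ≤ m) {φ : Words K}
    (hφ : φ ∈ wordsOn K N n) : pull g φ ∈ wordsOn K N m := fun w hw => by
  have := hφ _ hw
  exact ⟨by simpa using this.1, fun l hl => hg l (this.2 _ (List.mem_map_of_mem hl))⟩

/-- The end letters `0` and `n + 1` mark the boundary of the cube, and cofaces keep the boundary in
the boundary. This makes the relative cochains a subcomplex. -/
lemma face_proper {i n : ℕ} (_hi : i ≤ n + 1) (l : ℕ) (h : 1 ≤ face i l ∧ face i l ≤ n) :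
    1 ≤ l ∧ l ≤ n + 1 := by
  unfold face at h
  split_ifs at h <;> omega

lemma degen_proper {j n : ℕ} (hj : j ≤ n) (l : ℕ) (h : 1 ≤ degen j l ∧ degen j l ≤ n + 1) :
    1 ≤ l ∧ l ≤ n := by
  unfold degen at h
  split_ifs at h <;> omega

lemma delI_mem {N n a b : ℕ} (hb : b ≤ n + 2) {φ : Words K} (hφ : φ ∈ wordsOn K N n) :
    delI a b φ ∈ wordsOn K N (n + 1) := by
  rw [delI_apply]
  refine Submodule.sum_mem _ fun i hi => Submodule.smul_mem _ _ (pull_mem (face_proper ?_) hφ)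
  have := (Finset.mem_Ico.1 hi).2
  omega

lemma del_mem {N n b : ℕ} (hb : b ≤ n + 2) {φ : Words K} (hφ : φ ∈ wordsOn K N n) :
    del b φ ∈ wordsOn K N (n + 1) := delI_mem hb hφ

lemma shuf_mem {N k l : ℕ} (hl : l ≤ k + 1) {φ : Words K} (hφ : φ ∈ wordsOn K (N + 1) (k + 1)) :
    shuf l φ ∈ wordsOn K N k := by
  rw [shuf_apply]
  refine Submodule.sum_mem _ fun j hj => Submodule.smul_mem _ _ (pull_mem (degen_proper ?_)
    ((mem_wordsOn_succ.1 hφ).2.1 _))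
  rw [Finset.mem_range] at hj
  omega

/-- For relative cochains both end walls of the prism vanish, so the full shuffle sum anticommutes
with the differential. -/
lemma shuf_del_top {N n : ℕ} {φ : Words K} (hφ : φ ∈ wordsOn K (N + 1) n) :
    shuf (n + 1) (del (n + 2) φ) = - del (n + 1) (shuf n φ) := by
  obtain ⟨-, -, h⟩ := mem_wordsOn_succ.1 hφ
  rw [shuf_del le_rfl φ (h 0 (by omega)), h (n + 1) (by omega), delI_self]
  simp

/-- The contraction of the cochains on a prism. -/
def cone (n : ℕ) : Words K →ₗ[K] Words K := ofSlices fun l => if l ≤ n then shuf l else 0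

lemma slice_cone (n l : ℕ) (φ : Words K) :
    slice l (cone n φ) = if l ≤ n then shuf l φ else 0 := by
  rw [cone, slice_ofSlices]
  split_ifs <;> rfl

/-- The surviving wall of each partial shuffle sum is the corresponding slice of `φ`; the rest
cancels. However, `cone (k + 1) φ` is not a relative cochain: at its top letter `k + 1` it equals
the full shuffle sum. -/
lemma cone_htpy {N k : ℕ} {φ : Words K} (hφ : φ ∈ wordsOn K (N + 1) (k + 1)) :
    del (k + 2) (cone (k + 1) φ) + cone (k + 2) (del (k + 3) φ) = - φ := by
  obtain ⟨h1, -, h3⟩ := mem_wordsOn_succ.1 hφ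
  refine words_ext ?_ fun l => ?_
  · have h6 : del (k + 2) (cone (k + 1) φ) [] = 0 := by
      rw [del_apply, Finset.sum_apply]
      exact Finset.sum_eq_zero fun i _ => by simp [pull_apply, cone, ofSlices_nil]
    rw [Pi.add_apply, h6, Pi.neg_apply, h1, cone, ofSlices_nil]
    simp
  · rw [map_add, map_neg, slice_cone]
    rcases Nat.eq_zero_or_pos l with rfl | hl
    · rw [slice_zero_del, slice_cone, if_pos (Nat.zero_le _), if_pos (Nat.zero_le _), shuf_zero,
        shuf_zero, h3 0 (by omega)]
      simp
    · obtain ⟨m, rfl⟩ : ∃ m, l = m + 1 := ⟨l - 1, by omega⟩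
      by_cases hm : m + 1 ≤ k + 2
      · rw [if_pos hm, shuf_del (by omega) φ (h3 0 (by omega)), slice_del hm, slice_cone,
          if_pos (by omega), ← del_add_delI hm (shuf m φ)]
        -- `cone` is cut off above the letter `k + 1`, but there the range of cofaces is empty and
        -- the cut-off is harmless.
        have h5 : delI (m + 1) (k + 2) (slice (m + 1) (cone (k + 1) φ)) =
            delI (m + 1) (k + 2) (shuf (m + 1) φ) := by
          rw [slice_cone]
          split_ifs with h
          · rfl
          · obtain rfl : m = k + 1 := by omega
            rw [delI_self, delI_self]
        rw [h5, shuf_succ, map_add, map_smul]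
        abel
      · rw [if_neg hm, slice_del_of_lt (by omega), slice_cone, if_neg (by omega), h3 _ (by omega)]
        simp

/-- Adding the first letter `c`. -/
def ins (c : ℕ) : Words K →ₗ[K] Words K := ofSlices fun l => if l = c then LinearMap.id else 0

lemma slice_ins (c l : ℕ) (φ : Words K) : slice l (ins c φ) = if l = c then φ else 0 := by
  rw [ins, slice_ofSlices]
  split_ifs <;> rfl

lemma ins_nil (c : ℕ) (φ : Words K) : ins c φ [] = 0 := rfl

variable (K) in
/-- The antisymmetrized evaluation at the permutations. -/
def wordForm : ℕ → Words K →ₗ[K] K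
  | 0 => LinearMap.proj []
  | N + 1 => wordForm N ∘ₗ shuf (N + 1)

variable (K) in
/-- The generator of the cohomology of the cochains on words of length `N`. -/
def wordCocycle : ℕ → Words K
  | 0 => fun w => if w = [] then 1 else 0
  | N + 1 => - del (N + 2) (ins (N + 1) (wordCocycle N))

variable (K) in
/-- The projection to the cohomology. -/
def wordProj (N n : ℕ) : Words K →ₗ[K] Words K :=
  if n = N then (wordForm K N).smulRight (wordCocycle K N) else 0

variable (K) in
/-- The contraction of the cochains on words of length `N` to their cohomology. -/
def wordHtpy : ℕ → ℕ → Words K →ₗ[K] Words K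
  -- On the empty word every coface is the identity, so the differential into dimension `n` is an
  -- alternating sum of `n + 1` identities: the identity for even `n` and zero for odd `n`.
  | 0, n => if Even n ∧ n ≠ 0 then LinearMap.id else 0
  | _ + 1, 0 => 0
  -- The terms after `cone` put the homotopy identity of the smaller cube on the top letter, so that
  -- the total vanishes there and is again a relative cochain.
  | N + 1, k + 1 => - cone (k + 1) + (del (k + 1) ∘ₗ ins k ∘ₗ wordHtpy N k +
      ins (k + 1) ∘ₗ wordHtpy N (k + 1) ∘ₗ del (k + 2) + ins (k + 1) ∘ₗ wordProj K N k) ∘ₗ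
      shuf (k + 1)

lemma wordHtpy_succ (N k : ℕ) (φ : Words K) : wordHtpy K (N + 1) (k + 1) φ =
    - cone (k + 1) φ + (del (k + 1) (ins k (wordHtpy K N k (shuf (k + 1) φ))) +
      ins (k + 1) (wordHtpy K N (k + 1) (del (k + 2) (shuf (k + 1) φ))) +
      ins (k + 1) (wordProj K N k (shuf (k + 1) φ))) := rfl

lemma wordHtpy_bot (N : ℕ) (φ : Words K) : wordHtpy K N 0 φ = 0 := by
  cases N with
  | zero => simp [wordHtpy]
  | succ N => rfl

lemma wordProj_apply (N n : ℕ) (φ : Words K) :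
    wordProj K N n φ = if n = N then wordForm K N φ • wordCocycle K N else 0 := by
  rw [wordProj]
  split_ifs <;> rfl

lemma del_wordCocycle (N : ℕ) : del (N + 2) (wordCocycle K N) = 0 := by
  cases N with
  | zero =>
    have h : ∀ i, pull (face i) (wordCocycle K 0) = wordCocycle K 0 := fun i => by
      funext w
      simp [pull_apply, wordCocycle]
    simp [del_apply, h, Finset.sum_range_succ]
  | succ N => rw [wordCocycle, map_neg, del_del, neg_zero]

/-- Each shuffle sum anticommutes with the differential and lowers the dimension, until the empty
shuffle sum `shuf 0` is reached. -/
lemma wordForm_del {N : ℕ} : ∀ {φ : Words K}, φ ∈ wordsOn K (N + 1) N →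
    wordForm K (N + 1) (del (N + 2) φ) = 0 := by
  induction N with
  | zero =>
    intro φ hφ
    rw [wordForm, LinearMap.comp_apply, shuf_del_top hφ, shuf_zero]
    simp
  | succ N ih =>
    intro φ hφ
    rw [wordForm, LinearMap.comp_apply, shuf_del_top hφ, map_neg, ih (shuf_mem le_rfl hφ),
      neg_zero]

lemma wordProj_del {N k : ℕ} {φ : Words K} (hφ : φ ∈ wordsOn K N k) :
    wordProj K N (k + 1) (del (k + 2) φ) = 0 := by
  rw [wordProj_apply]
  split_ifs with h
  · subst h
    rw [wordForm_del hφ, zero_smul]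
  · rfl

/-- The generator is concentrated on a single word. -/
lemma wordCocycle_succ (N : ℕ) :
    wordCocycle K (N + 1) = (-1 : K) ^ N • ins (N + 1) (pull (face (N + 1)) (wordCocycle K N)) ∧
      wordCocycle K N ∈ wordsOn K N N := by
  induction N with
  | zero =>
    have hmem : wordCocycle K 0 ∈ wordsOn K 0 0 := fun w hw => by
      have : w = [] := by by_contra h; exact hw (if_neg h)
      simp [this]
    refine ⟨?_, hmem⟩
    have hpull : ∀ i, pull (face i) (wordCocycle K 0) = wordCocycle K 0 := fun i => by
      funext w
      simp [pull_apply, wordCocycle]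
    have hd : del 1 (wordCocycle K 0) = wordCocycle K 0 := by
      simp [del_apply, hpull]
    have hd' : delI 1 2 (wordCocycle K 0) = - wordCocycle K 0 := by
      simp [delI_apply, hpull]
    rw [hpull]
    refine words_ext ?_ fun l => ?_
    · change (- del 2 (ins 1 (wordCocycle K 0))) [] = _
      rw [del_apply]
      simp [Finset.sum_range_succ, pull_apply, ins_nil]
    · change slice l (- del 2 (ins 1 (wordCocycle K 0))) = _
      rw [map_neg, map_smul, slice_ins]
      rcases l with _ | _ | _ | l
      · rw [slice_zero_del, slice_ins]
        simp
      · rw [slice_del (by omega), slice_ins, slice_ins]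
        simp [hd']
      · have h0 : del 2 (wordCocycle K 0) = 0 := del_wordCocycle 0
        have h1 : slice (0 + 1 + 1) (del 2 (ins 1 (wordCocycle K 0))) =
            del 2 (slice 1 (ins 1 (wordCocycle K 0))) + delI 2 2 (slice 2 (ins 1 _)) :=
          slice_del le_rfl _
        rw [h1, slice_ins, if_pos rfl, h0, delI_self]
        simp
      · rw [slice_del_of_lt (by omega), slice_ins, if_neg (by omega)]
        simp
  | succ N ih =>
    have hmem : wordCocycle K (N + 1) ∈ wordsOn K (N + 1) (N + 1) := by
      rw [ih.1]
      refine Submodule.smul_mem _ _ (mem_wordsOn_succ.2 ⟨ins_nil _ _, fun l => ?_, fun l hl => ?_⟩)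
      · rw [slice_ins]
        split_ifs
        · exact pull_mem (face_proper le_rfl) ih.2
        · exact Submodule.zero_mem _
      · rw [slice_ins, if_neg]
        omega
    refine ⟨?_, hmem⟩
    refine words_ext ?_ fun l => ?_
    · change (- del (N + 1 + 2) (ins (N + 2) (wordCocycle K (N + 1)))) [] = _
      have : del (N + 1 + 2) (ins (N + 2) (wordCocycle K (N + 1))) [] = 0 := by
        rw [del_apply, Finset.sum_apply]
        exact Finset.sum_eq_zero fun i _ => by simp [pull_apply, ins_nil]
      simp [this, ins_nil]
    · change slice l (- del (N + 1 + 2) (ins (N + 2) (wordCocycle K (N + 1)))) = _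
      rw [map_neg, map_smul, slice_ins]
      rcases Nat.eq_zero_or_pos l with rfl | hl
      · rw [slice_zero_del, slice_ins, if_neg (by omega), if_neg (by omega)]
        simp
      obtain ⟨m, rfl⟩ : ∃ m, l = m + 1 := ⟨l - 1, by omega⟩
      by_cases hm : m + 1 ≤ N + 3
      · rw [slice_del hm, slice_ins, slice_ins]
        by_cases h1 : m = N + 2
        · subst h1
          -- At the letter above the inserted one the whole differential of the smaller generator
          -- appears, and that one is a cocycle.
          rw [if_pos rfl, if_neg (by omega), if_neg (by omega), del_wordCocycle]
          simp
        · rw [if_neg h1]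
          by_cases h2 : m = N + 1
          · subst h2
            rw [if_pos rfl, if_pos rfl]
            -- At the inserted letter only the last coface leaves the first letter in place, so a
            -- single term survives.
            have h3 : delI (N + 1 + 1) (N + 1 + 2) (wordCocycle K (N + 1)) =
                (-1 : K) ^ (N + 2) • pull (face (N + 2)) (wordCocycle K (N + 1)) := by
              rw [delI_apply]
              simp
            rw [h3, map_zero, zero_add, ← neg_smul, pow_succ _ (N + 1), mul_neg_one, neg_neg]
          · rw [if_neg (by omega), if_neg (by omega)]
            simp
      · rw [slice_del_of_lt (by omega), slice_ins, if_neg (by omega), if_neg (by omega)]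
        simp

lemma wordCocycle_mem (N : ℕ) : wordCocycle K N ∈ wordsOn K N N := (wordCocycle_succ N).2

lemma wordProj_mem {N n : ℕ} (φ : Words K) : wordProj K N n φ ∈ wordsOn K N n := by
  rw [wordProj_apply]
  split_ifs with h
  · subst h
    exact Submodule.smul_mem _ _ (wordCocycle_mem _)
  · exact Submodule.zero_mem _

/-- The cochains on words of length `N` are contracted to a line in dimension `N`. -/
theorem wordHtpy_spec (N : ℕ) :
    (∀ (k : ℕ) (φ : Words K), φ ∈ wordsOn K N (k + 1) → wordHtpy K N (k + 1) φ ∈ wordsOn K N k) ∧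
    ∀ (n : ℕ) (φ : Words K), φ ∈ wordsOn K N n →
      del (n + 1) (wordHtpy K N n φ) + wordHtpy K N (n + 1) (del (n + 2) φ) =
        φ - wordProj K N n φ := by
  induction N with
  | zero =>
    have hpull : ∀ {n : ℕ} {φ : Words K}, φ ∈ wordsOn K 0 n → ∀ g, pull g φ = φ := by
      intro n φ hφ g
      funext w
      cases w with
      | nil => rfl
      | cons l w =>
        have h1 : ∀ l w, φ (l :: w) = 0 := fun l w => by
          by_contra h
          simpa using (hφ _ h).1
        rw [pull_apply, List.map_cons, h1, h1]
    have hdel : ∀ {n : ℕ} {φ : Words K}, φ ∈ wordsOn K 0 n → ∀ c,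
        del c φ = if Odd c then φ else 0 := by
      intro n φ hφ c
      induction c with
      | zero => simp [del_apply]
      | succ c ih =>
        rw [del_apply, Finset.sum_range_succ, ← del_apply, ih, hpull hφ]
        rcases Nat.even_or_odd c with h | h
        · rw [if_neg (Nat.not_odd_iff_even.2 h), if_pos h.add_one, h.neg_one_pow]
          simp
        · rw [if_pos h, if_neg (Nat.not_odd_iff_even.2 h.add_one), h.neg_one_pow]
          simp
    have hmem : ∀ {n m : ℕ} {φ : Words K}, φ ∈ wordsOn K 0 n → φ ∈ wordsOn K 0 m := by
      intro n m φ hφ w hw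
      have := (hφ w hw).1
      rw [List.length_eq_zero_iff] at this
      simp [this]
    have hh : ∀ n (φ : Words K), wordHtpy K 0 n φ = if Even n ∧ n ≠ 0 then φ else 0 := by
      intro n φ
      rw [wordHtpy]
      split_ifs <;> rfl
    refine ⟨fun k φ hφ => ?_, fun n φ hφ => ?_⟩
    · rw [hh]
      split_ifs
      · exact hmem hφ
      · exact Submodule.zero_mem _
    · have h1 : wordHtpy K 0 n φ ∈ wordsOn K 0 n := by
        rw [hh]
        split_ifs
        · exact hφ
        · exact Submodule.zero_mem _
      rw [hdel h1, hdel hφ, hh, hh, wordProj_apply]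
      rcases Nat.eq_zero_or_pos n with rfl | hn
      · have h2 : wordForm K 0 φ • wordCocycle K 0 = φ := by
          funext w
          cases w with
          | nil => simp [wordForm, wordCocycle]
          | cons l w =>
            have h1 : φ (l :: w) = 0 := by
              by_contra h
              simpa using (hφ _ h).1
            simp [wordCocycle, h1]
        simp [h2]
      · rcases Nat.even_or_odd n with h | h
        · simp [h, h.add_one, hn.ne', Nat.not_even_iff_odd.2 h.add_one]
        · have h3 : Odd (n + 2) := h.add_even (by decide)
          simp [h3, h.add_one, hn.ne', Nat.not_even_iff_odd.2 h]
  | succ N ih =>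
    obtain ⟨ih1, ih2⟩ := ih
    refine ⟨fun k φ hφ => ?_, fun n φ hφ => ?_⟩
    · have hx := shuf_mem le_rfl hφ
      rw [wordHtpy_succ]
      set x := shuf (k + 1) φ with hxdef
      -- In dimension zero the homotopy is zero; otherwise it lands in dimension `k - 1`, and a
      -- coface raises this to `k`.
      have hz : ∀ i ≤ k, pull (face i) (wordHtpy K N k x) ∈ wordsOn K N k := by
        intro i hi
        cases k with
        | zero => rw [wordHtpy_bot, map_zero]; exact Submodule.zero_mem _
        | succ k => exact pull_mem (face_proper hi) (ih1 k x hx)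
      have hy : wordHtpy K N (k + 1) (del (k + 2) x) ∈ wordsOn K N k :=
        ih1 k _ (del_mem le_rfl hx)
      have hnil : ∀ (c d : ℕ) (ψ : Words K), del c (ins d ψ) [] = 0 := by
        intro c d ψ
        rw [del_apply, Finset.sum_apply]
        exact Finset.sum_eq_zero fun i _ => by simp [pull_apply, ins_nil]
      refine mem_wordsOn_succ.2 ⟨?_, fun l => ?_, fun l hl => ?_⟩
      · simp [hnil, ins_nil, cone, ofSlices_nil]
      · simp only [map_add, map_neg, slice_cone, slice_ins]
        refine add_mem (neg_mem ?_) (add_mem (add_mem ?_ ?_) ?_)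
        · split_ifs with h
          · exact shuf_mem h hφ
          · exact Submodule.zero_mem _
        · simp only [del_apply, map_sum, map_smul, slice_pull, slice_ins]
          refine Submodule.sum_mem _ fun i hi => Submodule.smul_mem _ _ ?_
          split_ifs
          · exact hz i (by simpa [Nat.lt_succ_iff] using hi)
          · rw [map_zero]; exact Submodule.zero_mem _
        · split_ifs
          · exact hy
          · exact Submodule.zero_mem _
        · split_ifs
          · exact wordProj_mem _
          · exact Submodule.zero_mem _
      · simp only [map_add, map_neg, slice_cone, slice_ins]
        rcases Nat.eq_zero_or_pos l with rfl | hl0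
        · rw [slice_zero_del, slice_ins]
          rcases Nat.eq_zero_or_pos k with rfl | hk
          · simp [wordHtpy_bot, shuf_zero]
          · simp [hk.ne, shuf_zero]
        -- At the top letter `cone` contributes `-x`, and the homotopy identity for `x` together
        -- with the projection contributes `x`. This cancellation dictates the correction terms.
        · by_cases hlk : l = k + 1
          · subst hlk
            rw [if_pos le_rfl, if_pos rfl, if_pos rfl, slice_del le_rfl, slice_ins, if_pos rfl,
              delI_self, add_zero, ih2 k x hx, ← hxdef]
            abel
          · rw [if_neg (by omega), slice_del_of_lt (by omega), slice_ins, if_neg (by omega),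
              if_neg hlk, if_neg hlk]
            simp
    · cases n with
      | zero =>
        have h0 : φ = 0 := words_ext (mem_wordsOn_succ.1 hφ).1 fun l => by
          rw [(mem_wordsOn_succ.1 hφ).2.2 l (by omega), map_zero]
        simp [h0]
      | succ k =>
        have hx := shuf_mem le_rfl hφ
        have hc := cone_htpy hφ
        have hs : shuf (k + 2) (del (k + 3) φ) = - del (k + 2) (shuf (k + 1) φ) := shuf_del_top hφ
        -- The form is defined through `shuf` and the generator as the differential of an insertion,
        -- so the projection of the cube comes from that of the smaller cube.
        have hp : wordProj K (N + 1) (k + 1) φ =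
            - del (k + 2) (ins (k + 1) (wordProj K N k (shuf (k + 1) φ))) := by
          rw [wordProj_apply, wordProj_apply]
          by_cases h : k = N
          · subst h
            simp [wordForm, wordCocycle]
          · simp [h]
        have hp' := wordProj_del hx
        rw [wordHtpy_succ, wordHtpy_succ, hs, hp]
        -- Everything containing two differentials or a projected coboundary disappears. The two
        -- terms with the homotopy of `del x` cancel, leaving `cone_htpy` and the projection.
        simp only [map_add, map_neg, del_del, hp', map_zero, neg_zero, add_zero, zero_add]
        have hc' : cone (k + 2) (del (k + 3) φ) = - φ - del (k + 2) (cone (k + 1) φ) := by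
          rw [← hc]; abel
        rw [show k + 1 + 2 = k + 3 from rfl, show k + 1 + 1 = k + 2 from rfl, hc']
        abel

end Words

end GerstenhaberSchack

end

noncomputable section

namespace GerstenhaberSchack

/-! ### The cobar complex through polarization. -/

section Cobar

set_option linter.unusedSectionVars false

variable {K : Type*} [Field K] {ι : Type*} {deg : ι → ℤ} [Fintype ι] [LinearOrder ι]

/-! ### Maps induced by maps of letters -/

/-- The derivative in the tensor factor with letter `l`; it vanishes if there is none. -/
def pdL {n : ℕ} (l : ℕ) (i : ι) : OTensor K deg n →ₗ[K] OTensor K deg n :=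
  if h : 1 ≤ l ∧ l ≤ n then pd ⟨l - 1, by omega⟩ i else 0

lemma pdL_succ {n : ℕ} (k : Fin n) (i : ι) :
    (pdL (k + 1) i : OTensor K deg n →ₗ[K] OTensor K deg n) = pd k i := by
  rw [pdL, dif_pos ⟨by omega, by omega⟩]
  rfl

lemma pdL_of_not {n l : ℕ} (h : ¬ (1 ≤ l ∧ l ≤ n)) (i : ι) :
    (pdL l i : OTensor K deg n →ₗ[K] OTensor K deg n) = 0 := dif_neg h

/-- The algebra homomorphism that belongs to a map of letters. -/
def letterMap (g : ℕ → ℕ) (p q : ℕ) : OTensor K deg p →ₗ[K] OTensor K deg q :=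
  slotMap fun k : Fin p => Finset.univ.filter fun l : Fin q => g (l + 1) = k + 1

/-- All letters of the source of `g` whose image is a letter `1, …, p` are among `1, …, q`. -/
def ProperLetters (g : ℕ → ℕ) (p q : ℕ) : Prop := ∀ l, 1 ≤ g l ∧ g l ≤ p → 1 ≤ l ∧ l ≤ q

lemma face_properLetters {i n : ℕ} (hi : i ≤ n + 1) : ProperLetters (face i) n (n + 1) :=
  face_proper hi

lemma degen_properLetters {j n : ℕ} (hj : j ≤ n) : ProperLetters (degen j) (n + 1) n :=
  degen_proper hj

/-- A letter map assigns every target factor to at most one source factor, so the sum in the chain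
rule has at most one term. `ProperLetters` handles letters without a tensor factor. -/
lemma pdL_letterMap {g : ℕ → ℕ} {p q : ℕ} (hg : ProperLetters g p q) (l : ℕ) (i : ι)
    (F : OTensor K deg p) : pdL l i (letterMap g p q F) = letterMap g p q (pdL (g l) i F) := by
  by_cases hl : 1 ≤ l ∧ l ≤ q
  · obtain ⟨k, rfl⟩ : ∃ k : Fin q, l = k + 1 := ⟨⟨l - 1, by omega⟩, by simp; omega⟩
    rw [pdL_succ, letterMap, pd_slotMap]
    by_cases h : 1 ≤ g (k + 1) ∧ g (k + 1) ≤ p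
    · obtain ⟨k', hk'⟩ : ∃ k' : Fin p, g (k + 1) = k' + 1 := ⟨⟨g (k + 1) - 1, by omega⟩, by simp; omega⟩
      have : (Finset.univ.filter fun j : Fin p =>
          k ∈ Finset.univ.filter fun l : Fin q => g (l + 1) = j + 1) = {k'} := by
        ext j
        simp only [Finset.mem_filter, Finset.mem_univ, true_and, Finset.mem_singleton, hk',
          Nat.add_right_cancel_iff, Fin.ext_iff, eq_comm]
      rw [this, Finset.sum_singleton, hk', pdL_succ]
    · rw [pdL_of_not h, LinearMap.zero_apply, map_zero]
      refine Finset.sum_eq_zero fun j hj => ?_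
      simp only [Finset.mem_filter, Finset.mem_univ, true_and] at hj
      omega
  · rw [pdL_of_not hl, pdL_of_not fun h => hl (hg l h), LinearMap.zero_apply, LinearMap.zero_apply,
      map_zero]

/-! ### Polarization -/

variable (K deg) in
/-- The polarization: the constant terms of the iterated derivatives in the variables `x (l, i)`,
where `i` runs through the list `u`, and `l` through the letters of a word. -/
def polar (n : ℕ) : List ι → OTensor K deg n →ₗ[K] Words K
  | [] => LinearMap.pi fun w => if w = [] then coeffL K _ 0 else 0
  | i :: u => ofSlices fun l => polar n u ∘ₗ pdL l i

lemma polar_nil (n : ℕ) (F : OTensor K deg n) (w : List ℕ) :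
    polar K deg n [] F w = if w = [] then coeff F 0 else 0 := by
  rw [polar, LinearMap.pi_apply]
  split_ifs <;> rfl

lemma slice_polar (n l : ℕ) (i : ι) (u : List ι) (F : OTensor K deg n) :
    slice l (polar K deg n (i :: u) F) = polar K deg n u (pdL l i F) := rfl

/-- Iterating the chain rule moves `g` from the series to the letters. Hence the cobar differential
becomes the simplicial one. -/
lemma polar_letterMap {g : ℕ → ℕ} {p q : ℕ} (hg : ProperLetters g p q) (u : List ι) :
    ∀ F : OTensor K deg p, polar K deg q u (letterMap g p q F) = pull g (polar K deg p u F) := by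
  induction u with
  | nil =>
    intro F
    funext w
    rw [polar_nil, pull_apply, polar_nil, letterMap, coeff_zero_slotMap]
    simp
  | cons i u ih =>
    intro F
    refine words_ext rfl fun l => ?_
    rw [slice_polar, pdL_letterMap hg, ih, slice_pull, slice_polar]

lemma polar_mem (n : ℕ) (u : List ι) :
    ∀ F : OTensor K deg n, polar K deg n u F ∈ wordsOn K u.length n := by
  induction u with
  | nil =>
    intro F w hw
    have : w = [] := by
      by_contra h
      exact hw (by rw [polar_nil, if_neg h])
    simp [this]
  | cons i u ih =>
    intro F
    refine mem_wordsOn_succ.2 ⟨rfl, fun l => ih _, fun l hl => ?_⟩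
    rw [slice_polar, pdL_of_not hl, LinearMap.zero_apply, map_zero]

/-- The multiplicities of the indices in a list. -/
def cnt (u : List ι) : ι → ℕ := fun i => u.count i

@[simp] lemma cnt_nil : cnt ([] : List ι) = 0 := rfl

lemma cnt_cons (i : ι) (u : List ι) : cnt (i :: u) = cnt u + Pi.single i 1 := by
  funext j
  rw [cnt, List.count_cons, Pi.add_apply, Pi.single_apply, cnt]
  by_cases h : j = i
  · subst h
    simp
  · simp [h, Ne.symm h]

lemma polar_eq_zero (n : ℕ) (u : List ι) : ∀ F : OTensor K deg n,
    (∀ a, wt a = cnt u → coeff F a = 0) → polar K deg n u F = 0 := by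
  induction u with
  | nil =>
    intro F hF
    funext w
    rw [polar_nil, hF 0 (by simp)]
    simp
  | cons i u ih =>
    intro F hF
    refine words_ext rfl fun l => ?_
    rw [slice_polar, map_zero]
    refine ih _ fun a ha => ?_
    rw [pdL]
    split_ifs with h
    · rw [coeff_partialD, hF _ (by rw [wt_add, wt_single, ha, cnt_cons]), mul_zero]
    · simp

lemma polar_congr {n : ℕ} {u : List ι} {F G : OTensor K deg n}
    (h : ∀ a, wt a = cnt u → coeff F a = coeff G a) : polar K deg n u F = polar K deg n u G := by
  rw [← sub_eq_zero, ← map_sub]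
  exact polar_eq_zero n u _ fun a ha => by rw [coeff_sub, h a ha, sub_self]

variable (K deg) in
/-- The restitution, a one-sided inverse of the polarization. -/
def restit (n : ℕ) : List ι → Words K →ₗ[K] OTensor K deg n
  | [] => LinearMap.smulRight (LinearMap.proj []) 1
  | i :: u => ((u.count i : K) + 1)⁻¹ •
      ∑ k : Fin n, mulLeft (xv k i) ∘ₗ restit n u ∘ₗ slice (k + 1)

lemma restit_nil (n : ℕ) (φ : Words K) : restit K deg n [] φ = φ [] • 1 := rfl

lemma restit_cons (n : ℕ) (i : ι) (u : List ι) (φ : Words K) :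
    restit K deg n (i :: u) φ = ((u.count i : K) + 1)⁻¹ •
      ∑ k : Fin n, xv k i * restit K deg n u (slice (k + 1) φ) := by
  simp [restit, mulLeft_apply]

lemma wt_sub_single {n : ℕ} {a : Fin n ×ₗ ι → ℕ} {k : Fin n} {i : ι} (h : a (toLex (k, i)) ≠ 0) :
    wt (a - Pi.single (toLex (k, i)) 1) + Pi.single i 1 = wt a := by
  rw [← wt_single (n := n) k i, ← wt_add, sub_single_add h]

lemma coeff_restit (n : ℕ) (u : List ι) : ∀ (φ : Words K) (a : Fin n ×ₗ ι → ℕ), wt a ≠ cnt u →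
    coeff (restit K deg n u φ) a = 0 := by
  induction u with
  | nil =>
    intro φ a ha
    rw [restit_nil, coeff_smul, coeff_one, if_neg, mul_zero]
    rintro rfl
    exact ha (by simp)
  | cons i u ih =>
    intro φ a ha
    by_cases hadm : Admissible (tensorDeg deg n) a
    · rw [restit_cons, coeff_smul, coeff_sum, Finset.sum_eq_zero, mul_zero]
      intro k _
      rw [coeff_var_mul _ _ hadm]
      split_ifs with h
      · rfl
      · rw [ih, mul_zero]
        intro h'
        exact ha (by rw [← wt_sub_single h, h', cnt_cons])
    · exact coeff_of_not_admissible hadm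

variable [CharZero K]

/-- Euler's formula: `∑ x (k, i) ∂/∂x (k, i)` over the factors `k` multiplies a monomial by its
exponent in `x i`, here `u.count i + 1`. The normalization of `restit` divides by exactly this. -/
lemma coeff_restit_polar (n : ℕ) (u : List ι) : ∀ (F : OTensor K deg n) (a : Fin n ×ₗ ι → ℕ),
    wt a = cnt u → coeff (restit K deg n u (polar K deg n u F)) a = coeff F a := by
  induction u with
  | nil =>
    intro F a ha
    obtain rfl : a = 0 := by
      funext t
      obtain ⟨⟨k, i⟩, rfl⟩ := toLex.surjective t
      exact Finset.sum_eq_zero_iff.1 (congrFun ha i) k (Finset.mem_univ k)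
    rw [restit_nil, coeff_smul, coeff_one, polar_nil]
    simp
  | cons i u ih =>
    intro F a ha
    by_cases hadm : Admissible (tensorDeg deg n) a
    · rw [restit_cons, coeff_smul, coeff_sum]
      have h1 : ∀ k : Fin n, coeff (xv k i * restit K deg n u
          (slice (k + 1) (polar K deg n (i :: u) F))) a = a (toLex (k, i)) * coeff F a := by
        intro k
        rw [coeff_var_mul _ _ hadm]
        split_ifs with h
        · simp [h]
        · have h2 : wt (a - Pi.single (toLex (k, i)) 1) = cnt u := by
            have := wt_sub_single h
            rw [ha, cnt_cons] at this
            exact add_right_cancel this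
          have h3 : (((a - Pi.single (toLex (k, i)) 1 : Fin n ×ₗ ι → ℕ) (toLex (k, i)) : ℕ) : K) + 1
              = a (toLex (k, i)) := by
            rw [Pi.sub_apply, Pi.single_eq_same, ← Nat.cast_succ, Nat.succ_eq_add_one,
              Nat.sub_add_cancel (Nat.one_le_iff_ne_zero.2 h)]
          rw [slice_polar, ih _ _ h2, pdL_succ, coeff_partialD, sub_single_add h, h3, ← mul_assoc,
            ← mul_assoc, lam_mul_self, one_mul]
      have h4 : (∑ k : Fin n, (a (toLex (k, i)) : K)) = (u.count i : K) + 1 := by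
        have := congrFun ha i
        rw [cnt, List.count_cons_self, wt] at this
        exact_mod_cast this
      rw [Finset.sum_congr rfl fun k _ => h1 k, ← Finset.sum_mul, h4, ← mul_assoc,
        inv_mul_cancel₀ (Nat.cast_add_one_ne_zero _), one_mul]
    · rw [coeff_of_not_admissible hadm, coeff_of_not_admissible hadm]

/-- The indices of the variables in a monomial of multidegree `β`, in increasing order. -/
def wordOf (β : ι → ℕ) : List ι :=
  ((Finset.univ : Finset ι).sort (· ≤ ·)).flatMap fun i => List.replicate (β i) i

lemma count_flatMap_replicate (β : ι → ℕ) (L : List ι) (hL : L.Nodup) (j : ι) :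
    (L.flatMap fun i => List.replicate (β i) i).count j = if j ∈ L then β j else 0 := by
  induction L with
  | nil => simp
  | cons i L ih =>
    obtain ⟨hi, hL⟩ := List.nodup_cons.1 hL
    rw [List.flatMap_cons, List.count_append, ih hL, List.count_replicate]
    by_cases hj : i = j
    · subst hj
      simp [hi]
    · simp [hj, Ne.symm hj]

lemma cnt_wordOf (β : ι → ℕ) : cnt (wordOf β) = β := by
  funext j
  rw [cnt, wordOf, count_flatMap_replicate β _ (Finset.sort_nodup _ _)]
  simp

lemma length_wordOf (β : ι → ℕ) : (wordOf β).length = ∑ i, β i := by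
  rw [wordOf, List.length_flatMap]
  simp only [List.length_replicate]
  rw [← List.sum_toFinset _ (Finset.sort_nodup _ _), Finset.sort_toFinset]

/-- Restitution recovers every coefficient from a polarization, so simplicial identities between
letters lift to series. -/
lemma ext_polar {n : ℕ} {F G : OTensor K deg n}
    (h : ∀ u, polar K deg n u F = polar K deg n u G) : F = G :=
  series_ext fun a _ => by
    rw [← coeff_restit_polar n (wordOf (wt a)) F a (cnt_wordOf _).symm, h,
      coeff_restit_polar n (wordOf (wt a)) G a (cnt_wordOf _).symm]

lemma letterMap_letterMap {g g' h h' : ℕ → ℕ} {p q q' m : ℕ} (hg : ProperLetters g p q)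
    (hg' : ProperLetters g' q m) (hh : ProperLetters h p q') (hh' : ProperLetters h' q' m)
    (hc : g ∘ g' = h ∘ h') (F : OTensor K deg p) :
    letterMap g' q m (letterMap g p q F) = letterMap h' q' m (letterMap h p q' F) :=
  ext_polar fun u => by
    rw [polar_letterMap hg', polar_letterMap hg, polar_letterMap hh', polar_letterMap hh, pull_pull,
      pull_pull, hc]

lemma letterMap_letterMap_id {g g' : ℕ → ℕ} {p q : ℕ} (hg : ProperLetters g p q)
    (hg' : ProperLetters g' q p) (hc : g ∘ g' = id) (F : OTensor K deg p) :
    letterMap g' q p (letterMap g p q F) = F :=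
  ext_polar fun u => by
    rw [polar_letterMap hg', polar_letterMap hg, pull_pull, hc, pull_id]

lemma letterMap_mul (g : ℕ → ℕ) (p q : ℕ) (F G : OTensor K deg p) :
    letterMap g p q (F * G) = letterMap g p q F * letterMap g p q G := slotMap_mul _ F G

/-- Restitution reads only the letters that have a tensor factor. The support condition on `φ` is
needed because `g` may send a letter of the target to one without a factor in the source. -/
lemma letterMap_restit {g : ℕ → ℕ} {p q : ℕ} (u : List ι) : ∀ φ ∈ wordsOn K u.length p,
    letterMap g p q (restit K deg p u φ) = restit K deg q u (pull g φ) := by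
  induction u with
  | nil =>
    intro φ _
    rw [restit_nil, restit_nil, map_smul, letterMap, slotMap_one]
    rfl
  | cons i u ih =>
    intro φ hφ
    obtain ⟨-, h1, h2⟩ := mem_wordsOn_succ.1 hφ
    rw [restit_cons, restit_cons, map_smul, map_sum]
    congr 1
    have h3 : ∀ k : Fin p, letterMap g p q (xv k i * restit K deg p u (slice (k + 1) φ)) =
        ∑ l : Fin q, if g (l + 1) = k + 1 then
          xv l i * restit K deg q u (pull g (slice (g (l + 1)) φ)) else 0 := by
      intro k
      rw [letterMap_mul, ih _ (h1 _), letterMap, slotMap_xv, sum_mul', Finset.sum_filter]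
      refine Finset.sum_congr rfl fun l _ => ?_
      split_ifs with h
      · rw [h]
      · rfl
    rw [Finset.sum_congr rfl fun k _ => h3 k, Finset.sum_comm]
    refine Finset.sum_congr rfl fun l _ => ?_
    rw [slice_pull]
    by_cases hl : 1 ≤ g (l + 1) ∧ g (l + 1) ≤ p
    · rw [Finset.sum_eq_single (⟨g (l + 1) - 1, by omega⟩ : Fin p)]
      · rw [if_pos]
        simp only
        omega
      · intro k _ hk
        rw [if_neg]
        intro h
        exact hk (Fin.ext (by simp [h]))
      · simp
    · rw [h2 _ hl]
      simp [mul_zero']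

/-! ### The cobar complex -/

variable (K deg) in
/-- The cobar differential. -/
def cobar (n : ℕ) : OTensor K deg n →ₗ[K] OTensor K deg (n + 1) :=
  ∑ i ∈ Finset.range (n + 2), (-1 : K) ^ i • letterMap (face i) n (n + 1)

lemma cobar_apply (n : ℕ) (F : OTensor K deg n) : cobar K deg n F =
    ∑ i ∈ Finset.range (n + 2), (-1 : K) ^ i • letterMap (face i) n (n + 1) F := by
  simp [cobar]

lemma polar_cobar (n : ℕ) (u : List ι) (F : OTensor K deg n) :
    polar K deg (n + 1) u (cobar K deg n F) = del (n + 2) (polar K deg n u F) := by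
  rw [cobar_apply, del_apply, map_sum]
  refine Finset.sum_congr rfl fun i hi => ?_
  rw [map_smul, polar_letterMap (face_properLetters (Nat.lt_succ_iff.1 (Finset.mem_range.1 hi)))]

lemma restit_del (n : ℕ) (u : List ι) {φ : Words K} (hφ : φ ∈ wordsOn K u.length n) :
    restit K deg (n + 1) u (del (n + 2) φ) = cobar K deg n (restit K deg n u φ) := by
  rw [cobar_apply, del_apply, map_sum]
  refine Finset.sum_congr rfl fun i _ => ?_
  rw [map_smul, letterMap_restit u φ hφ]

lemma cobar_cobar (n : ℕ) (F : OTensor K deg n) : cobar K deg (n + 1) (cobar K deg n F) = 0 :=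
  ext_polar fun u => by rw [polar_cobar, polar_cobar, del_del, map_zero]

/-- Both cofaces of the ground field are the unit map. Consequently the complexes may start with the
first tensor power without changing cohomology there. -/
lemma cobar_zero : cobar K deg 0 = 0 := by
  rw [cobar, Finset.sum_range_succ, Finset.sum_range_one, pow_zero, one_smul, pow_one, neg_smul,
    one_smul, ← sub_eq_add_neg, sub_eq_zero, letterMap, letterMap]
  congr 1
  funext k
  exact k.elim0

lemma coeff_cobar_congr {n : ℕ} {F G : OTensor K deg n} {a : Fin (n + 1) ×ₗ ι → ℕ}
    (h : ∀ c, wt c = wt a → coeff F c = coeff G c) :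
    coeff (cobar K deg n F) a = coeff (cobar K deg n G) a := by
  rw [cobar_apply, cobar_apply, coeff_sum, coeff_sum]
  refine Finset.sum_congr rfl fun i _ => ?_
  rw [coeff_smul, coeff_smul, letterMap, coeff_slotMap_congr _ h]

variable (K deg) in
/-- The contraction of the cobar complex. -/
def cobarHtpy (n : ℕ) : OTensor K deg (n + 1) →ₗ[K] OTensor K deg n where
  toFun F := ofCoeff fun a => coeff (restit K deg n (wordOf (wt a))
    (wordHtpy K (∑ i, wt a i) (n + 1) (polar K deg (n + 1) (wordOf (wt a)) F))) a
  map_add' F G := by simp only [map_add, coeff_add, ofCoeff_add]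
  map_smul' c F := by simp only [map_smul, coeff_smul, ofCoeff_smul, RingHom.id_apply]

lemma coeff_cobarHtpy (n : ℕ) (F : OTensor K deg (n + 1)) (a : Fin n ×ₗ ι → ℕ) :
    coeff (cobarHtpy K deg n F) a = coeff (restit K deg n (wordOf (wt a))
      (wordHtpy K (∑ i, wt a i) (n + 1) (polar K deg (n + 1) (wordOf (wt a)) F))) a :=
  coeff_ofCoeff_of_imp (g := fun a => coeff (restit K deg n (wordOf (wt a))
    (wordHtpy K (∑ i, wt a i) (n + 1) (polar K deg (n + 1) (wordOf (wt a)) F))) a)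
    fun h => coeff_of_not_admissible h

lemma cobarHtpy_wt {n : ℕ} {F : OTensor K deg (n + 1)} {a : Fin n ×ₗ ι → ℕ}
    (h : coeff (cobarHtpy K deg n F) a ≠ 0) : ∃ c, wt c = wt a ∧ coeff F c ≠ 0 := by
  by_contra! hF
  refine h ?_
  rw [coeff_cobarHtpy, polar_eq_zero _ _ _ fun c hc => hF c (by rw [hc, cnt_wordOf])]
  simp

lemma cobar_wt {n : ℕ} {F : OTensor K deg n} {a : Fin (n + 1) ×ₗ ι → ℕ}
    (h : coeff (cobar K deg n F) a ≠ 0) : ∃ c, wt c = wt a ∧ coeff F c ≠ 0 := by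
  by_contra! hF
  refine h ?_
  rw [coeff_cobar_congr (G := 0) fun c hc => by rw [hF c hc, coeff_zero]]
  simp

variable (K deg) in
/-- The linear form dual to the class of multidegree `β`. -/
def cobarForm (n : ℕ) (β : ι → ℕ) : OTensor K deg n →ₗ[K] K :=
  wordForm K n ∘ₗ polar K deg n (wordOf β)

variable (K deg) in
/-- A cocycle that represents the class of multidegree `β`. -/
def cobarCocycle (n : ℕ) (β : ι → ℕ) : OTensor K deg n :=
  restit K deg n (wordOf β) (wordCocycle K n)

/-- Polarization and restitution are cochain maps exhibiting the multidegree `wt a` as a retract of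
the cochains on words, so the homotopy of words can be conjugated by them. -/
lemma coeff_cobarHtpy_spec (n : ℕ) (F : OTensor K deg (n + 1)) (a : Fin (n + 1) ×ₗ ι → ℕ) :
    coeff (cobar K deg n (cobarHtpy K deg n F) +
      cobarHtpy K deg (n + 1) (cobar K deg (n + 1) F)) a = coeff F a -
      if n + 1 = ∑ i, wt a i then
        cobarForm K deg (n + 1) (wt a) F * coeff (cobarCocycle K deg (n + 1) (wt a)) a else 0 := by
  set u := wordOf (wt a) with hu
  have hlen : u.length = ∑ i, wt a i := length_wordOf _
  set N := ∑ i, wt a i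
  have hφ : polar K deg (n + 1) u F ∈ wordsOn K N (n + 1) := hlen ▸ polar_mem _ _ _
  obtain ⟨h1, h2⟩ := wordHtpy_spec (K := K) N
  have h3 : coeff (cobar K deg n (cobarHtpy K deg n F)) a =
      coeff (restit K deg (n + 1) u (del (n + 2)
        (wordHtpy K N (n + 1) (polar K deg (n + 1) u F)))) a := by
    -- Restitution commutes with the differential only on properly supported words; this is why the
    -- homotopy must preserve supports.
    rw [restit_del _ _ (hlen ▸ h1 n _ hφ)]
    refine coeff_cobar_congr fun c hc => ?_
    rw [coeff_cobarHtpy, hc]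
  rw [coeff_add, h3, coeff_cobarHtpy, ← hu, polar_cobar, ← coeff_add, ← map_add, h2 _ _ hφ, map_sub,
    coeff_sub, coeff_restit_polar _ _ _ _ (cnt_wordOf _).symm, wordProj_apply]
  congr 1
  split_ifs with h
  · rw [map_smul, coeff_smul, cobarForm, cobarCocycle, ← hu, ← h]
    rfl
  · simp

/-! ### Evaluation of the forms at the cocycles -/

/-- Polarization by one index followed by the shuffle sum. -/
def lower (N : ℕ) (i : ι) : OTensor K deg (N + 1) →ₗ[K] OTensor K deg N :=
  ∑ j ∈ Finset.range (N + 1), (-1 : K) ^ j • (letterMap (degen j) (N + 1) N ∘ₗ pdL (j + 1) i)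

lemma lower_apply (N : ℕ) (i : ι) (F : OTensor K deg (N + 1)) : lower N i F =
    ∑ j ∈ Finset.range (N + 1), (-1 : K) ^ j • letterMap (degen j) (N + 1) N (pdL (j + 1) i F) := by
  simp [lower]

/-- The shuffle sum of a polarization is itself a polarization, so the antisymmetrized form can be
evaluated by recursion on series. -/
lemma shuf_polar (N : ℕ) (i : ι) (u : List ι) (F : OTensor K deg (N + 1)) :
    shuf (N + 1) (polar K deg (N + 1) (i :: u) F) = polar K deg N u (lower N i F) := by
  rw [shuf_apply, lower_apply, map_sum]
  refine Finset.sum_congr rfl fun j hj => ?_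
  rw [map_smul, polar_letterMap (degen_properLetters (Nat.lt_succ_iff.1 (Finset.mem_range.1 hj))),
    slice_polar]

lemma wordForm_polar_cons (N : ℕ) (i : ι) (u : List ι) (F : OTensor K deg (N + 1)) :
    wordForm K (N + 1) (polar K deg (N + 1) (i :: u) F) =
      wordForm K N (polar K deg N u (lower N i F)) := by
  rw [← shuf_polar]
  rfl

lemma pdL_comm {n : ℕ} (l l' : ℕ) (i : ι) (hi : Even (deg i)) (F : OTensor K deg n) :
    pdL l i (pdL l' i F) = pdL l' i (pdL l i F) := by
  by_cases h : 1 ≤ l ∧ l ≤ n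
  · by_cases h' : 1 ≤ l' ∧ l' ≤ n
    · rw [pdL, pdL, dif_pos h, dif_pos h', partialD_comm, tensorDeg_toLex, tensorDeg_toLex,
        sgn_of_even (hi.mul_right _), one_smul]
    · simp [pdL_of_not h']
  · simp [pdL_of_not h]

/-- Derivatives in even variables commute, while two successive shuffle sums are antisymmetric. The
preceding indices are stripped off by replacing `F` with `lower F`. -/
lemma wordForm_polar_repeat (N : ℕ) (pre : List ι) (i : ι) (rest : List ι) (hi : Even (deg i)) :
    ∀ (F : OTensor K deg N), (pre ++ i :: i :: rest).length = N →
    wordForm K N (polar K deg N (pre ++ i :: i :: rest) F) = 0 := by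
  induction pre generalizing N with
  | nil =>
    intro F hN
    obtain ⟨N, rfl⟩ : ∃ M, N = M + 2 := ⟨rest.length, by simp [← hN]⟩
    change wordForm K N (shuf (N + 1) (shuf (N + 2) (polar K deg (N + 2) (i :: i :: rest) F))) = 0
    convert map_zero (wordForm K N)
    rw [shuf_apply]
    simp only [shuf_apply (N + 2), map_sum, map_smul, slice_pull, slice_polar, pull_pull,
      Finset.smul_sum, smul_smul]
    -- The simplicial identity for two codegeneracies exchanges the letters of the two derivatives
    -- in `x i`, which commute.
    refine sum_alternating_eq_zero (K := K) (N + 1) (fun j k => pull (degen k ∘ degen j)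
      (polar K deg (N + 2) rest (pdL (degen k (j + 1)) i (pdL (k + 1) i F)))) fun j k h => ?_
    have h1 : degen k ∘ degen j = degen j ∘ degen (k - 1) := by
      funext l
      simp only [degen, Function.comp_apply]
      split_ifs <;> omega
    have h2 : degen k (j + 1) = j + 1 := if_pos h
    have h3 : degen j (k - 1 + 1) = k + 1 := by
      rw [degen, if_neg (by omega)]
      omega
    simp only [h1, h2, h3]
    rw [pdL_comm _ _ _ hi]
  | cons k pre ih =>
    intro F hN
    obtain ⟨N, rfl⟩ : ∃ M, N = M + 1 := ⟨(pre ++ i :: i :: rest).length, by simp [← hN]⟩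
    rw [List.cons_append, wordForm_polar_cons]
    exact ih N _ (by simpa using hN)

/-- Multiplication by a variable in a new last tensor factor. -/
def raise (N : ℕ) (k : ι) (G : OTensor K deg N) : OTensor K deg (N + 1) :=
  xv (Fin.last N) k * letterMap (face (N + 1)) N (N + 1) G

lemma raise_smul (N : ℕ) (k : ι) (c : K) (G : OTensor K deg N) :
    raise N k (c • G) = c • raise N k G := by
  rw [raise, map_smul, mul_smul', raise]

lemma raise_zero (N : ℕ) (k : ι) : raise N k (0 : OTensor K deg N) = 0 := by
  rw [raise, map_zero, mul_zero']

lemma pdL_raise {N j : ℕ} (hj : j ≤ N) (i k : ι) (G : OTensor K deg N) :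
    pdL (j + 1) i (raise N k G) = (if j = N ∧ i = k then letterMap (face (N + 1)) N (N + 1) G
      else 0) + sgn K (deg i * deg k) • raise N k (pdL (j + 1) i G) := by
  have h1 : face (N + 1) (j + 1) = j + 1 := if_pos (by omega)
  have h2 := pdL_letterMap (face_properLetters (le_refl (N + 1))) (j + 1) i G
  rw [h1] at h2
  have h3 := pdL_succ (K := K) (deg := deg) (⟨j, by omega⟩ : Fin (N + 1)) i
  simp only at h3
  have h4 : partialD (toLex (⟨j, by omega⟩, i)) (letterMap (face (N + 1)) N (N + 1) G) =
      letterMap (face (N + 1)) N (N + 1) (pdL (j + 1) i G) := by rw [← h2, h3]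
  rw [raise, h3, partialD_mul, h4, partialD_var, tw_var, smul_mul', raise]
  congr 1
  · simp only [EmbeddingLike.apply_eq_iff_eq, Prod.mk.injEq, Fin.ext_iff, Fin.val_last]
    split_ifs
    · rw [one_mul']
    · rw [zero_mul']

/-- For `j ≤ N` the codegeneracy drops a factor before the last one, so the factor carrying the new
variable stays last. -/
lemma letterMap_raise {N j : ℕ} (hj : j ≤ N) (k : ι) (G : OTensor K deg (N + 1)) :
    letterMap (degen j) (N + 2) (N + 1) (raise (N + 1) k G) =
      raise N k (letterMap (degen j) (N + 1) N G) := by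
  rw [raise, letterMap_mul, raise]
  congr 1
  · rw [letterMap, slotMap_xv, Finset.sum_eq_single_of_mem (Fin.last N)]
    · simp [degen]
      omega
    · intro l hl hl'
      exfalso
      apply hl'
      have hl := (Finset.mem_filter.1 hl).2
      simp only [degen, Fin.val_last] at hl
      ext
      simp only [Fin.val_last]
      split_ifs at hl <;> omega
  · refine letterMap_letterMap (face_properLetters le_rfl) (degen_properLetters (by omega))
      (degen_properLetters hj) (face_properLetters le_rfl) ?_ G
    funext l
    simp only [face, degen, Function.comp_apply]
    split_ifs <;> omega

/-- Only the last term `j = N` can differentiate the new variable, and it differentiates nothing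
else since `G` has no factor with that letter. In all other terms the derivative moves past the new
variable onto `G`. -/
lemma lower_raise_aux (N : ℕ) (i k : ι) (G : OTensor K deg N) :
    lower N i (raise N k G) = (if i = k then (-1 : K) ^ N • G else 0) +
      sgn K (deg i * deg k) • ∑ j ∈ Finset.range N, (-1 : K) ^ j •
        letterMap (degen j) (N + 1) N (raise N k (pdL (j + 1) i G)) := by
  have hid : letterMap (degen N) (N + 1) N (letterMap (face (N + 1)) N (N + 1) G) = G := by
    refine letterMap_letterMap_id (face_properLetters le_rfl) (degen_properLetters le_rfl) ?_ G
    funext l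
    simp only [face, degen, Function.comp_apply, id]
    split_ifs <;> omega
  rw [lower_apply, Finset.sum_range_succ, add_comm]
  congr 1
  · rw [pdL_raise le_rfl, pdL_of_not (by omega), LinearMap.zero_apply, raise_zero, smul_zero,
      add_zero]
    by_cases h : i = k
    · simp [h, hid]
    · simp [h]
  · rw [Finset.smul_sum]
    refine Finset.sum_congr rfl fun j hj => ?_
    rw [Finset.mem_range] at hj
    rw [pdL_raise hj.le, if_neg fun h => hj.ne h.1, zero_add, map_smul, smul_comm]

lemma lower_raise_zero (i k : ι) (G : OTensor K deg 0) :
    lower 0 i (raise 0 k G) = if i = k then G else 0 := by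
  rw [lower_raise_aux]
  simp

/-- A graded commutation relation between annihilating and creating an index, from which the pairing
of form and cocycle is computed. -/
lemma lower_raise (N : ℕ) (i k : ι) (G : OTensor K deg (N + 1)) :
    lower (N + 1) i (raise (N + 1) k G) = (if i = k then (-1 : K) ^ (N + 1) • G else 0) +
      sgn K (deg i * deg k) • raise N k (lower N i G) := by
  rw [lower_raise_aux, lower_apply]
  congr 2
  have h : ∀ (s : Finset ℕ) (f : ℕ → OTensor K deg N),
      raise N k (∑ j ∈ s, f j) = ∑ j ∈ s, raise N k (f j) := fun s f => by
    simp only [raise, map_sum, mul_sum']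
  rw [h]
  refine Finset.sum_congr rfl fun j hj => ?_
  rw [letterMap_raise (Nat.lt_succ_iff.1 (Finset.mem_range.1 hj)), raise_smul]

variable (K deg) in
/-- The cocycle that belongs to a list of indices. -/
def listCocycle (u : List ι) : OTensor K deg u.length :=
  restit K deg u.length u (wordCocycle K u.length)

/-- Since the generator on words begins with the top letter only, a single summand of the
restitution remains: the new variable sits in a new last factor. -/
lemma listCocycle_cons (i : ι) (u : List ι) : listCocycle K deg (i :: u) =
    (((u.count i : K) + 1)⁻¹ * (-1) ^ u.length) • raise u.length i (listCocycle K deg u) := by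
  change restit K deg (u.length + 1) (i :: u) (wordCocycle K (u.length + 1)) = _
  rw [(wordCocycle_succ u.length).1, restit_cons, mul_smul]
  congr 1
  rw [Finset.sum_eq_single (Fin.last u.length)]
  · rw [map_smul, map_smul, mul_smul', slice_ins, if_pos (by simp), raise, listCocycle,
      letterMap_restit u _ (wordCocycle_mem _)]
  · intro l _ hl
    rw [map_smul, slice_ins, if_neg, smul_zero, map_zero, mul_zero']
    intro h
    exact hl (Fin.ext (by simpa using h))
  · simp

lemma lower_listCocycle_of_notMem (i : ι) : ∀ (k : ι) (u : List ι), i ∉ k :: u →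
    lower u.length i (listCocycle K deg (k :: u)) = 0 := by
  intro k u
  induction u generalizing k with
  | nil =>
    intro h
    rw [listCocycle_cons, map_smul]
    change _ • lower 0 i (raise 0 k _) = 0
    rw [lower_raise_zero, if_neg fun h' => h (by simp [h']), smul_zero]
  | cons k' u ih =>
    intro h
    rw [listCocycle_cons, map_smul]
    change _ • lower (u.length + 1) i (raise (u.length + 1) k _) = 0
    rw [lower_raise, if_neg fun h' => h (by simp [h']), ih k' fun h' => h (List.mem_cons_of_mem _ h'),
      raise_zero]
    simp

/-- Equal indices are adjacent in the list, and only indices of odd degree are repeated. -/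
def GoodList (deg : ι → ℤ) : List ι → Prop
  | [] => True
  | i :: u => GoodList deg u ∧ (i ∉ u ∨ (Odd (deg i) ∧ u.head? = some i))

/-- For a repeated odd index, every occurrence contributes equally after the signs: the newest gives
one and the older ones give `count + 1` by induction. Together they cancel the denominator of
`restit`. A new index gives just one term. -/
lemma lower_listCocycle (i : ι) (u : List ι) (hu : GoodList deg (i :: u)) :
    lower u.length i (listCocycle K deg (i :: u)) = listCocycle K deg u := by
  induction u with
  | nil =>
    rw [listCocycle_cons, map_smul]
    change _ • lower 0 i (raise 0 i _) = _
    rw [lower_raise_zero, if_pos rfl]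
    simp
  | cons k u ih =>
    obtain ⟨hu, hi⟩ := hu
    rw [listCocycle_cons, map_smul]
    change _ • lower (u.length + 1) i (raise (u.length + 1) i _) = _
    rw [lower_raise, if_pos rfl]
    have hsq : ∀ n : ℕ, ((-1 : K) ^ n) * (-1) ^ n = 1 := fun n => by rw [← mul_pow]; simp
    by_cases him : i ∈ k :: u
    · obtain ⟨hodd, hk⟩ := hi.resolve_left (not_not.2 him)
      obtain rfl : k = i := by simpa using hk
      rw [ih hu, sgn_of_odd (hodd.mul hodd), List.count_cons_self, Nat.cast_add, Nat.cast_one]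
      -- The recursion for the cocycle is inverted, so that both contributions become multiples of
      -- the same cocycle.
      have h1 : raise u.length k (listCocycle K deg u) =
          (((u.count k : K) + 1) * (-1) ^ u.length) • listCocycle K deg (k :: u) := by
        rw [listCocycle_cons, smul_smul]
        have h2 : ((u.count k : K) + 1) * (-1) ^ u.length *
            (((u.count k : K) + 1)⁻¹ * (-1) ^ u.length) = 1 := by
          have h3 : ((u.count k : K) + 1) ≠ 0 := Nat.cast_add_one_ne_zero _
          field_simp
          rw [pow_two, hsq]
        rw [h2, one_smul]
      rw [h1, smul_smul, ← add_smul, smul_smul]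
      convert one_smul K _
      have h4 : ((u.count k : K) + 1 + 1) ≠ 0 := by exact_mod_cast Nat.succ_ne_zero (u.count k + 1)
      rw [List.length_cons, mul_assoc, inv_mul_eq_iff_eq_mul₀ h4, mul_one]
      have h5 := hsq u.length
      rw [pow_succ]
      linear_combination ((u.count k : K) + 1 + 1) * h5
    · rw [lower_listCocycle_of_notMem i k u him, raise_zero, smul_zero, add_zero, smul_smul,
        List.count_eq_zero_of_not_mem him, List.length_cons]
      simp only [Nat.cast_zero, zero_add, inv_one, one_mul]
      rw [hsq, one_smul]

lemma wordForm_listCocycle (u : List ι) (hu : GoodList deg u) :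
    wordForm K u.length (polar K deg u.length u (listCocycle K deg u)) = 1 := by
  induction u with
  | nil =>
    change polar K deg 0 [] (restit K deg 0 [] (wordCocycle K 0)) [] = 1
    rw [polar_nil, if_pos rfl, restit_nil, coeff_smul, coeff_one]
    simp [wordCocycle]
  | cons i u ih =>
    change wordForm K (u.length + 1) (polar K deg (u.length + 1) (i :: u) _) = 1
    rw [wordForm_polar_cons, lower_listCocycle i u hu, ih hu.1]

/-- The exponents of monomials in variables of degrees `deg i + 1`. -/
def ShiftAdmissible (deg : ι → ℤ) (β : ι → ℕ) : Prop := ∀ i, Even (deg i) → β i ≤ 1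

lemma goodList_flatMap (β : ι → ℕ) (hβ : ShiftAdmissible deg β) (L : List ι) (hL : L.Nodup) :
    GoodList deg (L.flatMap fun i => List.replicate (β i) i) := by
  induction L with
  | nil => trivial
  | cons i L ih =>
    obtain ⟨hi, hL⟩ := List.nodup_cons.1 hL
    rw [List.flatMap_cons]
    have hnot : i ∉ L.flatMap fun i => List.replicate (β i) i := by
      intro h
      obtain ⟨j, hj, hij⟩ := List.mem_flatMap.1 h
      exact hi ((List.eq_of_mem_replicate hij) ▸ hj)
    have hb : ∀ b ≤ β i, GoodList deg (List.replicate b i ++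
        L.flatMap fun i => List.replicate (β i) i) := by
      intro b
      induction b with
      | zero => intro _; simpa using ih hL
      | succ b ihb =>
        intro hb
        rw [List.replicate_succ, List.cons_append]
        refine ⟨ihb (by omega), ?_⟩
        cases b with
        | zero => left; simpa using hnot
        | succ b =>
          right
          refine ⟨?_, by simp [List.replicate_succ]⟩
          by_contra h
          have := hβ i (Int.not_odd_iff_even.1 h)
          omega
    exact hb _ le_rfl

/-- `wordOf` lists equal indices consecutively, so a repeated even index is adjacent to its copy and
the antisymmetry applies. -/
lemma cobarForm_eq_zero {n : ℕ} {β : ι → ℕ} (hn : n = ∑ i, β i) (hβ : ¬ ShiftAdmissible deg β)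
    (F : OTensor K deg n) : cobarForm K deg n β F = 0 := by
  simp only [ShiftAdmissible, not_forall, not_le] at hβ
  obtain ⟨i, hi, h2⟩ := hβ
  have hw : ∃ pre rest, wordOf β = pre ++ i :: i :: rest := by
    obtain ⟨l1, l2, hl⟩ := List.append_of_mem
      ((Finset.mem_sort (α := ι) (s := Finset.univ) (r := (· ≤ ·))).2 (Finset.mem_univ i))
    obtain ⟨b, hb⟩ : ∃ b, β i = b + 2 := ⟨β i - 2, by omega⟩
    refine ⟨l1.flatMap fun i => List.replicate (β i) i,
      List.replicate b i ++ l2.flatMap fun i => List.replicate (β i) i, ?_⟩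
    rw [wordOf, hl, List.flatMap_append, List.flatMap_cons, hb]
    simp [List.replicate_succ]
  obtain ⟨pre, rest, hw⟩ := hw
  have hlen := length_wordOf β
  rw [cobarForm, LinearMap.comp_apply, hw]
  exact wordForm_polar_repeat n pre i rest hi F (by rw [← hw, hlen, hn])

lemma cobarForm_cocycle {n : ℕ} {β : ι → ℕ} (hn : n = ∑ i, β i) (hβ : ShiftAdmissible deg β) :
    cobarForm K deg n β (cobarCocycle K deg n β) = 1 := by
  rw [← length_wordOf] at hn
  subst hn
  exact wordForm_listCocycle _ (goodList_flatMap β hβ _ (Finset.sort_nodup _ _))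

lemma coeff_cobarCocycle {n : ℕ} {β : ι → ℕ} {a : Fin n ×ₗ ι → ℕ} (h : wt a ≠ β) :
    coeff (cobarCocycle K deg n β) a = 0 :=
  coeff_restit _ _ _ _ (by rwa [cnt_wordOf])

lemma cobarForm_congr {n : ℕ} {β : ι → ℕ} {F G : OTensor K deg n}
    (h : ∀ a, wt a = β → coeff F a = coeff G a) :
    cobarForm K deg n β F = cobarForm K deg n β G := by
  rw [cobarForm, LinearMap.comp_apply, LinearMap.comp_apply, polar_congr (F := F) (G := G)]
  rwa [cnt_wordOf]

lemma cobarForm_cocycle_of_ne {n : ℕ} {β β' : ι → ℕ} (h : β ≠ β') :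
    cobarForm K deg n β (cobarCocycle K deg n β') = 0 := by
  rw [cobarForm_congr (G := 0), map_zero]
  intro a ha
  rw [coeff_cobarCocycle (by rwa [ha]), coeff_zero]

lemma cobarForm_cobar {n : ℕ} {β : ι → ℕ} (hn : n + 1 = ∑ i, β i) (F : OTensor K deg n) :
    cobarForm K deg (n + 1) β (cobar K deg n F) = 0 := by
  rw [cobarForm, LinearMap.comp_apply, polar_cobar]
  refine wordForm_del ?_
  rw [hn, ← length_wordOf]
  exact polar_mem _ _ _

lemma cobar_cobarCocycle {n : ℕ} {β : ι → ℕ} (hn : n = ∑ i, β i) :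
    cobar K deg n (cobarCocycle K deg n β) = 0 := by
  rw [cobarCocycle, ← restit_del, del_wordCocycle, map_zero]
  rw [length_wordOf, ← hn]
  exact wordCocycle_mem n

open Classical in
/-- The multidegrees of the classes in dimension `n`. -/
def classIndex (deg : ι → ℤ) (n : ℕ) : Finset (ι → ℕ) :=
  (Finset.piAntidiag Finset.univ n).filter (ShiftAdmissible deg)

lemma mem_classIndex {n : ℕ} {β : ι → ℕ} :
    β ∈ classIndex deg n ↔ n = ∑ i, β i ∧ ShiftAdmissible deg β := by
  simp [classIndex, eq_comm]

variable (K deg) in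
/-- The projection of the cobar complex to its cohomology. -/
def cobarProj (n : ℕ) : OTensor K deg n →ₗ[K] OTensor K deg n :=
  ∑ β ∈ classIndex deg n, (cobarForm K deg n β).smulRight (cobarCocycle K deg n β)

lemma cobarProj_apply (n : ℕ) (F : OTensor K deg n) : cobarProj K deg n F =
    ∑ β ∈ classIndex deg n, cobarForm K deg n β F • cobarCocycle K deg n β := by
  simp [cobarProj]

/-- The cohomology of the cobar complex of a graded-commutative formal power series algebra. -/
theorem cobarHtpy_spec (n : ℕ) (F : OTensor K deg (n + 1)) :
    cobar K deg n (cobarHtpy K deg n F) + cobarHtpy K deg (n + 1) (cobar K deg (n + 1) F) =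
      F - cobarProj K deg (n + 1) F := by
  refine series_ext fun a _ => ?_
  rw [coeff_cobarHtpy_spec, coeff_sub, cobarProj_apply, coeff_sum]
  congr 1
  have h1 : ∀ β ∈ classIndex deg (n + 1), β ≠ wt a →
      coeff (cobarForm K deg (n + 1) β F • cobarCocycle K deg (n + 1) β) a = 0 := fun β _ hβ => by
    rw [coeff_smul, coeff_cobarCocycle hβ.symm, mul_zero]
  by_cases hm : wt a ∈ classIndex deg (n + 1)
  · rw [Finset.sum_eq_single_of_mem _ hm h1, if_pos (mem_classIndex.1 hm).1, coeff_smul]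
  · rw [Finset.sum_eq_zero fun β hβ => h1 β hβ fun h => hm (h ▸ hβ)]
    -- A multidegree of the right length outside `classIndex` repeats an even variable; its cocycle
    -- may be nonzero, but the form vanishes.
    split_ifs with h
    · rw [cobarForm_eq_zero h fun h' => hm (mem_classIndex.2 ⟨h, h'⟩), zero_mul]
    · rfl

lemma cobarProj_cobar (n : ℕ) (F : OTensor K deg n) :
    cobarProj K deg (n + 1) (cobar K deg n F) = 0 := by
  rw [cobarProj_apply]
  exact Finset.sum_eq_zero fun β hβ => by
    rw [cobarForm_cobar (mem_classIndex.1 hβ).1, zero_smul]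

lemma cobar_cobarProj (n : ℕ) (F : OTensor K deg n) :
    cobar K deg n (cobarProj K deg n F) = 0 := by
  rw [cobarProj_apply, map_sum]
  exact Finset.sum_eq_zero fun β hβ => by
    rw [map_smul, cobar_cobarCocycle (mem_classIndex.1 hβ).1, smul_zero]

end Cobar

end GerstenhaberSchack

end

noncomputable section

namespace GerstenhaberSchack

/-! ### Slices of tensor powers -/

section Slices

set_option linter.unusedSectionVars false

variable {K : Type*} [Field K] {ι : Type*} {deg : ι → ℤ}

lemma consExp_head_tail {n : ℕ} (b : Fin (n + 1) ×ₗ ι → ℕ) : consExp (headExp b) (tailExp b) = b := by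
  funext t
  obtain ⟨⟨k, i⟩, rfl⟩ := toLex.surjective t
  cases k using Fin.cases <;> rfl

@[simp] lemma lastExp_snocExp {n : ℕ} (a : Fin n ×ₗ ι → ℕ) (c : ι → ℕ) :
    lastExp (snocExp a c) = c := by
  funext i
  simp [lastExp, snocExp]

@[simp] lemma initExp_snocExp {n : ℕ} (a : Fin n ×ₗ ι → ℕ) (c : ι → ℕ) :
    initExp (snocExp a c) = a := by
  funext t
  simp only [initExp, snocExp, ofLex_toLex, Fin.lastCases_castSucc]
  rfl

lemma snocExp_init_last {n : ℕ} (b : Fin (n + 1) ×ₗ ι → ℕ) : snocExp (initExp b) (lastExp b) = b := by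
  funext t
  obtain ⟨⟨k, i⟩, rfl⟩ := toLex.surjective t
  cases k using Fin.lastCases <;> simp [snocExp, initExp, lastExp]

lemma Admissible.head {n : ℕ} {b : Fin (n + 1) ×ₗ ι → ℕ} (h : Admissible (tensorDeg deg (n + 1)) b) :
    Admissible deg (headExp b) := fun i hi => h (toLex (0, i)) hi

lemma Admissible.tail {n : ℕ} {b : Fin (n + 1) ×ₗ ι → ℕ} (h : Admissible (tensorDeg deg (n + 1)) b) :
    Admissible (tensorDeg deg n) (tailExp b) := fun t ht => h (toLex ((ofLex t).1.succ, _)) ht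

lemma Admissible.last {n : ℕ} {b : Fin (n + 1) ×ₗ ι → ℕ} (h : Admissible (tensorDeg deg (n + 1)) b) :
    Admissible deg (lastExp b) := fun i hi => h (toLex (Fin.last n, i)) hi

lemma Admissible.front {n : ℕ} {b : Fin (n + 1) ×ₗ ι → ℕ} (h : Admissible (tensorDeg deg (n + 1)) b) :
    Admissible (tensorDeg deg n) (initExp b) := fun t ht => h (toLex ((ofLex t).1.castSucc, _)) ht

/-- The part `F_c` of a series `∑ x^c ⊗ F_c`. -/
def sliceHead {n : ℕ} (c : ι → ℕ) : OTensor K deg (n + 1) →ₗ[K] OTensor K deg n where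
  toFun F := ofCoeff fun a => coeff F (consExp c a)
  map_add' F G := by simp only [coeff_add, ofCoeff_add]
  map_smul' k F := by simp only [coeff_smul, ofCoeff_smul, RingHom.id_apply]

lemma coeff_sliceHead {n : ℕ} (c : ι → ℕ) (F : OTensor K deg (n + 1)) (a : Fin n ×ₗ ι → ℕ) :
    coeff (sliceHead c F) a = coeff F (consExp c a) :=
  coeff_ofCoeff_of_imp (g := fun a => coeff F (consExp c a))
    fun h => coeff_of_not_admissible fun h' => h h'.tail

lemma ext_sliceHead {n : ℕ} {F G : OTensor K deg (n + 1)} (h : ∀ c, sliceHead c F = sliceHead c G) :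
    F = G := by
  refine series_ext fun a _ => ?_
  rw [← consExp_head_tail a, ← coeff_sliceHead, h, coeff_sliceHead]

/-- The part `F_c` of a series `∑ F_c ⊗ x^c`. -/
def sliceLast {n : ℕ} (c : ι → ℕ) : OTensor K deg (n + 1) →ₗ[K] OTensor K deg n where
  toFun F := ofCoeff fun a => coeff F (snocExp a c)
  map_add' F G := by simp only [coeff_add, ofCoeff_add]
  map_smul' k F := by simp only [coeff_smul, ofCoeff_smul, RingHom.id_apply]

lemma coeff_sliceLast {n : ℕ} (c : ι → ℕ) (F : OTensor K deg (n + 1)) (a : Fin n ×ₗ ι → ℕ) :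
    coeff (sliceLast c F) a = coeff F (snocExp a c) :=
  coeff_ofCoeff_of_imp (g := fun a => coeff F (snocExp a c))
    fun h => coeff_of_not_admissible fun h' => h (by simpa using h'.front)

lemma ext_sliceLast {n : ℕ} {F G : OTensor K deg (n + 1)} (h : ∀ c, sliceLast c F = sliceLast c G) :
    F = G := by
  refine series_ext fun a _ => ?_
  rw [← snocExp_init_last a, ← coeff_sliceLast, h, coeff_sliceLast]

variable [Fintype ι] [LinearOrder ι]

/-- Conjugating `f` by the twist of degree `|c|` multiplies a component of degree `e` by `(-1) ^
(|c| e)`. The Koszul rule thus makes sense without assuming `f` homogeneous. -/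
lemma sliceHead_idTensor {p q : ℕ} (f : OTensor K deg p →ₗ[K] OTensor K deg q) (c : ι → ℕ)
    (F : OTensor K deg (p + 1)) : sliceHead c (idTensor f F) =
      tw (degree deg c) (f (tw (degree deg c) (sliceHead c F))) := by
  have h1 : (ofCoeff fun a => sgn K (degree deg c * degree (tensorDeg deg p) a) *
      coeff F (consExp c a)) = tw (degree deg c) (sliceHead c F) := by
    refine series_ext fun a ha => ?_
    rw [coeff_ofCoeff ha, coeff_tw, coeff_sliceHead]
  refine series_ext fun a ha => ?_
  rw [coeff_sliceHead, coeff_tw, ← h1, idTensor_apply]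
  by_cases h : Admissible deg c
  · refine coeff_ofCoeff (fun t ht => ?_)
    obtain ⟨⟨k, i⟩, rfl⟩ := toLex.surjective t
    cases k using Fin.cases with
    | zero => exact h i ht
    | succ k => exact ha (toLex (k, i)) ht
  · have h2 : sliceHead c F = 0 := series_ext fun a ha => by
      rw [coeff_sliceHead, coeff_zero, coeff_of_not_admissible fun h' => h h'.head]
    rw [h1, h2, map_zero, map_zero, coeff_zero, mul_zero]
    exact coeff_of_not_admissible fun h' => h h'.head

lemma sliceLast_tensorId {p q : ℕ} (f : OTensor K deg p →ₗ[K] OTensor K deg q) (c : ι → ℕ)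
    (F : OTensor K deg (p + 1)) : sliceLast c (tensorId f F) = f (sliceLast c F) := by
  refine series_ext fun a ha => ?_
  rw [coeff_sliceLast, tensorId_apply]
  by_cases h : Admissible deg c
  · rw [coeff_ofCoeff, lastExp_snocExp, initExp_snocExp]
    · rfl
    intro t ht
    obtain ⟨⟨k, i⟩, rfl⟩ := toLex.surjective t
    cases k using Fin.lastCases with
    | last => simpa [snocExp] using h i ht
    | cast k => simpa [snocExp] using ha (toLex (k, i)) ht
  · have h2 : sliceLast c F = 0 := series_ext fun a ha => by
      rw [coeff_sliceLast, coeff_zero,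
        coeff_of_not_admissible fun h' => h (by simpa using h'.last)]
    rw [h2, map_zero, coeff_zero]
    exact coeff_of_not_admissible fun h' => h (by simpa using h'.last)

lemma prod_lex {M : Type*} [CommMonoid M] {n : ℕ} (f : Fin n ×ₗ ι → M) :
    ∏ t, f t = ∏ k, ∏ i, f (toLex (k, i)) := by
  rw [← Fintype.prod_prod_type' (f := fun k i => f (toLex (k, i)))]
  exact (Fintype.prod_equiv toLex _ _ fun _ => rfl).symm

/-- In the lexicographic order the variables before `(k, i)` are all those of the earlier factors
and the smaller ones of the same factor. -/
lemma lam_toLex {n : ℕ} (k : Fin n) (i : ι) (a : Fin n ×ₗ ι → ℕ) :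
    lam K (tensorDeg deg n) (toLex (k, i)) a =
      (∏ k', if k' < k then ∏ j, sgn K (deg i * (a (toLex (k', j)) * deg j)) else 1) *
        lam K deg i (fun j => a (toLex (k, j))) := by
  have h : ∀ k', (∏ j, if toLex (k', j) < toLex (k, i) then
      sgn K (deg i * (a (toLex (k', j)) * deg j)) else 1) =
      (if k' < k then ∏ j, sgn K (deg i * (a (toLex (k', j)) * deg j)) else 1) *
        (if k' = k then lam K deg i (fun j => a (toLex (k, j))) else 1) := by
    intro k'
    rcases lt_trichotomy k' k with h | rfl | h
    · simp [Prod.Lex.toLex_lt_toLex, h, h.ne]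
    · simp [Prod.Lex.toLex_lt_toLex, lam, Finset.prod_filter]
    · simp [Prod.Lex.toLex_lt_toLex, h.not_gt, h.ne']
  rw [lam, Finset.prod_filter, prod_lex]
  simp only [tensorDeg_toLex]
  rw [Finset.prod_congr rfl fun k' _ => h k', Finset.prod_mul_distrib]
  simp

lemma sgn_degree (d : ℤ) (c : ι → ℕ) :
    sgn K (d * degree deg c) = ∏ j, sgn K (d * (c j * deg j)) := by
  rw [degree, Finset.mul_sum, sgn_sum]

lemma lam_consExp_succ {n : ℕ} (k : Fin n) (i : ι) (c : ι → ℕ) (a : Fin n ×ₗ ι → ℕ) :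
    lam K (tensorDeg deg (n + 1)) (toLex (k.succ, i)) (consExp c a) =
      sgn K (deg i * degree deg c) * lam K (tensorDeg deg n) (toLex (k, i)) a := by
  rw [lam_toLex, lam_toLex, Fin.prod_univ_succ, sgn_degree, mul_assoc]
  simp [consExp]

lemma lam_consExp_zero {n : ℕ} (i : ι) (c : ι → ℕ) (a : Fin n ×ₗ ι → ℕ) :
    lam K (tensorDeg deg (n + 1)) (toLex (0, i)) (consExp c a) = lam K deg i c := by
  rw [lam_toLex]
  simp [consExp]

lemma lam_snocExp_castSucc {n : ℕ} (k : Fin n) (i : ι) (c : ι → ℕ) (a : Fin n ×ₗ ι → ℕ) :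
    lam K (tensorDeg deg (n + 1)) (toLex (k.castSucc, i)) (snocExp a c) =
      lam K (tensorDeg deg n) (toLex (k, i)) a := by
  rw [lam_toLex, lam_toLex, Fin.prod_univ_castSucc]
  simp [snocExp, (Fin.castSucc_lt_last k).not_gt]

lemma lam_snocExp_last {n : ℕ} (i : ι) (c : ι → ℕ) (a : Fin n ×ₗ ι → ℕ) :
    lam K (tensorDeg deg (n + 1)) (toLex (Fin.last n, i)) (snocExp a c) =
      sgn K (deg i * degree (tensorDeg deg n) a) * lam K deg i c := by
  rw [lam_toLex, Fin.prod_univ_castSucc, sgn_degree, prod_lex]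
  simp [snocExp, Fin.castSucc_lt_last]

lemma consExp_add_single_succ {n : ℕ} (k : Fin n) (i : ι) (c : ι → ℕ) (a : Fin n ×ₗ ι → ℕ) :
    consExp c a + Pi.single (toLex (k.succ, i)) 1 = consExp c (a + Pi.single (toLex (k, i)) 1) := by
  funext t
  obtain ⟨⟨l, j⟩, rfl⟩ := toLex.surjective t
  cases l using Fin.cases <;> simp [consExp, Pi.single_apply, Fin.ext_iff]

lemma consExp_add_single_zero {n : ℕ} (i : ι) (c : ι → ℕ) (a : Fin n ×ₗ ι → ℕ) :
    consExp c a + Pi.single (toLex (0, i)) 1 = consExp (c + Pi.single i 1) a := by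
  funext t
  obtain ⟨⟨l, j⟩, rfl⟩ := toLex.surjective t
  cases l using Fin.cases <;> simp [consExp, Pi.single_apply, Fin.ext_iff]

lemma snocExp_add_single_castSucc {n : ℕ} (k : Fin n) (i : ι) (c : ι → ℕ) (a : Fin n ×ₗ ι → ℕ) :
    snocExp a c + Pi.single (toLex (k.castSucc, i)) 1 =
      snocExp (a + Pi.single (toLex (k, i)) 1) c := by
  funext t
  obtain ⟨⟨l, j⟩, rfl⟩ := toLex.surjective t
  cases l using Fin.lastCases <;> simp [snocExp, Pi.single_apply, Fin.ext_iff, k.2.ne']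

lemma snocExp_add_single_last {n : ℕ} (i : ι) (c : ι → ℕ) (a : Fin n ×ₗ ι → ℕ) :
    snocExp a c + Pi.single (toLex (Fin.last n, i)) 1 = snocExp a (c + Pi.single i 1) := by
  funext t
  obtain ⟨⟨l, j⟩, rfl⟩ := toLex.surjective t
  cases l using Fin.lastCases with
  | last => simp [snocExp, Pi.single_apply]
  | cast l => simp [snocExp, Fin.ext_iff, l.2.ne]

lemma sliceHead_pd_succ {n : ℕ} (c : ι → ℕ) (k : Fin n) (i : ι) (F : OTensor K deg (n + 1)) :
    sliceHead c (pd k.succ i F) = sgn K (deg i * degree deg c) • pd k i (sliceHead c F) := by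
  refine series_ext fun a _ => ?_
  rw [coeff_sliceHead, coeff_partialD, coeff_smul, coeff_partialD, coeff_sliceHead,
    lam_consExp_succ, consExp_add_single_succ]
  simp only [consExp, ofLex_toLex, Fin.cases_succ]
  ring

lemma sliceHead_pd_zero {n : ℕ} (c : ι → ℕ) (i : ι) (F : OTensor K deg (n + 1)) :
    sliceHead c (pd 0 i F) = (lam K deg i c * (c i + 1)) • sliceHead (c + Pi.single i 1) F := by
  refine series_ext fun a _ => ?_
  rw [coeff_sliceHead, coeff_partialD, coeff_smul, coeff_sliceHead,
    lam_consExp_zero, consExp_add_single_zero]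
  simp only [consExp, ofLex_toLex, Fin.cases_zero]

lemma sliceLast_pd_castSucc {n : ℕ} (c : ι → ℕ) (k : Fin n) (i : ι) (F : OTensor K deg (n + 1)) :
    sliceLast c (pd k.castSucc i F) = pd k i (sliceLast c F) := by
  refine series_ext fun a _ => ?_
  rw [coeff_sliceLast, coeff_partialD, coeff_partialD, coeff_sliceLast,
    lam_snocExp_castSucc, snocExp_add_single_castSucc]
  simp only [snocExp, ofLex_toLex, Fin.lastCases_castSucc]

lemma sliceLast_pd_last {n : ℕ} (c : ι → ℕ) (i : ι) (F : OTensor K deg (n + 1)) :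
    sliceLast c (pd (Fin.last n) i F) =
      (lam K deg i c * (c i + 1)) • tw (deg i) (sliceLast (c + Pi.single i 1) F) := by
  refine series_ext fun a _ => ?_
  rw [coeff_sliceLast, coeff_partialD, coeff_smul, coeff_tw, coeff_sliceLast,
    lam_snocExp_last, snocExp_add_single_last]
  simp only [snocExp, ofLex_toLex, Fin.lastCases_last]
  ring

end Slices

/-! ### Tensoring an operator with the identity -/

section Whisker

set_option linter.unusedSectionVars false

variable (K : Type*) [Field K] {ι : Type*} (deg : ι → ℤ) [Fintype ι] [LinearOrder ι]

/-- The properties shared by `f ↦ id ⊗ f` and `f ↦ f ⊗ id`; the new tensor factor is `pos`. -/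
structure Whisker where
  /-- the position of the new tensor factor -/
  pos : ∀ p : ℕ, Fin (p + 1)
  /-- the operator tensored with the identity -/
  map : ∀ {p q : ℕ}, (OTensor K deg p →ₗ[K] OTensor K deg q) →
    (OTensor K deg (p + 1) →ₗ[K] OTensor K deg (q + 1))
  /-- the part without variables of the new tensor factor -/
  part : ∀ {p : ℕ}, OTensor K deg (p + 1) → OTensor K deg p
  map_add : ∀ {p q : ℕ} (f g : OTensor K deg p →ₗ[K] OTensor K deg q), map (f + g) = map f + map g
  map_smul : ∀ {p q : ℕ} (c : K) (f : OTensor K deg p →ₗ[K] OTensor K deg q),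
    map (c • f) = c • map f
  map_id : ∀ p : ℕ, map (LinearMap.id : OTensor K deg p →ₗ[K] _) = LinearMap.id
  map_comp : ∀ {p q r : ℕ} (f : OTensor K deg q →ₗ[K] OTensor K deg r)
    (g : OTensor K deg p →ₗ[K] OTensor K deg q), map (f ∘ₗ g) = map f ∘ₗ map g
  map_pd : ∀ {p : ℕ} (k : Fin p) (i : ι), map (pd k i) = pd ((pos p).succAbove k) i
  -- The conjugation by `tw` is the Koszul sign for exchanging `f` with a derivative of degree `-deg
  -- i`.
  pd_pos : ∀ {p q : ℕ} (f : OTensor K deg p →ₗ[K] OTensor K deg q) (i : ι)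
    (F : OTensor K deg (p + 1)), pd (pos q) i (map f F) =
      map (tw (deg i) ∘ₗ f ∘ₗ tw (deg i)) (pd (pos p) i F)
  -- This and the next field supply the constant terms for coinduction, where no sign can occur.
  coeff_map : ∀ {p q : ℕ} (f : OTensor K deg p →ₗ[K] OTensor K deg q) (F : OTensor K deg (p + 1)),
    coeff (map f F) 0 = coeff (f (part F)) 0
  coeff_part : ∀ {p : ℕ} (F : OTensor K deg (p + 1)), coeff (part F) 0 = coeff F 0

variable {K deg} in
lemma tw_zero_degree_comp {p q : ℕ} (f : OTensor K deg p →ₗ[K] OTensor K deg q) (i : ι) (d : ℤ)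
    (F : OTensor K deg p) : tw (d + deg i) (f (tw (d + deg i) F)) =
      tw d ((tw (deg i) ∘ₗ f ∘ₗ tw (deg i)) (tw d F)) := by
  simp only [LinearMap.comp_apply]
  rw [tw_add_tw, add_comm, tw_add_tw]

/-- The operators `id ⊗ f`. -/
def headWhisker : Whisker K deg where
  pos _ := 0
  map := idTensor
  part := sliceHead 0
  map_add := idTensor_add
  map_smul := idTensor_smul
  map_id p := by
    refine LinearMap.ext fun F => ext_sliceHead fun c => ?_
    rw [sliceHead_idTensor, LinearMap.id_apply, LinearMap.id_apply, tw_tw]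
  map_comp f g := by
    refine LinearMap.ext fun F => ext_sliceHead fun c => ?_
    simp only [sliceHead_idTensor, LinearMap.comp_apply, tw_tw]
  map_pd k i := by
    refine LinearMap.ext fun F => ext_sliceHead fun c => ?_
    rw [sliceHead_idTensor, Fin.succAbove_zero, sliceHead_pd_succ, partialD_tw, map_smul, tw_tw,
      mul_comm]
    rfl
  pd_pos f i F := by
    refine ext_sliceHead fun c => ?_
    rw [sliceHead_pd_zero, sliceHead_idTensor, sliceHead_idTensor, sliceHead_pd_zero, degree_add,
      degree_single, tw_zero_degree_comp]
    simp only [map_smul]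
  coeff_map f F := by
    have h := congrArg (coeff · 0) (sliceHead_idTensor f 0 F)
    simp only [degree_zero, tw_zero, coeff_sliceHead] at h
    rw [← h]
    congr 1
    exact (consExp_head_tail 0).symm
  coeff_part F := by
    rw [coeff_sliceHead]
    congr 1
    exact consExp_head_tail 0

/-- The operators `f ⊗ id`. -/
def lastWhisker : Whisker K deg where
  pos p := Fin.last p
  map := tensorId
  part := sliceLast 0
  map_add := tensorId_add
  map_smul := tensorId_smul
  map_id p := by
    refine LinearMap.ext fun F => ext_sliceLast fun c => ?_
    rw [sliceLast_tensorId, LinearMap.id_apply, LinearMap.id_apply]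
  map_comp f g := by
    refine LinearMap.ext fun F => ext_sliceLast fun c => ?_
    simp only [sliceLast_tensorId, LinearMap.comp_apply]
  map_pd k i := by
    refine LinearMap.ext fun F => ext_sliceLast fun c => ?_
    rw [sliceLast_tensorId, Fin.succAbove_last, sliceLast_pd_castSucc]
  pd_pos f i F := by
    refine ext_sliceLast fun c => ?_
    rw [sliceLast_pd_last, sliceLast_tensorId, sliceLast_tensorId, sliceLast_pd_last]
    simp only [LinearMap.comp_apply, map_smul, tw_tw]
  coeff_map f F := by
    have h := congrArg (coeff · 0) (sliceLast_tensorId f 0 F)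
    simp only [coeff_sliceLast] at h
    rw [← h]
    congr 1
    exact (snocExp_init_last 0).symm
  coeff_part F := by
    rw [coeff_sliceLast]
    congr 1
    exact snocExp_init_last 0

end Whisker

end GerstenhaberSchack

end

noncomputable section

namespace GerstenhaberSchack

/-! ### Structure maps and whiskering -/

section StructureMaps

set_option linter.unusedSectionVars false

variable {K : Type*} [Field K] {ι : Type*} {deg : ι → ℤ} [Fintype ι] [LinearOrder ι]

/-- The insertion of a tensor factor `1`. -/
def insOne {n : ℕ} (z : Fin (n + 1)) : OTensor K deg n →ₗ[K] OTensor K deg (n + 1) :=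
  slotMap fun k => {z.succAbove k}

/-- The action of a tensor factor on the others through the iterated comultiplication. -/
def act {n : ℕ} (z : Fin (n + 1)) : OTensor K deg (n + 1) →ₗ[K] OTensor K deg n :=
  slotMap (Fin.insertNth (α := fun _ => Finset (Fin n)) z Finset.univ fun k => {k})

/-- The coaction, with its first component in the tensor factor `z`. -/
def coact {n : ℕ} (z : Fin (n + 1)) : OTensor K deg n →ₗ[K] OTensor K deg (n + 1) :=
  slotMap fun k => {z, z.succAbove k}

/-- The map `f₁ ⊗ ⋯ ⊗ f_m ↦ Δ^(n-1)(f₁) ⋯ Δ^(n-1)(f_m)`. -/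
def spread (m n : ℕ) : OTensor K deg m →ₗ[K] OTensor K deg n := slotMap fun _ => Finset.univ

lemma leftAct_eq (n : ℕ) : (leftAct n : OTensor K deg (n + 1) →ₗ[K] _) = act 0 := by
  unfold leftAct act
  congr 1
  funext k
  cases k using Fin.cases <;> simp

lemma rightAct_eq (n : ℕ) : (rightAct n : OTensor K deg (n + 1) →ₗ[K] _) = act (Fin.last n) := by
  unfold rightAct act
  congr 1
  funext k
  cases k using Fin.lastCases <;> simp

lemma leftCoact_eq (n : ℕ) : (leftCoact n : OTensor K deg n →ₗ[K] _) = coact 0 := by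
  simp [leftCoact, coact]

lemma rightCoact_eq (n : ℕ) : (rightCoact n : OTensor K deg n →ₗ[K] _) = coact (Fin.last n) := by
  simp [rightCoact, coact, Finset.pair_comm]

lemma pd_insOne_self {n : ℕ} (z : Fin (n + 1)) (i : ι) (P : OTensor K deg n) :
    pd z i (insOne z P) = 0 := by
  rw [insOne, pd_slotMap, Finset.sum_filter]
  simp [(Fin.succAbove_ne z _).symm]

lemma pd_insOne {n : ℕ} (z : Fin (n + 1)) (k : Fin n) (i : ι) (P : OTensor K deg n) :
    pd (z.succAbove k) i (insOne z P) = insOne z (pd k i P) := by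
  rw [insOne, pd_slotMap, Finset.sum_filter]
  simp

lemma pd_act {n : ℕ} (z : Fin (n + 1)) (l : Fin n) (i : ι) (F : OTensor K deg (n + 1)) :
    pd l i (act z F) = act z (pd z i F + pd (z.succAbove l) i F) := by
  rw [act, pd_slotMap, Finset.sum_filter, Fin.sum_univ_succAbove _ z, map_add]
  simp

lemma pd_coact_self {n : ℕ} (z : Fin (n + 1)) (i : ι) (F : OTensor K deg n) :
    pd z i (coact z F) = ∑ k, coact z (pd k i F) := by
  rw [coact, pd_slotMap, Finset.sum_filter]
  simp

lemma pd_coact {n : ℕ} (z : Fin (n + 1)) (k : Fin n) (i : ι) (F : OTensor K deg n) :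
    pd (z.succAbove k) i (coact z F) = coact z (pd k i F) := by
  rw [coact, pd_slotMap, Finset.sum_filter]
  simp [Fin.succAbove_ne]

lemma pd_spread {m n : ℕ} (l : Fin n) (i : ι) (F : OTensor K deg m) :
    pd l i (spread m n F) = ∑ k, spread m n (pd k i F) := by
  rw [spread, pd_slotMap]
  simp

variable [CharZero K]

lemma act_insOne {n : ℕ} (z : Fin (n + 1)) (P : OTensor K deg n) : act z (insOne z P) = P := by
  refine eq_of_coinduction (fun P : OTensor K deg n => act z (insOne z P)) id ?_ ?_ P
  · intro P
    simp [act, insOne, coeff_zero_slotMap]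
  · intro P l i
    rw [pd_act, pd_insOne_self, pd_insOne, zero_add]
    exact Submodule.subset_span ⟨_, rfl⟩

lemma act_mul {n : ℕ} (z : Fin (n + 1)) (F G : OTensor K deg (n + 1)) :
    act z (F * G) = act z F * act z G := slotMap_mul _ F G

/-- Each input is merged into exactly one factor before being spread, so no multiplicities arise in
the composite. -/
lemma spread_multAt {m n : ℕ} (j : Fin m) (F : OTensor K deg (m + 1)) :
    spread m n (multAt j F) = spread (m + 1) n F :=
  slotMap_comp _ _ _ (fun k l => by simp [Finset.filter_eq']) F

lemma comultAt_spread {m n : ℕ} (j : Fin n) (F : OTensor K deg m) :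
    comultAt j (spread m n F) = spread m (n + 1) F :=
  slotMap_comp _ _ _ (fun k l => by simp [Finset.filter_eq]) F

namespace Whisker

variable (W : Whisker K deg)

lemma map_sum {p q : ℕ} {α : Type*} (s : Finset α) (f : α → OTensor K deg p →ₗ[K] OTensor K deg q) :
    W.map (∑ x ∈ s, f x) = ∑ x ∈ s, W.map (f x) := by
  classical
  have h0 : W.map (0 : OTensor K deg p →ₗ[K] OTensor K deg q) = 0 := by
    have := W.map_smul (0 : K) (0 : OTensor K deg p →ₗ[K] OTensor K deg q)
    rwa [zero_smul, zero_smul] at this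
  induction s using Finset.induction_on with
  | empty => simpa using h0
  | insert x s hx ih => rw [Finset.sum_insert hx, Finset.sum_insert hx, W.map_add, ih]

lemma pd_map {p q : ℕ} (f : OTensor K deg p →ₗ[K] OTensor K deg q) (k : Fin q) (i : ι)
    (F : OTensor K deg (p + 1)) : pd ((W.pos q).succAbove k) i (W.map f F) =
      W.map (pd k i ∘ₗ f) F := by
  rw [W.map_comp, W.map_pd]
  rfl

/-- Multiplying by a coefficient with a unit inserted at the new factor satisfies the same Leibniz
rules as the whiskered multiplication. The derivative at the new factor only twists `P`, hence the
coinduction over pairs. -/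
lemma map_mulLeft {n : ℕ} (P : OTensor K deg n) :
    W.map (mulLeft P) = mulLeft (insOne (W.pos n) P) := by
  refine LinearMap.ext fun F => ?_
  rw [mulLeft_apply]
  refine eq_of_coinduction (fun x : OTensor K deg n × OTensor K deg (n + 1) =>
    W.map (mulLeft x.1) x.2) (fun x => insOne (W.pos n) x.1 * x.2) ?_ ?_ (P, F)
  · rintro ⟨P, F⟩
    simp only [W.coeff_map, mulLeft_apply, coeff_zero_mul, insOne, coeff_zero_slotMap, W.coeff_part]
  · rintro ⟨P, F⟩ l i
    rcases Fin.eq_self_or_eq_succAbove (W.pos n) l with rfl | ⟨k, rfl⟩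
    · have h : tw (deg i) ∘ₗ mulLeft P ∘ₗ tw (deg i) = mulLeft (tw (deg i) P) := by
        refine LinearMap.ext fun G => ?_
        simp only [LinearMap.comp_apply, mulLeft_apply, tw_mul, tw_tw]
      rw [W.pd_pos, h, partialD_mul, pd_insOne_self, zero_mul', zero_add, tensorDeg_toLex,
        insOne, ← slotMap_tw]
      exact Submodule.subset_span ⟨(tw (deg i) P, _), rfl⟩
    · have h : pd k i ∘ₗ mulLeft P = mulLeft (pd k i P) + mulLeft (tw (deg i) P) ∘ₗ pd k i := by
        refine LinearMap.ext fun G => ?_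
        simp only [LinearMap.comp_apply, mulLeft_apply, LinearMap.add_apply, partialD_mul]
        rfl
      rw [W.pd_map, h, W.map_add, W.map_comp, W.map_pd, partialD_mul, pd_insOne, tensorDeg_toLex,
        insOne, ← slotMap_tw, LinearMap.add_apply, add_sub_add_comm]
      exact add_mem (Submodule.subset_span ⟨(pd k i P, F), rfl⟩)
        (Submodule.subset_span ⟨(tw (deg i) P, pd ((W.pos n).succAbove k) i F), rfl⟩)

/-- `spread` has internal degree zero, so conjugation by a twist produces no sign. -/
lemma tw_spread_tw {m n : ℕ} (d : ℤ) : tw d ∘ₗ spread m n ∘ₗ tw d =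
    (spread m n : OTensor K deg m →ₗ[K] _) := by
  refine LinearMap.ext fun G => ?_
  simp only [LinearMap.comp_apply, spread, slotMap_tw, tw_tw]

lemma pd_comp_spread {m n : ℕ} (l : Fin n) (i : ι) : pd l i ∘ₗ spread m n =
    ∑ k, (spread m n : OTensor K deg m →ₗ[K] _) ∘ₗ pd k i := by
  refine LinearMap.ext fun G => ?_
  simp [pd_spread]

/-- On either side, a derivative in any output becomes the sum of the derivatives in all inputs. The
coaction statement below holds for the same reason. -/
lemma act_map_spread {m n : ℕ} (F : OTensor K deg (m + 1)) :
    act (W.pos n) (W.map (spread m n) F) = spread (m + 1) n F := by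
  refine eq_of_coinduction (fun F : OTensor K deg (m + 1) => act (W.pos n) (W.map (spread m n) F))
    (fun F => spread (m + 1) n F) ?_ ?_ F
  · intro F
    simp only [act, spread, coeff_zero_slotMap, W.coeff_map, W.coeff_part]
  · intro F l i
    have h : pd l i (act (W.pos n) (W.map (spread m n) F)) =
        ∑ k, act (W.pos n) (W.map (spread m n) (pd k i F)) := by
      rw [pd_act, W.pd_pos, tw_spread_tw, W.pd_map, pd_comp_spread, W.map_sum,
        Fin.sum_univ_succAbove _ (W.pos m)]
      simp only [W.map_comp, W.map_pd, LinearMap.sum_apply, LinearMap.comp_apply, _root_.map_add,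
        _root_.map_sum]
    rw [h, pd_spread, ← Finset.sum_sub_distrib]
    exact Submodule.sum_mem _ fun k _ => Submodule.subset_span ⟨_, rfl⟩

lemma map_spread_coact {m n : ℕ} (F : OTensor K deg m) :
    W.map (spread m n) (coact (W.pos m) F) = spread m (n + 1) F := by
  refine eq_of_coinduction (fun F : OTensor K deg m => W.map (spread m n) (coact (W.pos m) F))
    (fun F => spread m (n + 1) F) ?_ ?_ F
  · intro F
    simp only [coact, spread, coeff_zero_slotMap, W.coeff_map, W.coeff_part]
  · intro F l i
    have h : pd l i (W.map (spread m n) (coact (W.pos m) F)) =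
        ∑ k, W.map (spread m n) (coact (W.pos m) (pd k i F)) := by
      rcases Fin.eq_self_or_eq_succAbove (W.pos n) l with rfl | ⟨k, rfl⟩
      · rw [W.pd_pos, tw_spread_tw, pd_coact_self, _root_.map_sum]
      · rw [W.pd_map, pd_comp_spread, W.map_sum]
        simp only [W.map_comp, W.map_pd, LinearMap.sum_apply, LinearMap.comp_apply, pd_coact]
    rw [h, pd_spread, ← Finset.sum_sub_distrib]
    exact Submodule.sum_mem _ fun k _ => Submodule.subset_span ⟨_, rfl⟩

end Whisker

end StructureMaps

/-! ### Polynomials and constant coefficient differential operators -/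

section Polynomials

set_option linter.unusedSectionVars false

variable {K : Type*} [Field K] {σ : Type*} {deg : σ → ℤ} [Fintype σ] [LinearOrder σ]

variable (K deg) in
/-- The monomial `x^I`. -/
def mono (I : σ → ℕ) : Series K deg := ofCoeff fun a => if a = I then 1 else 0

lemma coeff_mono {I : σ → ℕ} (hI : Admissible deg I) (a : σ → ℕ) :
    coeff (mono K deg I) a = if a = I then 1 else 0 :=
  coeff_ofCoeff_of_imp (g := fun a => if a = I then (1 : K) else 0)
    fun h => if_neg fun h' => h (by rwa [h'])

variable (K deg) in
/-- The polynomials. -/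
def polys : Submodule K (Series K deg) :=
  Submodule.span K (Set.range fun I : {a : σ → ℕ // Admissible deg a} => mono K deg I.1)

lemma mono_mem_polys {I : σ → ℕ} (hI : Admissible deg I) : mono K deg I ∈ polys K deg :=
  Submodule.subset_span ⟨⟨I, hI⟩, rfl⟩

lemma linearIndependent_mono :
    LinearIndependent K fun I : {a : σ → ℕ // Admissible deg a} => mono K deg I.1 := by
  rw [linearIndependent_iff']
  intro s g h J hJ
  have h1 := congrArg (coeff · J.1) h
  simp only [coeff_sum, coeff_smul, coeff_zero] at h1
  rw [Finset.sum_eq_single_of_mem J hJ, coeff_mono J.2, if_pos rfl, mul_one] at h1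
  · exact h1
  · intro I _ hI
    rw [coeff_mono I.2, if_neg (fun h => hI (Subtype.ext h.symm)), mul_zero]

lemma eq_sum_mono {F : Series K deg} {s : Finset (σ → ℕ)} (hs : ∀ a, coeff F a ≠ 0 → a ∈ s) :
    F = ∑ a ∈ s, coeff F a • mono K deg a := by
  refine series_ext fun b _ => ?_
  rw [coeff_sum]
  by_cases hb : b ∈ s
  · rw [Finset.sum_eq_single_of_mem b hb]
    · by_cases h : coeff F b = 0
      · rw [h, zero_smul, coeff_zero]
      · rw [coeff_smul, coeff_mono (by by_contra h'; exact h (coeff_of_not_admissible h')),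
          if_pos rfl, mul_one]
    · intro a _ ha
      by_cases h : coeff F a = 0
      · rw [h, zero_smul, coeff_zero]
      · rw [coeff_smul, coeff_mono (by by_contra h'; exact h (coeff_of_not_admissible h')),
          if_neg (Ne.symm ha), mul_zero]
  · have : coeff F b = 0 := by
      by_contra h
      exact hb (hs b h)
    rw [this, Finset.sum_eq_zero]
    intro a ha
    by_cases h : coeff F a = 0
    · rw [h, zero_smul, coeff_zero]
    · rw [coeff_smul, coeff_mono (by by_contra h'; exact h (coeff_of_not_admissible h')),
        if_neg (fun h' => hb (by rwa [h'])), mul_zero]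

lemma mem_polys_of_finset {F : Series K deg} (s : Finset (σ → ℕ))
    (hs : ∀ a, coeff F a ≠ 0 → a ∈ s) : F ∈ polys K deg := by
  rw [eq_sum_mono hs]
  refine Submodule.sum_mem _ fun a _ => ?_
  by_cases h : Admissible deg a
  · exact Submodule.smul_mem _ _ (mono_mem_polys h)
  · rw [coeff_of_not_admissible h, zero_smul]
    exact zero_mem _

lemma mem_polys_iff {F : Series K deg} :
    F ∈ polys K deg ↔ ∃ N, ∀ a, coeff F a ≠ 0 → ∑ s, a s ≤ N := by
  constructor
  · intro h
    induction h using Submodule.span_induction with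
    | mem F hF =>
      obtain ⟨I, rfl⟩ := hF
      refine ⟨∑ s, I.1 s, fun a ha => ?_⟩
      simp only [coeff_mono I.2] at ha
      rw [(ite_ne_right_iff.1 ha).1]
    | zero => exact ⟨0, fun a ha => absurd (coeff_zero a) ha⟩
    | add F G _ _ hF hG =>
      obtain ⟨N, hN⟩ := hF
      obtain ⟨M, hM⟩ := hG
      refine ⟨max N M, fun a ha => ?_⟩
      rw [coeff_add] at ha
      by_cases h : coeff F a = 0
      · exact (hM a fun h' => ha (by rw [h, h', add_zero])).trans (le_max_right _ _)
      · exact (hN a h).trans (le_max_left _ _)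
    | smul c F _ hF =>
      obtain ⟨N, hN⟩ := hF
      refine ⟨N, fun a ha => hN a ?_⟩
      rw [coeff_smul] at ha
      exact right_ne_zero_of_mul ha
  · rintro ⟨N, hN⟩
    refine mem_polys_of_finset ((Finset.range (N + 1)).biUnion
      fun n => Finset.piAntidiag Finset.univ n) fun a ha => ?_
    rw [Finset.mem_biUnion]
    exact ⟨_, Finset.mem_range.2 (Nat.lt_succ_of_le (hN a ha)), by simp [Finset.mem_piAntidiag]⟩

lemma mono_zero : mono K deg 0 = 1 := rfl

lemma var_mul_mono (s : σ) {I : σ → ℕ} (hI : Admissible deg I) : var s * mono K deg I =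
    lam K deg s I • mono K deg (I + Pi.single s 1) := by
  refine series_ext fun c hc => ?_
  rw [coeff_var_mul s _ hc, coeff_smul, coeff_mono hI]
  have h1 : coeff (mono K deg (I + Pi.single s 1)) c = if c = I + Pi.single s 1 then 1 else 0 :=
    coeff_ofCoeff hc
  rw [h1]
  by_cases h : c = I + Pi.single s 1
  · subst h
    simp
  · rw [if_neg h, mul_zero]
    split_ifs with h2 h3
    · rfl
    · exact absurd (by rw [← h3, sub_single_add h2]) h
    · simp

lemma mono_of_not_admissible {I : σ → ℕ} (hI : ¬ Admissible deg I) : mono K deg I = 0 := by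
  refine series_ext fun c hc => ?_
  rw [coeff_zero]
  exact (coeff_ofCoeff hc).trans (if_neg fun h => hI (by rwa [← h]))

/-- Every monomial is, up to a sign, built from `1` by left multiplications with variables. This
fits `op`, which turns such a multiplication into composition with a derivative. -/
theorem polys_induction {p : Series K deg → Prop} (one : p 1)
    (add : ∀ F G, p F → p G → p (F + G)) (smul : ∀ (c : K) F, p F → p (c • F))
    (var_mul : ∀ s F, F ∈ polys K deg → p F → p (var s * F)) {F : Series K deg}
    (hF : F ∈ polys K deg) : p F := by
  have hmono : ∀ (N : ℕ) (I : σ → ℕ), Admissible deg I → ∑ s, I s = N → p (mono K deg I) := by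
    intro N
    induction N with
    | zero =>
      intro I _ hN
      have : I = 0 := funext fun s => Finset.sum_eq_zero_iff.1 hN s (Finset.mem_univ s)
      rw [this, mono_zero]
      exact one
    | succ N ih =>
      intro I hI hN
      obtain ⟨s, -, hs⟩ : ∃ s ∈ Finset.univ, I s ≠ 0 := by
        by_contra! h
        rw [Finset.sum_eq_zero h] at hN
        omega
      have hI' : Admissible deg (I - Pi.single s 1) := hI.of_le tsub_le_self
      have h1 := var_mul_mono (K := K) s hI'
      rw [sub_single_add hs] at h1
      have h2 : mono K deg I = (lam K deg s (I - Pi.single s 1))⁻¹ •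
          (var s * mono K deg (I - Pi.single s 1)) := by
        rw [h1, smul_smul, inv_mul_cancel₀ (lam_ne_zero _ _), one_smul]
      rw [h2]
      refine smul _ _ (var_mul _ _ (mono_mem_polys hI') (ih _ hI' ?_))
      have h3 : ∑ t, I t = ∑ t, (I - Pi.single s 1 : σ → ℕ) t + 1 := by
        conv_lhs => rw [← sub_single_add hs]
        simp [Finset.sum_add_distrib]
      omega
  induction hF using Submodule.span_induction with
  | mem F hF =>
    obtain ⟨I, rfl⟩ := hF
    exact hmono _ _ I.2 rfl
  | zero => simpa using smul 0 1 one
  | add F G _ _ hF hG => exact add F G hF hG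
  | smul c F _ hF => exact smul c F hF

/-! ### Iterated derivatives -/

lemma partialD_pow_comm (s t : σ) (b : ℕ) (F : Series K deg) :
    partialD s (((partialD t : Module.End K (Series K deg)) ^ b) F) =
      sgn K (deg s * (b * deg t)) • ((partialD t : Module.End K (Series K deg)) ^ b) (partialD s F) := by
  induction b with
  | zero => simp
  | succ b ih =>
    rw [pow_succ', Module.End.mul_apply, Module.End.mul_apply, partialD_comm, ih, map_smul,
      smul_smul, ← sgn_add]
    congr 2
    push_cast
    ring

lemma partialD_listProd (s : σ) (L : List σ) (hL : L.Pairwise (· < ·)) (hs : s ∈ L) (I : σ → ℕ)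
    (F : Series K deg) :
    partialD s ((L.map fun t => (partialD t : Module.End K (Series K deg)) ^ I t).prod F) =
      (∏ t ∈ L.toFinset with t < s, sgn K (deg s * (I t * deg t))) •
        (L.map fun t => (partialD t : Module.End K (Series K deg)) ^
          (I + Pi.single s 1 : σ → ℕ) t).prod F := by
  induction L with
  | nil => simp at hs
  | cons t L ih =>
    rw [List.pairwise_cons] at hL
    have htL : t ∉ L := fun h => lt_irrefl t (hL.1 t h)
    rw [List.map_cons, List.map_cons, List.prod_cons, List.prod_cons, Module.End.mul_apply,
      Module.End.mul_apply, List.toFinset_cons]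
    by_cases hst : s = t
    · subst hst
      have h1 : (L.map fun t => (partialD t : Module.End K (Series K deg)) ^
          (I + Pi.single s 1 : σ → ℕ) t) = L.map fun t => (partialD t : Module.End K (Series K deg)) ^ I t :=
        List.map_congr_left fun t ht => by
          have : t ≠ s := fun h => htL (h ▸ ht)
          simp [this]
      have h2 : (insert s L.toFinset).filter (· < s) = ∅ := by
        refine Finset.filter_eq_empty_iff.2 fun u hu => ?_
        rcases Finset.mem_insert.1 hu with rfl | hu
        · exact lt_irrefl _
        · exact (hL.1 u (List.mem_toFinset.1 hu)).not_gt
      rw [h1, h2, Finset.prod_empty, one_smul, Pi.add_apply, Pi.single_eq_same, pow_succ',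
        Module.End.mul_apply]
    · have hsL : s ∈ L := (List.mem_cons.1 hs).resolve_left hst
      have hts : t < s := hL.1 s hsL
      rw [partialD_pow_comm, ih hL.2 hsL, Finset.filter_insert, if_pos hts, Finset.prod_insert,
        map_smul, smul_smul, Pi.add_apply, Pi.single_eq_of_ne (Ne.symm hst), add_zero]
      simp [htL]

lemma partialD_iteratedPartial (s : σ) (I : σ → ℕ) (F : Series K deg) :
    partialD s (iteratedPartial I F) = lam K deg s I • iteratedPartial (I + Pi.single s 1) F := by
  rw [iteratedPartial, partialD_listProd s _ (Finset.sortedLT_sort _).pairwise (by simp),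
    Finset.sort_toFinset]
  rfl

lemma iteratedPartial_zero : (iteratedPartial 0 : Module.End K (Series K deg)) = 1 := by
  simp [iteratedPartial]

/-- The coefficients of an iterated derivative. -/
lemma exists_coeff_iteratedPartial [CharZero K] (I : σ → ℕ) : ∃ c : (σ → ℕ) → K, (∀ a, c a ≠ 0) ∧
    ∀ (F : Series K deg) a, coeff (iteratedPartial I F) a = c a * coeff F (a + I) := by
  obtain ⟨N, hN⟩ : ∃ N, ∑ s, I s = N := ⟨_, rfl⟩
  induction N generalizing I with
  | zero =>
    have : I = 0 := funext fun s => Finset.sum_eq_zero_iff.1 hN s (Finset.mem_univ s)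
    subst this
    exact ⟨fun _ => 1, fun _ => one_ne_zero, fun F a => by simp [iteratedPartial_zero]⟩
  | succ N ih =>
    obtain ⟨s, -, hs⟩ : ∃ s ∈ Finset.univ, I s ≠ 0 := by
      by_contra! h
      rw [Finset.sum_eq_zero h] at hN
      omega
    have h3 : ∑ t, I t = ∑ t, (I - Pi.single s 1 : σ → ℕ) t + 1 := by
      conv_lhs => rw [← sub_single_add hs]
      simp [Finset.sum_add_distrib]
    obtain ⟨c, hc, h⟩ := ih (I - Pi.single s 1) (by omega)
    refine ⟨fun a => lam K deg s (I - Pi.single s 1) *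
      (lam K deg s a * (a s + 1) * c (a + Pi.single s 1)), fun a => ?_, fun F a => ?_⟩
    · exact mul_ne_zero (lam_ne_zero _ _) (mul_ne_zero (mul_ne_zero (lam_ne_zero _ _)
        (Nat.cast_add_one_ne_zero _)) (hc _))
    · have h1 := partialD_iteratedPartial s (I - Pi.single s 1) F
      rw [sub_single_add hs] at h1
      have h2 : iteratedPartial I F = lam K deg s (I - Pi.single s 1) •
          partialD s (iteratedPartial (I - Pi.single s 1) F) := by
        rw [h1, smul_smul, lam_mul_self, one_smul]
      rw [h2, coeff_smul, coeff_partialD, h, add_assoc a, add_comm (Pi.single s 1),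
        sub_single_add hs]
      ring

lemma iteratedPartial_of_not_admissible [CharZero K] {I : σ → ℕ} (hI : ¬ Admissible deg I) :
    (iteratedPartial I : Module.End K (Series K deg)) = 0 := by
  obtain ⟨c, -, h⟩ := exists_coeff_iteratedPartial (K := K) (deg := deg) I
  refine LinearMap.ext fun F => series_ext fun a _ => ?_
  rw [h, coeff_of_not_admissible fun h' => hI (h'.of_le le_add_self), mul_zero, LinearMap.zero_apply,
    coeff_zero]

/-- The values are prescribed on the basis of monomials of the polynomials; on other series the
extension is arbitrary. Later identities therefore assume a polynomial argument. -/
lemma exists_op : ∃ g : Series K deg →ₗ[K] Module.End K (Series K deg),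
    ∀ I, Admissible deg I → g (mono K deg I) = iteratedPartial I := by
  let b : Module.Basis {a : σ → ℕ // Admissible deg a} K (polys K deg) :=
    Module.Basis.span (linearIndependent_mono (K := K) (deg := deg))
  have hb : ∀ I, (b I : Series K deg) = mono K deg I.1 := fun I =>
    congrArg Subtype.val (Module.Basis.span_apply (linearIndependent_mono (K := K) (deg := deg)) I)
  obtain ⟨g, hg⟩ := LinearMap.exists_extend
    (b.constr K fun I => (iteratedPartial I.1 : Module.End K (Series K deg)))
  refine ⟨g, fun I hI => ?_⟩
  have h1 := (LinearMap.congr_fun hg (b ⟨I, hI⟩)).trans (b.constr_basis K _ _)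
  rw [← h1, ← hb ⟨I, hI⟩]
  rfl

variable (K deg) in
/-- A linear map that sends a polynomial to the corresponding differential operator. -/
def op : Series K deg →ₗ[K] Module.End K (Series K deg) := exists_op.choose

lemma op_mono {I : σ → ℕ} (hI : Admissible deg I) : op K deg (mono K deg I) = iteratedPartial I :=
  exists_op.choose_spec I hI

lemma op_one : op K deg 1 = LinearMap.id := by
  rw [← mono_zero, op_mono admissible_zero, iteratedPartial_zero]
  rfl

/-- Moving `x s` to its place in `x^I` and moving its derivative to its place in the ordered product
cost the same sign. If the result is inadmissible, both sides vanish. -/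
lemma op_var_mul [CharZero K] (s : σ) {G : Series K deg} (hG : G ∈ polys K deg) :
    op K deg (var s * G) = partialD s ∘ₗ op K deg G := by
  induction hG using Submodule.span_induction with
  | mem F hF =>
    obtain ⟨I, rfl⟩ := hF
    simp only [var_mul_mono s I.2, op_mono I.2, map_smul]
    refine LinearMap.ext fun F => ?_
    rw [LinearMap.comp_apply, partialD_iteratedPartial, LinearMap.smul_apply]
    by_cases h : Admissible deg (I.1 + Pi.single s 1)
    · rw [op_mono h]
    · rw [mono_of_not_admissible h, iteratedPartial_of_not_admissible h, map_zero]
  | zero => rw [mul_zero', map_zero, LinearMap.comp_zero]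
  | add F G _ _ hF hG => rw [mul_add', map_add, hF, hG, map_add, LinearMap.comp_add]
  | smul c F _ hF => rw [mul_smul', map_smul, hF, map_smul, LinearMap.comp_smul]

end Polynomials

/-! ### Differential operators on tensor powers -/

section TensorOp

set_option linter.unusedSectionVars false

variable {K : Type*} [Field K] {ι : Type*} {deg : ι → ℤ} [Fintype ι] [LinearOrder ι]

/-- Polynomials are the series of bounded degree, and total degree is read off from the multidegree.
Maps preserving multidegrees, such as the cobar homotopy, restrict to polynomials. -/
lemma mem_polys_of_wt {m n : ℕ} {F : OTensor K deg m} {G : OTensor K deg n}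
    (h : ∀ a, coeff G a ≠ 0 → ∃ c, wt c = wt a ∧ coeff F c ≠ 0) (hF : F ∈ polys K _) :
    G ∈ polys K (tensorDeg deg n) := by
  rw [mem_polys_iff] at hF ⊢
  obtain ⟨N, hN⟩ := hF
  refine ⟨N, fun a ha => ?_⟩
  obtain ⟨c, hc, hc'⟩ := h a ha
  rw [← sum_wt, ← hc, sum_wt]
  exact hN c hc'

variable [CharZero K]

lemma slotMap_wt {m n : ℕ} {r : Fin m → Finset (Fin n)} {F : OTensor K deg m} {a : Fin n ×ₗ ι → ℕ}
    (h : coeff (slotMap r F) a ≠ 0) : ∃ c, wt c = wt a ∧ coeff F c ≠ 0 := by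
  by_contra! h'
  refine h ?_
  rw [coeff_slotMap_congr (G := 0) r (fun c hc => by rw [h' c hc, coeff_zero]), map_zero, coeff_zero]

lemma slotMap_mem_polys {m n : ℕ} (r : Fin m → Finset (Fin n)) {F : OTensor K deg m}
    (hF : F ∈ polys K _) : slotMap r F ∈ polys K (tensorDeg deg n) :=
  mem_polys_of_wt (fun _ h => slotMap_wt h) hF

/-- Differentiation in the old factors only is described by the symbol with a unit at the new
factor. -/
lemma Whisker.map_op (W : Whisker K deg) {n : ℕ} {G : OTensor K deg n} (hG : G ∈ polys K _) :
    W.map (op K _ G) = op K _ (insOne (W.pos n) G) := by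
  refine polys_induction (p := fun G : OTensor K deg n => W.map (op K _ G) =
    op K _ (insOne (W.pos n) G)) ?_ ?_ ?_ ?_ hG
  · rw [insOne, slotMap_one, op_one, op_one, W.map_id]
  · intro F G hF hG
    rw [_root_.map_add, W.map_add, hF, hG, _root_.map_add, _root_.map_add]
  · intro c F hF
    rw [_root_.map_smul, W.map_smul, hF, _root_.map_smul, _root_.map_smul]
  · intro s F hF ih
    obtain ⟨⟨k, i⟩, rfl⟩ := toLex.surjective s
    rw [op_var_mul _ hF, W.map_comp, W.map_pd, ih, insOne, slotMap_mul, slotMap_xv,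
      Finset.sum_singleton, op_var_mul _ (slotMap_mem_polys _ hF)]

lemma Whisker.map_op_coact (W : Whisker K deg) {n : ℕ} {G : OTensor K deg n} (hG : G ∈ polys K _) :
    W.map (op K _ G) ∘ₗ coact (W.pos n) = coact (W.pos n) ∘ₗ op K _ G := by
  refine polys_induction (p := fun G : OTensor K deg n => W.map (op K _ G) ∘ₗ coact (W.pos n) =
    coact (W.pos n) ∘ₗ op K _ G) ?_ ?_ ?_ ?_ hG
  · rw [op_one, W.map_id, LinearMap.id_comp, LinearMap.comp_id]
  · intro F G hF hG
    rw [_root_.map_add, W.map_add, LinearMap.add_comp, LinearMap.comp_add, hF, hG]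
  · intro c F hF
    rw [_root_.map_smul, W.map_smul, LinearMap.smul_comp, LinearMap.comp_smul, hF]
  · intro s F hF ih
    obtain ⟨⟨k, i⟩, rfl⟩ := toLex.surjective s
    rw [op_var_mul _ hF, W.map_comp, W.map_pd, LinearMap.comp_assoc, ih]
    refine LinearMap.ext fun X => ?_
    simp only [LinearMap.comp_apply, pd_coact]

/-- The chain rule in dual form: a derivative after a substitution is the substitution of
derivatives along the transposed relation. In particular, merging slots on functions becomes
comultiplication on symbols. -/
lemma op_slotMap {m n : ℕ} (r : Fin m → Finset (Fin n)) (r' : Fin n → Finset (Fin m))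
    (h : ∀ k l, l ∈ r k ↔ k ∈ r' l) {G : OTensor K deg n} (hG : G ∈ polys K _) :
    op K _ G ∘ₗ slotMap r = slotMap r ∘ₗ op K _ (slotMap r' G) := by
  refine polys_induction (p := fun G : OTensor K deg n => op K _ G ∘ₗ slotMap r =
    slotMap r ∘ₗ op K _ (slotMap r' G)) ?_ ?_ ?_ ?_ hG
  · rw [slotMap_one, op_one, op_one, LinearMap.id_comp, LinearMap.comp_id]
  · intro F G hF hG
    rw [map_add, LinearMap.add_comp, hF, hG, map_add, map_add, LinearMap.comp_add]
  · intro c F hF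
    rw [map_smul, LinearMap.smul_comp, hF, map_smul, map_smul, LinearMap.comp_smul]
  · intro s F hF ih
    obtain ⟨⟨k, i⟩, rfl⟩ := toLex.surjective s
    rw [op_var_mul _ hF, LinearMap.comp_assoc, ih, slotMap_mul, slotMap_xv, sum_mul', map_sum]
    refine LinearMap.ext fun X => ?_
    rw [LinearMap.comp_apply, LinearMap.comp_apply, pd_slotMap, LinearMap.comp_apply,
      LinearMap.sum_apply, map_sum]
    refine Finset.sum_congr (by ext; simp [h]) fun l _ => ?_
    rw [op_var_mul _ (slotMap_mem_polys _ hF)]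
    rfl

end TensorOp

end GerstenhaberSchack

end

noncomputable section

namespace GerstenhaberSchack

/-! ### Symbols of polydifferential operators -/

section Symbols

set_option linter.unusedSectionVars false

open scoped TensorProduct

variable {K : Type*} [Field K] {ι : Type*} {deg : ι → ℤ} [Fintype ι] [LinearOrder ι]

/-- The operator with symbol `P ⊗ G`. -/
def symbolOp {m n : ℕ} (P : OTensor K deg n) (G : OTensor K deg m) :
    OTensor K deg m →ₗ[K] OTensor K deg n := mulLeft P ∘ₗ spread m n ∘ₗ op K _ G

lemma symbolOp_apply {m n : ℕ} (P : OTensor K deg n) (G F : OTensor K deg m) :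
    symbolOp P G F = P * spread m n (op K _ G F) := rfl

lemma mono_mem_polys' {σ : Type*} [Fintype σ] [LinearOrder σ] {dg : σ → ℤ} (I : σ → ℕ) :
    mono K dg I ∈ polys K dg := by
  by_cases h : Admissible dg I
  · exact mono_mem_polys h
  · rw [mono_of_not_admissible h]
    exact zero_mem _

variable (K deg) in
/-- The space of symbols. -/
abbrev Symbol (m n : ℕ) : Type _ := OTensor K deg n ⊗[K] polys K (tensorDeg deg m)

variable (K deg) in
/-- The operator with a given symbol. -/
def opOfSymbol (m n : ℕ) : Symbol K deg m n →ₗ[K] OTensor K deg m →ₗ[K] OTensor K deg n :=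
  TensorProduct.lift (LinearMap.mk₂ K (fun P G => symbolOp P G.1)
    (fun P P' G => LinearMap.ext fun F => by
      simp only [symbolOp_apply, add_mul', LinearMap.add_apply])
    (fun c P G => LinearMap.ext fun F => by
      simp only [symbolOp_apply, smul_mul', LinearMap.smul_apply])
    (fun P G G' => LinearMap.ext fun F => by
      simp only [symbolOp_apply, LinearMap.add_apply, Submodule.coe_add, map_add, mul_add'])
    (fun c P G => LinearMap.ext fun F => by
      simp only [symbolOp_apply, LinearMap.smul_apply, Submodule.coe_smul, map_smul, mul_smul']))

@[simp] lemma opOfSymbol_tmul {m n : ℕ} (P : OTensor K deg n) (G : polys K (tensorDeg deg m)) :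
    opOfSymbol K deg m n (P ⊗ₜ G) = symbolOp P G.1 := by
  rw [opOfSymbol, TensorProduct.lift.tmul, LinearMap.mk₂_apply]

/-- The coefficient of a symbol at `x^I`. -/
def symbolCoeff {m n : ℕ} (I : Fin m ×ₗ ι → ℕ) : Symbol K deg m n →ₗ[K] OTensor K deg n :=
  (TensorProduct.rid K _).toLinearMap ∘ₗ LinearMap.lTensor _ (coeffL K _ I ∘ₗ (polys K _).subtype)

@[simp] lemma symbolCoeff_tmul {m n : ℕ} (I : Fin m ×ₗ ι → ℕ) (P : OTensor K deg n)
    (G : polys K (tensorDeg deg m)) : symbolCoeff I (P ⊗ₜ G) = coeff G.1 I • P := by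
  simp [symbolCoeff]

/-- The expansion is stated for all larger finite sets, so that the supports of several symbols, or
a prescribed set of exponents, can be merged. -/
lemma exists_eq_sum_symbolCoeff {m n : ℕ} (t : Symbol K deg m n) :
    ∃ s : Finset (Fin m ×ₗ ι → ℕ), ∀ s', s ⊆ s' →
      t = ∑ I ∈ s', symbolCoeff I t ⊗ₜ ⟨mono K _ I, mono_mem_polys' I⟩ := by
  induction t using TensorProduct.induction_on with
  | zero => exact ⟨∅, fun s' _ => by simp⟩
  | tmul P G =>
    obtain ⟨N, hN⟩ := mem_polys_iff.1 G.2
    refine ⟨(Finset.range (N + 1)).biUnion fun n => Finset.piAntidiag Finset.univ n,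
      fun s' hs' => ?_⟩
    have h1 : G = ∑ I ∈ s', coeff G.1 I •
        (⟨mono K _ I, mono_mem_polys' I⟩ : polys K (tensorDeg deg m)) := by
      refine Subtype.ext ?_
      rw [Submodule.coe_sum]
      refine eq_sum_mono fun a ha => hs' ?_
      rw [Finset.mem_biUnion]
      exact ⟨_, Finset.mem_range.2 (Nat.lt_succ_of_le (hN a ha)), by simp [Finset.mem_piAntidiag]⟩
    conv_lhs => rw [h1]
    rw [TensorProduct.tmul_sum]
    refine Finset.sum_congr rfl fun I _ => ?_
    rw [symbolCoeff_tmul, TensorProduct.smul_tmul]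
  | add t t' h h' =>
    classical
    obtain ⟨s, hs⟩ := h
    obtain ⟨s', hs'⟩ := h'
    refine ⟨s ∪ s', fun u hu => ?_⟩
    conv_lhs => rw [hs u (Finset.subset_union_left.trans hu), hs' u (Finset.subset_union_right.trans hu)]
    rw [← Finset.sum_add_distrib]
    refine Finset.sum_congr rfl fun I _ => ?_
    rw [map_add, TensorProduct.add_tmul]

variable [CharZero K]

lemma polyOp_eq {m n : ℕ} (P : OTensor K deg n) (I : Fin m ×ₗ ι → ℕ) :
    polyOp P I = symbolOp P (mono K _ I) := by
  by_cases h : Admissible (tensorDeg deg m) I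
  · rw [symbolOp, op_mono h]
    rfl
  · rw [symbolOp, mono_of_not_admissible h, polyOp, iteratedPartial_of_not_admissible h, map_zero]
    rfl

lemma mem_homPoly_iff {m n : ℕ} {f : OTensor K deg m →ₗ[K] OTensor K deg n} :
    f ∈ HomPoly K deg m n ↔ ∃ t, opOfSymbol K deg m n t = f := by
  rw [← LinearMap.mem_range]
  revert f
  rw [← SetLike.ext_iff]
  refine le_antisymm (Submodule.span_le.2 ?_) ?_
  · rintro _ ⟨⟨P, I⟩, rfl⟩
    exact ⟨P ⊗ₜ ⟨mono K _ I, mono_mem_polys' I⟩, by rw [opOfSymbol_tmul, ← polyOp_eq]⟩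
  · rintro _ ⟨t, rfl⟩
    obtain ⟨s, hs⟩ := exists_eq_sum_symbolCoeff t
    rw [hs s subset_rfl, map_sum]
    refine Submodule.sum_mem _ fun I _ => Submodule.subset_span ⟨(symbolCoeff I t, I), ?_⟩
    rw [opOfSymbol_tmul]
    exact polyOp_eq _ _

lemma iteratedPartial_mono_self {σ : Type*} [Fintype σ] [LinearOrder σ] {dg : σ → ℤ} {J : σ → ℕ}
    (hJ : Admissible dg J) : ∃ c : K, c ≠ 0 ∧ iteratedPartial J (mono K dg J) = c • 1 := by
  obtain ⟨c, hc, h⟩ := exists_coeff_iteratedPartial (K := K) (deg := dg) J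
  refine ⟨c 0, hc 0, series_ext fun a _ => ?_⟩
  rw [h, coeff_mono hJ, coeff_smul, coeff_one]
  by_cases ha : a = 0
  · simp [ha]
  · simp [ha]

lemma iteratedPartial_mono_of_not_le {σ : Type*} [Fintype σ] [LinearOrder σ] {dg : σ → ℤ}
    {I J : σ → ℕ} (h : ¬ I ≤ J) : iteratedPartial I (mono K dg J) = 0 := by
  obtain ⟨c, -, hc⟩ := exists_coeff_iteratedPartial (K := K) (deg := dg) I
  refine series_ext fun a _ => ?_
  by_cases hJ : Admissible dg J
  · rw [hc, coeff_mono hJ, if_neg, mul_zero, coeff_zero]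
    exact fun h' => h (h' ▸ le_add_self)
  · rw [mono_of_not_admissible hJ, map_zero]

lemma opOfSymbol_mono {m n : ℕ} (t : Symbol K deg m n) (J : Fin m ×ₗ ι → ℕ) :
    opOfSymbol K deg m n t (mono K _ J) =
      ∑ I ∈ Finset.Iic J, symbolCoeff I t * spread m n (iteratedPartial I (mono K _ J)) := by
  obtain ⟨s, hs⟩ := exists_eq_sum_symbolCoeff t
  have h1 := hs (s ∪ Finset.Iic J) Finset.subset_union_left
  conv_lhs => rw [h1]
  rw [map_sum, LinearMap.sum_apply]
  refine (Finset.sum_subset Finset.subset_union_right fun I _ hI => ?_).symm.trans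
    (Finset.sum_congr rfl fun I _ => ?_)
  · rw [opOfSymbol_tmul, ← polyOp_eq, polyOp, LinearMap.comp_apply, LinearMap.comp_apply,
      iteratedPartial_mono_of_not_le (fun h => hI (Finset.mem_Iic.2 h)), map_zero, map_zero]
  · rw [opOfSymbol_tmul, ← polyOp_eq]
    rfl

lemma symbolCoeff_of_not_admissible {m n : ℕ} (t : Symbol K deg m n) {I : Fin m ×ₗ ι → ℕ}
    (hI : ¬ Admissible (tensorDeg deg m) I) : symbolCoeff I t = 0 := by
  induction t using TensorProduct.induction_on with
  | zero => exact map_zero _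
  | tmul P G => rw [symbolCoeff_tmul, coeff_of_not_admissible hI, zero_smul]
  | add t t' h h' => rw [map_add, h, h', add_zero]

/-- The coefficients of a symbol are controlled by the values of the operator at monomials. -/
lemma symbolCoeff_mem {m n : ℕ} (t : Symbol K deg m n)
    (N : (Fin m ×ₗ ι → ℕ) → Submodule K (OTensor K deg n))
    (hN : ∀ I J, I ≤ J → ∀ P ∈ N I, P * spread m n (iteratedPartial I (mono K _ J)) ∈ N J)
    (ht : ∀ J, opOfSymbol K deg m n t (mono K _ J) ∈ N J) (J : Fin m ×ₗ ι → ℕ) :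
    symbolCoeff J t ∈ N J := by
  induction J using WellFoundedLT.induction with
  | ind J ih =>
    by_cases hJ : Admissible (tensorDeg deg m) J
    · obtain ⟨c, hc, hc'⟩ := iteratedPartial_mono_self (K := K) hJ
      have h1 := opOfSymbol_mono t J
      rw [← Finset.add_sum_erase _ _ (Finset.mem_Iic.2 (le_refl J)), hc', map_smul, spread,
        slotMap_one, mul_smul', mul_one'] at h1
      have h2 : c • symbolCoeff J t ∈ N J := by
        -- Evaluation at `x^J` is triangular: the term `I = J` is the symbol coefficient times a
        -- nonzero scalar, and the terms `I < J` are known by induction.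
        rw [eq_sub_of_add_eq h1.symm]
        refine sub_mem (ht J) (Submodule.sum_mem _ fun I hI => ?_)
        rw [Finset.mem_erase, Finset.mem_Iic] at hI
        exact hN I J hI.2 _ (ih I (lt_of_le_of_ne hI.2 hI.1))
      simpa [hc] using Submodule.smul_mem _ c⁻¹ h2
    · rw [symbolCoeff_of_not_admissible t hJ]
      exact zero_mem _

/-- Triangularity with all the subspaces equal to zero. -/
lemma opOfSymbol_injective (m n : ℕ) : Function.Injective (opOfSymbol K deg m n) := by
  rw [injective_iff_map_eq_zero]
  intro t ht
  have h := symbolCoeff_mem t (fun _ => ⊥)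
    (fun I J _ P hP => by rw [(Submodule.mem_bot K).1 hP, zero_mul']; exact zero_mem _)
    (fun J => by rw [ht]; exact zero_mem _)
  obtain ⟨s, hs⟩ := exists_eq_sum_symbolCoeff t
  rw [hs s subset_rfl]
  exact Finset.sum_eq_zero fun I _ => by rw [(Submodule.mem_bot K).1 (h I), TensorProduct.zero_tmul]

/-! ### Degrees -/

variable (K) in
/-- The homogeneous series of degree `d`. -/
def homog {σ : Type*} [Fintype σ] (dg : σ → ℤ) (d : ℤ) : Submodule K (Series K dg) where
  carrier := {F | IsHomogeneous F d}
  add_mem' := isHomogeneous_add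
  zero_mem' := isHomogeneous_zero
  smul_mem' c _ := isHomogeneous_smul c

lemma isHomogeneous_mul {σ : Type*} [Fintype σ] [LinearOrder σ] {dg : σ → ℤ} {F G : Series K dg}
    {d e : ℤ} (hF : IsHomogeneous F d) (hG : IsHomogeneous G e) : IsHomogeneous (F * G) (d + e) := by
  intro a ha
  have hadm : Admissible dg a := by
    by_contra h
    exact ha (coeff_of_not_admissible h)
  rw [coeff_mul hadm] at ha
  obtain ⟨b, hb, h⟩ := Finset.exists_ne_zero_of_sum_ne_zero ha
  have h' := right_ne_zero_of_mul h
  rw [← hF b (left_ne_zero_of_mul h'), ← hG _ (right_ne_zero_of_mul h'), ← degree_add,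
    add_tsub_cancel_of_le (Finset.mem_Iic.1 hb)]

lemma isHomogeneous_of_wt {m n : ℕ} {F : OTensor K deg m} {G : OTensor K deg n} {d : ℤ}
    (h : ∀ a, coeff G a ≠ 0 → ∃ c, wt c = wt a ∧ coeff F c ≠ 0) (hF : IsHomogeneous F d) :
    IsHomogeneous G d := by
  intro a ha
  obtain ⟨c, hc, hc'⟩ := h a ha
  rw [degree_wt, ← hc, ← degree_wt]
  exact hF c hc'

lemma isHomogeneous_mono {σ : Type*} [Fintype σ] [LinearOrder σ] {dg : σ → ℤ} (J : σ → ℕ) :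
    IsHomogeneous (mono K dg J) (degree dg J) := by
  intro a ha
  by_cases hJ : Admissible dg J
  · rw [coeff_mono hJ] at ha
    rw [(ite_ne_right_iff.1 ha).1]
  · rw [mono_of_not_admissible hJ, coeff_zero] at ha
    exact absurd rfl ha

lemma isHomogeneous_iteratedPartial {σ : Type*} [Fintype σ] [LinearOrder σ] {dg : σ → ℤ} (I : σ → ℕ)
    {F : Series K dg} {d : ℤ} (hF : IsHomogeneous F d) :
    IsHomogeneous (iteratedPartial I F) (d - degree dg I) := by
  obtain ⟨c, -, hc⟩ := exists_coeff_iteratedPartial (K := K) (deg := dg) I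
  intro a ha
  rw [hc] at ha
  rw [← hF _ (right_ne_zero_of_mul ha), degree_add, add_sub_cancel_right]

lemma isHomogeneous_op {σ : Type*} [Fintype σ] [LinearOrder σ] {dg : σ → ℤ} {G : Series K dg}
    (hG : G ∈ polys K dg) {F : Series K dg} {d e : ℤ} (hF : IsHomogeneous F d)
    (hG' : IsHomogeneous G e) : IsHomogeneous (op K dg G F) (d - e) := by
  obtain ⟨N, hN⟩ := mem_polys_iff.1 hG
  rw [eq_sum_mono (s := (Finset.range (N + 1)).biUnion fun n => Finset.piAntidiag Finset.univ n)
    (F := G) (fun a ha => by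
      rw [Finset.mem_biUnion]
      exact ⟨_, Finset.mem_range.2 (Nat.lt_succ_of_le (hN a ha)), by simp [Finset.mem_piAntidiag]⟩),
    map_sum, LinearMap.sum_apply]
  refine Submodule.sum_mem (homog K dg (d - e)) fun a _ => ?_
  by_cases h : coeff G a = 0
  · rw [h, zero_smul, map_zero]
    exact zero_mem _
  · have hadm : Admissible dg a := by
      by_contra h'
      exact h (coeff_of_not_admissible h')
    rw [map_smul, op_mono hadm, ← hG' a h]
    exact Submodule.smul_mem _ _ (isHomogeneous_iteratedPartial a hF)

variable (K deg) in
/-- The symbols of the operators of degree `e`. -/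
def symbolDegree (m n : ℕ) (e : ℤ) : Submodule K (Symbol K deg m n) :=
  Submodule.span K {t | ∃ (P : OTensor K deg n) (G : polys K (tensorDeg deg m)) (d d' : ℤ),
    IsHomogeneous P d ∧ IsHomogeneous G.1 d' ∧ d - d' = e ∧ t = P ⊗ₜ G}

lemma hasDegree_opOfSymbol {m n : ℕ} {e : ℤ} {t : Symbol K deg m n}
    (ht : t ∈ symbolDegree K deg m n e) : HasDegree (opOfSymbol K deg m n t) e := by
  intro F d0 hF
  change _ ∈ homog K _ (d0 + e)
  induction ht using Submodule.span_induction with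
  | mem t h =>
    obtain ⟨P, G, d, d', hP, hG, rfl, rfl⟩ := h
    rw [opOfSymbol_tmul, symbolOp_apply]
    have h2 := isHomogeneous_mul hP (isHomogeneous_of_wt (G := spread m n (op K _ G.1 F))
      (fun _ h => slotMap_wt h) (isHomogeneous_op G.2 hF hG))
    rwa [show d + (d0 - d') = d0 + (d - d') by ring] at h2
  | zero => rw [map_zero]; exact zero_mem _
  | add t t' _ _ h h' => rw [map_add]; exact add_mem h h'
  | smul c t _ h => rw [map_smul]; exact Submodule.smul_mem _ c h

/-- The same triangularity, now with the subspaces of degree `e + |x^I|`: the coefficient of `∂^I`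
in an operator of degree `e` must compensate the degree lost by differentiation. -/
lemma mem_symbolDegree_of_hasDegree {m n : ℕ} {e : ℤ} {t : Symbol K deg m n}
    (ht : HasDegree (opOfSymbol K deg m n t) e) : t ∈ symbolDegree K deg m n e := by
  have h := symbolCoeff_mem t (fun I => homog K _ (e + degree _ I))
    (fun I J _ P hP => by
      have h2 := isHomogeneous_mul hP (isHomogeneous_of_wt
        (G := spread m n (iteratedPartial I (mono K _ J))) (fun _ h => slotMap_wt h)
          (isHomogeneous_iteratedPartial I (isHomogeneous_mono J)))
      rwa [show e + degree _ I + (degree _ J - degree _ I) = e + degree _ J by ring] at h2)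
    (fun J => by
      have := ht _ _ (isHomogeneous_mono J)
      rwa [add_comm] at this)
  obtain ⟨s, hs⟩ := exists_eq_sum_symbolCoeff t
  rw [hs s subset_rfl]
  exact Submodule.sum_mem _ fun I _ => Submodule.subset_span
    ⟨_, _, _, _, h I, isHomogeneous_mono I, add_sub_cancel_right _ _, rfl⟩

/-! ### The differentials on symbols -/

lemma letterMap_face_zero (n : ℕ) :
    (letterMap (face 0) n (n + 1) : OTensor K deg n →ₗ[K] _) = insOne 0 := by
  unfold letterMap insOne
  congr 1
  funext k
  ext l
  rw [Finset.mem_filter, Finset.mem_singleton, Fin.succAbove_zero, Fin.ext_iff, Fin.val_succ]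
  simp only [Finset.mem_univ, true_and, face]
  split_ifs <;> omega

lemma letterMap_face_last (n : ℕ) :
    (letterMap (face (n + 1)) n (n + 1) : OTensor K deg n →ₗ[K] _) = insOne (Fin.last n) := by
  unfold letterMap insOne
  congr 1
  funext k
  ext l
  have := l.2
  rw [Finset.mem_filter, Finset.mem_singleton, Fin.succAbove_last, Fin.ext_iff, Fin.val_castSucc]
  simp only [Finset.mem_univ, true_and, face]
  split_ifs <;> omega

lemma letterMap_face_succ {n : ℕ} (j : Fin n) :
    (letterMap (face (j + 1)) n (n + 1) : OTensor K deg n →ₗ[K] _) = comultAt j := by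
  unfold letterMap comultAt
  congr 1
  funext k
  ext l
  rw [Finset.mem_filter, Finset.mem_filter, Fin.ext_iff]
  simp only [Finset.mem_univ, true_and, face, Fin.predAbove, Fin.lt_def, Fin.val_castSucc]
  by_cases h : (j : ℕ) < l
  · simp only [h, dite_true, Fin.val_pred]
    split_ifs <;> omega
  · simp only [h, dite_false, Fin.coe_castPred]
    split_ifs <;> omega

/-- The interior coface `j + 1` comultiplies the factor `j`; this shift of the index explains the
minus sign in front of the sum. -/
lemma cobar_eq (n : ℕ) (F : OTensor K deg n) : cobar K deg n F = insOne 0 F -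
    (∑ j : Fin n, (-1 : K) ^ (j : ℕ) • comultAt j F) + (-1 : K) ^ (n + 1) • insOne (Fin.last n) F := by
  rw [cobar_apply, Finset.sum_range_succ, Finset.sum_range_succ', letterMap_face_zero,
    letterMap_face_last, pow_zero, one_smul, Finset.sum_range, add_comm (∑ _, _) (insOne 0 F),
    sub_eq_add_neg, ← Finset.sum_neg_distrib]
  congr 2
  refine Finset.sum_congr rfl fun j _ => ?_
  rw [letterMap_face_succ, pow_succ, mul_neg_one, neg_smul]

/-- An outer term of `d₁` feeds the new input undifferentiated into the product, so the symbol
acquires a unit at that input. In outer terms of `d₂`, treated next, the coefficient `P` acquires a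
unit at the new output instead. -/
lemma act_map_symbolOp (W : Whisker K deg) {m n : ℕ} (P : OTensor K deg n) {G : OTensor K deg m}
    (hG : G ∈ polys K _) (F : OTensor K deg (m + 1)) :
    act (W.pos n) (W.map (symbolOp P G) F) = symbolOp P (insOne (W.pos m) G) F := by
  rw [symbolOp, W.map_comp, W.map_comp, W.map_mulLeft, W.map_op hG, LinearMap.comp_apply,
    mulLeft_apply, act_mul, act_insOne, LinearMap.comp_apply, W.act_map_spread, symbolOp_apply]

lemma map_symbolOp_coact (W : Whisker K deg) {m n : ℕ} (P : OTensor K deg n) {G : OTensor K deg m}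
    (hG : G ∈ polys K _) (F : OTensor K deg m) :
    W.map (symbolOp P G) (coact (W.pos m) F) = symbolOp (insOne (W.pos n) P) G F := by
  have h := LinearMap.congr_fun (W.map_op_coact hG) F
  rw [LinearMap.comp_apply, LinearMap.comp_apply] at h
  rw [symbolOp, W.map_comp, W.map_comp, W.map_mulLeft, LinearMap.comp_apply, mulLeft_apply,
    LinearMap.comp_apply, h, W.map_spread_coact, symbolOp_apply]

lemma symbolOp_multAt {m n : ℕ} (P : OTensor K deg n) {G : OTensor K deg m}
    (hG : G ∈ polys K _) (j : Fin m) (F : OTensor K deg (m + 1)) :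
    symbolOp P G (multAt j F) = symbolOp P (comultAt j G) F := by
  have h := LinearMap.congr_fun (op_slotMap (fun k => {j.predAbove k})
    (fun k => Finset.univ.filter fun l => j.predAbove l = k) (by simp [eq_comm]) hG) F
  rw [LinearMap.comp_apply, LinearMap.comp_apply] at h
  change op K _ G (multAt j F) = multAt j (op K _ (comultAt j G) F) at h
  rw [symbolOp_apply, h, spread_multAt, symbolOp_apply]

lemma comultAt_symbolOp {m n : ℕ} (P : OTensor K deg n) (G : OTensor K deg m) (j : Fin n)
    (F : OTensor K deg m) : comultAt j (symbolOp P G F) = symbolOp (comultAt j P) G F := by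
  rw [symbolOp_apply, symbolOp_apply, ← comultAt_spread j]
  exact slotMap_mul _ _ _

/-- The three kinds of terms of `d₁` match the cofaces of `G`: units at both ends, and
comultiplications dual to the products of neighbouring inputs. -/
lemma dMult_symbolOp {m n : ℕ} (P : OTensor K deg n) {G : OTensor K deg m} (hG : G ∈ polys K _) :
    dMult (symbolOp P G) = symbolOp P (cobar K deg m G) := by
  refine LinearMap.ext fun F => ?_
  have h1 := act_map_symbolOp (headWhisker K deg) P hG F
  have h2 := act_map_symbolOp (lastWhisker K deg) P hG F
  change act 0 (idTensor (symbolOp P G) F) = symbolOp P (insOne 0 G) F at h1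
  change act (Fin.last n) (tensorId (symbolOp P G) F) = symbolOp P (insOne (Fin.last m) G) F at h2
  change (leftAct n ∘ₗ idTensor (symbolOp P G) -
    (∑ i : Fin m, (-1 : K) ^ (i : ℕ) • symbolOp P G ∘ₗ multAt i)
    + (-1 : K) ^ (m + 1) • rightAct n ∘ₗ tensorId (symbolOp P G)) F = _
  rw [LinearMap.add_apply, LinearMap.sub_apply, LinearMap.smul_apply, LinearMap.comp_apply,
    LinearMap.comp_apply, leftAct_eq, rightAct_eq, h1, h2, LinearMap.sum_apply]
  simp only [LinearMap.smul_apply, LinearMap.comp_apply, symbolOp_multAt P hG]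
  simp only [symbolOp_apply, cobar_eq, map_add, map_smul, map_sum, LinearMap.add_apply,
    LinearMap.smul_apply, LinearMap.sum_apply, mul_add', mul_smul', mul_sum',
    sub_eq_add_neg, ← neg_one_smul K (∑ _, _)]

lemma dComult_symbolOp {m n : ℕ} (P : OTensor K deg n) {G : OTensor K deg m} (hG : G ∈ polys K _) :
    dComult (symbolOp P G) = symbolOp (cobar K deg n P) G := by
  refine LinearMap.ext fun F => ?_
  have h1 := map_symbolOp_coact (headWhisker K deg) P hG F
  have h2 := map_symbolOp_coact (lastWhisker K deg) P hG F
  change idTensor (symbolOp P G) (coact 0 F) = symbolOp (insOne 0 P) G F at h1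
  change tensorId (symbolOp P G) (coact (Fin.last m) F) = symbolOp (insOne (Fin.last n) P) G F at h2
  change (idTensor (symbolOp P G) ∘ₗ leftCoact m -
    (∑ j : Fin n, (-1 : K) ^ (j : ℕ) • comultAt j ∘ₗ symbolOp P G)
    + (-1 : K) ^ (n + 1) • tensorId (symbolOp P G) ∘ₗ rightCoact m) F = _
  rw [LinearMap.add_apply, LinearMap.sub_apply, LinearMap.smul_apply, LinearMap.comp_apply,
    LinearMap.comp_apply, leftCoact_eq, rightCoact_eq, h1, h2, LinearMap.sum_apply]
  simp only [LinearMap.smul_apply, LinearMap.comp_apply, comultAt_symbolOp]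
  simp only [symbolOp_apply, cobar_eq, add_mul', sub_mul', sum_mul', smul_mul']

variable (K deg) in
/-- The cobar differential of polynomials. -/
def polyCobar (n : ℕ) : polys K (tensorDeg deg n) →ₗ[K] polys K (tensorDeg deg (n + 1)) :=
  (cobar K deg n).restrict fun _ h => mem_polys_of_wt (fun _ h => cobar_wt h) h

variable (K deg) in
/-- The contraction of the cobar complex of polynomials. -/
def polyHtpy (n : ℕ) : polys K (tensorDeg deg (n + 1)) →ₗ[K] polys K (tensorDeg deg n) :=
  (cobarHtpy K deg n).restrict fun _ h => mem_polys_of_wt (fun _ h => cobarHtpy_wt h) h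

lemma dMult_opOfSymbol {m n : ℕ} (t : Symbol K deg m n) :
    dMult (opOfSymbol K deg m n t) =
      opOfSymbol K deg (m + 1) n (LinearMap.lTensor _ (polyCobar K deg m) t) := by
  induction t using TensorProduct.induction_on with
  | zero => simp only [map_zero]
  | tmul P G =>
    rw [LinearMap.lTensor_tmul, opOfSymbol_tmul, opOfSymbol_tmul, dMult_symbolOp P G.2]
    rfl
  | add t t' h h' => simp only [map_add, h, h']

lemma dComult_opOfSymbol {m n : ℕ} (t : Symbol K deg m n) :
    dComult (opOfSymbol K deg m n t) =
      opOfSymbol K deg m (n + 1) (LinearMap.rTensor _ (cobar K deg n) t) := by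
  induction t using TensorProduct.induction_on with
  | zero => simp only [map_zero]
  | tmul P G =>
    rw [LinearMap.rTensor_tmul, opOfSymbol_tmul, opOfSymbol_tmul, dComult_symbolOp P G.2]
  | add t t' h h' => simp only [map_add, h, h']

end Symbols

end GerstenhaberSchack

end

noncomputable section

namespace GerstenhaberSchack

/-! ### The total complex of symbols -/

section Total

set_option linter.unusedSectionVars false

open scoped TensorProduct

variable {K : Type*} [Field K] {ι : Type*} {deg : ι → ℤ} [Fintype ι] [LinearOrder ι]

variable (K deg) in
/-- The families of symbols. -/
abbrev SymbolFamilies : Type _ := ∀ m n : ℕ, Symbol K deg (m + 1) (n + 1)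

variable (K deg) in
/-- The family of operators that belongs to a family of symbols. -/
def familyOp : SymbolFamilies K deg →ₗ[K] Families K deg where
  toFun t m n := opOfSymbol K deg (m + 1) (n + 1) (t m n)
  map_add' s t := funext fun m => funext fun n =>
    (opOfSymbol K deg (m + 1) (n + 1)).map_add (s m n) (t m n)
  map_smul' c t := funext fun m => funext fun n => (opOfSymbol K deg (m + 1) (n + 1)).map_smul c (t m n)

lemma familyOp_apply (t : SymbolFamilies K deg) (m n : ℕ) :
    familyOp K deg t m n = opOfSymbol K deg (m + 1) (n + 1) (t m n) := rfl

variable (K deg) in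
/-- The families of symbols of total degree `k`. -/
def symbolGs (k : ℤ) : Submodule K (SymbolFamilies K deg) where
  carrier := {t | ∀ m n : ℕ, t m n ∈ symbolDegree K deg (m + 1) (n + 1) (k - m - n)}
  add_mem' hs ht m n := add_mem (hs m n) (ht m n)
  zero_mem' _ _ := zero_mem _
  smul_mem' c _ ht m n := Submodule.smul_mem _ c (ht m n)

lemma map_mem_symbolDegree {m n m' n' : ℕ} (f : OTensor K deg n →ₗ[K] OTensor K deg n')
    (g : polys K (tensorDeg deg m) →ₗ[K] polys K (tensorDeg deg m'))
    (hf : ∀ P d, IsHomogeneous P d → IsHomogeneous (f P) d)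
    (hg : ∀ (G : polys K (tensorDeg deg m)) d, IsHomogeneous G.1 d → IsHomogeneous (g G).1 d) {e : ℤ}
    {t : Symbol K deg m n} (ht : t ∈ symbolDegree K deg m n e) :
    TensorProduct.map f g t ∈ symbolDegree K deg m' n' e := by
  induction ht using Submodule.span_induction with
  | mem t h =>
    obtain ⟨P, G, d, d', hP, hG, he, rfl⟩ := h
    exact Submodule.subset_span ⟨f P, g G, d, d', hf P d hP, hg G d' hG, he, TensorProduct.map_tmul _ _ _ _⟩
  | zero => rw [map_zero]; exact zero_mem _
  | add t t' _ _ h h' => rw [map_add]; exact add_mem h h'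
  | smul c t _ h => rw [map_smul]; exact Submodule.smul_mem _ c h

variable [CharZero K]

lemma familyOp_injective : Function.Injective (familyOp K deg) := fun _ _ h =>
  funext fun m => funext fun n => opOfSymbol_injective _ _ (congrFun (congrFun h m) n)

lemma mem_gs_iff {k : ℤ} {f : Families K deg} :
    f ∈ gs K deg k ↔ ∃ t ∈ symbolGs K deg k, familyOp K deg t = f := by
  constructor
  · intro hf
    choose t ht using fun m n => mem_homPoly_iff.1 (hf m n).1
    refine ⟨t, fun m n => mem_symbolDegree_of_hasDegree ?_, funext fun m => funext fun n => ht m n⟩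
    rw [ht]
    exact (hf m n).2
  · rintro ⟨t, ht, rfl⟩ m n
    exact ⟨mem_homPoly_iff.2 ⟨t m n, rfl⟩, hasDegree_opOfSymbol (ht m n)⟩

/-- The part of the differential of symbols that raises the number of inputs. -/
def symbolD₁ (t : SymbolFamilies K deg) : SymbolFamilies K deg := fun m n => match m with
  | 0 => 0
  | m + 1 => LinearMap.lTensor _ (polyCobar K deg (m + 1)) (t m n)

/-- The part of the differential of symbols that raises the number of outputs. -/
def symbolD₂ (t : SymbolFamilies K deg) : SymbolFamilies K deg := fun m n => match n with
  | 0 => 0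
  | n + 1 => (-1 : K) ^ (m + 1) • LinearMap.rTensor _ (cobar K deg (n + 1)) (t m n)

lemma symbolD₁_zero (t : SymbolFamilies K deg) (n : ℕ) : symbolD₁ t 0 n = 0 := rfl

lemma symbolD₁_succ (t : SymbolFamilies K deg) (m n : ℕ) : symbolD₁ t (m + 1) n =
    LinearMap.lTensor _ (polyCobar K deg (m + 1)) (t m n) := rfl

lemma symbolD₂_zero (t : SymbolFamilies K deg) (m : ℕ) : symbolD₂ t m 0 = 0 := rfl

lemma symbolD₂_succ (t : SymbolFamilies K deg) (m n : ℕ) : symbolD₂ t m (n + 1) =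
    (-1 : K) ^ (m + 1) • LinearMap.rTensor _ (cobar K deg (n + 1)) (t m n) := rfl

/-- The total differential of symbols. -/
def symbolD (t : SymbolFamilies K deg) : SymbolFamilies K deg := symbolD₁ t + symbolD₂ t

lemma symbolD_apply (t : SymbolFamilies K deg) (m n : ℕ) :
    symbolD t m n = symbolD₁ t m n + symbolD₂ t m n := rfl

lemma gsD_familyOp (t : SymbolFamilies K deg) :
    gsD K deg (familyOp K deg t) = familyOp K deg (symbolD t) := by
  funext m n
  rw [familyOp_apply, symbolD_apply, map_add]
  change gsD₁ K deg (familyOp K deg t) m n + gsD₂ K deg (familyOp K deg t) m n = _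
  congr 1
  · cases m with
    | zero => rw [symbolD₁_zero, map_zero]; rfl
    | succ m => exact dMult_opOfSymbol (t m n)
  · cases n with
    | zero => rw [symbolD₂_zero, map_zero]; rfl
    | succ n =>
      rw [symbolD₂_succ, map_smul, ← dComult_opOfSymbol]
      rfl

lemma polyCobar_polyCobar (n : ℕ) : polyCobar K deg (n + 1) ∘ₗ polyCobar K deg n = 0 :=
  LinearMap.ext fun F => Subtype.ext (cobar_cobar n F.1)

lemma polyCobar_zero : polyCobar K deg 0 = 0 :=
  LinearMap.ext fun F => Subtype.ext (LinearMap.congr_fun cobar_zero F.1)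

lemma symbolD_symbolD (t : SymbolFamilies K deg) : symbolD (symbolD t) = 0 := by
  have hl : ∀ m n, symbolD₁ (symbolD₁ t) m n = 0 := by
    rintro (_ | _ | m) n
    · rfl
    · rw [symbolD₁_succ, symbolD₁_zero, map_zero]
    · rw [symbolD₁_succ, symbolD₁_succ, ← LinearMap.comp_apply, ← LinearMap.lTensor_comp,
        polyCobar_polyCobar, LinearMap.lTensor_zero, LinearMap.zero_apply]
  have hr : ∀ m n, symbolD₂ (symbolD₂ t) m n = 0 := by
    rintro m (_ | _ | n)
    · rfl
    · rw [symbolD₂_succ, symbolD₂_zero, map_zero, smul_zero]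
    · have h : cobar K deg (n + 1 + 1) ∘ₗ cobar K deg (n + 1) = 0 :=
        LinearMap.ext fun F => cobar_cobar (n + 1) F
      rw [symbolD₂_succ, symbolD₂_succ, map_smul, ← LinearMap.comp_apply, ← LinearMap.rTensor_comp,
        h, LinearMap.rTensor_zero, LinearMap.zero_apply, smul_zero, smul_zero]
  -- The two differentials act on different tensor factors and commute; the sign depending on the
  -- number of inputs makes them anticommute.
  have hlr : ∀ m n, symbolD₁ (symbolD₂ t) m n + symbolD₂ (symbolD₁ t) m n = 0 := by
    rintro (_ | m) (_ | n)
    · exact add_zero _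
    · rw [symbolD₁_zero, symbolD₂_succ, symbolD₁_zero, map_zero, smul_zero, add_zero]
    · rw [symbolD₁_succ, symbolD₂_zero, map_zero, symbolD₂_zero, add_zero]
    · rw [symbolD₁_succ, symbolD₂_succ, symbolD₂_succ, symbolD₁_succ, map_smul,
        ← LinearMap.comp_apply, LinearMap.lTensor_comp_rTensor, ← LinearMap.comp_apply,
        LinearMap.rTensor_comp_lTensor, pow_succ _ (m + 1), mul_neg_one, neg_smul, add_neg_cancel]
  have h1 : ∀ s s' : SymbolFamilies K deg, symbolD₁ (s + s') = symbolD₁ s + symbolD₁ s' := by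
    intro s s'
    funext m n
    cases m with
    | zero => exact (add_zero _).symm
    | succ m => exact map_add _ _ _
  have h2 : ∀ s s' : SymbolFamilies K deg, symbolD₂ (s + s') = symbolD₂ s + symbolD₂ s' := by
    intro s s'
    funext m n
    cases n with
    | zero => exact (add_zero _).symm
    | succ n =>
      simp only [Pi.add_apply, symbolD₂_succ, map_add, smul_add]
  funext m n
  simp only [symbolD, h1, h2, Pi.add_apply, hl, hr, zero_add, add_zero, Pi.zero_apply]
  exact hlr m n

lemma isHomogeneous_cobar (n : ℕ) (P : OTensor K deg n) (d : ℤ) (hP : IsHomogeneous P d) :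
    IsHomogeneous (cobar K deg n P) d := isHomogeneous_of_wt (fun _ h => cobar_wt h) hP

lemma isHomogeneous_cobarHtpy (n : ℕ) (P : OTensor K deg (n + 1)) (d : ℤ) (hP : IsHomogeneous P d) :
    IsHomogeneous (cobarHtpy K deg n P) d := isHomogeneous_of_wt (fun _ h => cobarHtpy_wt h) hP

lemma symbolD_mem {k : ℤ} {t : SymbolFamilies K deg} (ht : t ∈ symbolGs K deg k) :
    symbolD t ∈ symbolGs K deg (k + 1) := by
  intro m n
  refine add_mem ?_ ?_
  · cases m with
    | zero => exact zero_mem _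
    | succ m =>
      rw [show k + 1 - (m + 1 : ℕ) - (n : ℤ) = k - m - n by push_cast; ring]
      exact map_mem_symbolDegree _ _ (fun _ _ h => h) (fun G d h => isHomogeneous_cobar _ G.1 d h)
        (ht m n)
  · cases n with
    | zero => exact zero_mem _
    | succ n =>
      rw [show k + 1 - (m : ℤ) - (n + 1 : ℕ) = k - m - n by push_cast; ring]
      exact Submodule.smul_mem _ _ (map_mem_symbolDegree _ _ (isHomogeneous_cobar _)
        (fun _ _ h => h) (ht m n))

/-! ### The contraction of the total complex -/

lemma cobarForm_support {n : ℕ} {β : ι → ℕ} {F : OTensor K deg n} (h : cobarForm K deg n β F ≠ 0) :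
    ∃ a, wt a = β ∧ coeff F a ≠ 0 := by
  by_contra! h'
  refine h ?_
  rw [cobarForm_congr (G := 0) (fun a ha => by rw [h' a ha, coeff_zero]), map_zero]

lemma cobarCocycle_mem_polys (n : ℕ) (β : ι → ℕ) : cobarCocycle K deg n β ∈ polys K _ := by
  refine mem_polys_iff.2 ⟨∑ i, β i, fun a ha => ?_⟩
  have : wt a = β := by
    by_contra h
    exact ha (coeff_cobarCocycle h)
  rw [← sum_wt, this]

lemma isHomogeneous_cobarCocycle (n : ℕ) (β : ι → ℕ) :
    IsHomogeneous (cobarCocycle K deg n β) (degree deg β) := by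
  intro a ha
  have : wt a = β := by
    by_contra h
    exact ha (coeff_cobarCocycle h)
  rw [degree_wt, this]

lemma cobarProj_mem_polys {n : ℕ} (F : OTensor K deg n) : cobarProj K deg n F ∈ polys K _ := by
  rw [cobarProj_apply]
  exact Submodule.sum_mem _ fun β _ => Submodule.smul_mem _ _ (cobarCocycle_mem_polys n β)

lemma isHomogeneous_cobarProj {n : ℕ} {F : OTensor K deg n} {d : ℤ} (hF : IsHomogeneous F d) :
    IsHomogeneous (cobarProj K deg n F) d := by
  rw [cobarProj_apply]
  refine Submodule.sum_mem (homog K _ d) fun β _ => ?_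
  by_cases h : cobarForm K deg n β F = 0
  · rw [h, zero_smul]
    exact zero_mem _
  · obtain ⟨a, rfl, ha⟩ := cobarForm_support h
    rw [← hF a ha, degree_wt]
    exact Submodule.smul_mem _ _ (isHomogeneous_cobarCocycle n _)

variable (K deg) in
/-- The projection of the cobar complex of polynomials. -/
def polyProj (n : ℕ) : polys K (tensorDeg deg n) →ₗ[K] polys K (tensorDeg deg n) :=
  (cobarProj K deg n).restrict fun F _ => cobarProj_mem_polys F

/-- The contraction of the total complex. -/
def symbolHtpy (t : SymbolFamilies K deg) : SymbolFamilies K deg := fun m n =>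
  LinearMap.lTensor _ (polyHtpy K deg (m + 1)) (t (m + 1) n) +
    (-1 : K) ^ (m + 1) •
      TensorProduct.map (cobarHtpy K deg (n + 1)) (polyProj K deg (m + 1)) (t m (n + 1))

lemma symbolHtpy_apply (t : SymbolFamilies K deg) (m n : ℕ) : symbolHtpy t m n =
    LinearMap.lTensor _ (polyHtpy K deg (m + 1)) (t (m + 1) n) + (-1 : K) ^ (m + 1) •
      TensorProduct.map (cobarHtpy K deg (n + 1)) (polyProj K deg (m + 1)) (t m (n + 1)) := rfl

lemma symbolHtpy_mem {k : ℤ} {t : SymbolFamilies K deg} (ht : t ∈ symbolGs K deg k) :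
    symbolHtpy t ∈ symbolGs K deg (k - 1) := by
  intro m n
  refine add_mem ?_ (Submodule.smul_mem _ _ ?_)
  · have h := ht (m + 1) n
    rw [show k - (m + 1 : ℕ) - (n : ℤ) = k - 1 - m - n by push_cast; ring] at h
    exact map_mem_symbolDegree _ _ (fun _ _ h => h)
      (fun G d h => isHomogeneous_cobarHtpy _ G.1 d h) h
  · have h := ht m (n + 1)
    rw [show k - (m : ℤ) - (n + 1 : ℕ) = k - 1 - m - n by push_cast; ring] at h
    exact map_mem_symbolDegree _ _ (isHomogeneous_cobarHtpy _)
      (fun G d h => isHomogeneous_cobarProj h) h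

lemma polyCobar_comp_polyProj (n : ℕ) : polyCobar K deg n ∘ₗ polyProj K deg n = 0 :=
  LinearMap.ext fun F => Subtype.ext (cobar_cobarProj n F.1)

lemma polyProj_comp_polyCobar (n : ℕ) : polyProj K deg (n + 1) ∘ₗ polyCobar K deg n = 0 :=
  LinearMap.ext fun F => Subtype.ext (cobarProj_cobar n F.1)

lemma polyHtpy_spec (n : ℕ) : polyCobar K deg n ∘ₗ polyHtpy K deg n +
    polyHtpy K deg (n + 1) ∘ₗ polyCobar K deg (n + 1) = LinearMap.id - polyProj K deg (n + 1) :=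
  LinearMap.ext fun F => Subtype.ext (cobarHtpy_spec n F.1)

lemma cobarHtpy_spec' (n : ℕ) : cobar K deg n ∘ₗ cobarHtpy K deg n +
    cobarHtpy K deg (n + 1) ∘ₗ cobar K deg (n + 1) = LinearMap.id - cobarProj K deg (n + 1) :=
  LinearMap.ext fun F => cobarHtpy_spec n F

/-- The second part of the homotopy is killed because projected series are cocycles. At the edge `m
= 0` the right side vanishes as well, by `polyCobar_zero`. -/
lemma symbolD₁_symbolHtpy (t : SymbolFamilies K deg) (m n : ℕ) : symbolD₁ (symbolHtpy t) m n =
    LinearMap.lTensor _ (polyCobar K deg m ∘ₗ polyHtpy K deg m) (t m n) := by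
  cases m with
  | zero => rw [polyCobar_zero, LinearMap.zero_comp, LinearMap.lTensor_zero]; rfl
  | succ m =>
    rw [symbolD₁_succ, symbolHtpy_apply, map_add, map_smul, ← LinearMap.comp_apply,
      ← LinearMap.lTensor_comp, ← LinearMap.comp_apply (LinearMap.lTensor _ _),
      LinearMap.lTensor_comp_map, polyCobar_comp_polyProj, TensorProduct.map_zero_right,
      LinearMap.zero_apply, smul_zero, add_zero]

/-- The subtracted term will cancel against the homotopy applied to the differential; the sign
arises because `polyHtpy` changes the number of inputs by one. -/
lemma symbolD₂_symbolHtpy (t : SymbolFamilies K deg) (m n : ℕ) : symbolD₂ (symbolHtpy t) m n =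
    TensorProduct.map (cobar K deg n ∘ₗ cobarHtpy K deg n) (polyProj K deg (m + 1)) (t m n) -
      LinearMap.lTensor _ (polyHtpy K deg (m + 1)) (symbolD₂ t (m + 1) n) := by
  cases n with
  | zero =>
    rw [cobar_zero, LinearMap.zero_comp, TensorProduct.map_zero_left, symbolD₂_zero, symbolD₂_zero,
      map_zero, LinearMap.zero_apply, sub_zero]
  | succ n =>
    rw [symbolD₂_succ, symbolHtpy_apply, map_add, map_smul, smul_add, smul_smul, ← mul_pow,
      neg_mul_neg, one_mul, one_pow, one_smul, ← LinearMap.comp_apply,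
      LinearMap.rTensor_comp_lTensor, ← LinearMap.comp_apply (LinearMap.rTensor _ _),
      LinearMap.rTensor_comp_map, symbolD₂_succ, map_smul, ← LinearMap.comp_apply (LinearMap.lTensor _ _),
      LinearMap.lTensor_comp_rTensor, pow_succ _ (m + 1), mul_neg_one, neg_smul, sub_neg_eq_add]
    exact add_comm _ _

lemma map_symbolD₁ (t : SymbolFamilies K deg) (m n : ℕ) :
    TensorProduct.map (cobarHtpy K deg (n + 1)) (polyProj K deg (m + 1)) (symbolD₁ t m (n + 1)) = 0 := by
  cases m with
  | zero => rw [symbolD₁_zero, map_zero]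
  | succ m =>
    rw [symbolD₁_succ, ← LinearMap.comp_apply, LinearMap.map_comp_lTensor, polyProj_comp_polyCobar,
      TensorProduct.map_zero_right, LinearMap.zero_apply]

/-- The usual homotopy of a tensor product: contracting the inputs gives `1 - 1 ⊗ p`, and
contracting the outputs of what is left gives `1 ⊗ p - p ⊗ p`. -/
theorem symbolHtpy_spec (t : SymbolFamilies K deg) (m n : ℕ) :
    symbolD (symbolHtpy t) m n + symbolHtpy (symbolD t) m n =
      t m n - TensorProduct.map (cobarProj K deg (n + 1)) (polyProj K deg (m + 1)) (t m n) := by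
  have h1 : LinearMap.lTensor (OTensor K deg (n + 1)) (polyCobar K deg m ∘ₗ polyHtpy K deg m) (t m n) +
      LinearMap.lTensor _ (polyHtpy K deg (m + 1)) (symbolD₁ t (m + 1) n) =
      t m n - LinearMap.lTensor _ (polyProj K deg (m + 1)) (t m n) := by
    rw [symbolD₁_succ, ← LinearMap.comp_apply (LinearMap.lTensor _ _), ← LinearMap.lTensor_comp,
      ← LinearMap.add_apply, ← LinearMap.lTensor_add, polyHtpy_spec, LinearMap.lTensor_sub,
      LinearMap.lTensor_id]
    rfl
  have h2 : TensorProduct.map (cobar K deg n ∘ₗ cobarHtpy K deg n) (polyProj K deg (m + 1)) (t m n) +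
      (-1 : K) ^ (m + 1) • TensorProduct.map (cobarHtpy K deg (n + 1)) (polyProj K deg (m + 1))
        (symbolD₂ t m (n + 1)) = LinearMap.lTensor _ (polyProj K deg (m + 1)) (t m n) -
        TensorProduct.map (cobarProj K deg (n + 1)) (polyProj K deg (m + 1)) (t m n) := by
    rw [symbolD₂_succ, map_smul, smul_smul, ← mul_pow, neg_mul_neg, one_mul, one_pow, one_smul,
      ← LinearMap.comp_apply (TensorProduct.map _ _), LinearMap.map_comp_rTensor,
      ← LinearMap.add_apply, ← TensorProduct.map_add_left, cobarHtpy_spec']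
    refine eq_sub_of_add_eq ?_
    rw [← LinearMap.add_apply, ← TensorProduct.map_add_left, sub_add_cancel]
    rfl
  rw [symbolD_apply, symbolHtpy_apply, symbolD₁_symbolHtpy, symbolD₂_symbolHtpy, symbolD_apply,
    symbolD_apply, map_add, map_add, map_symbolD₁, zero_add, ← sub_add_sub_cancel (t m n), ← h1, ← h2]
  abel

end Total

end GerstenhaberSchack

end

noncomputable section

namespace GerstenhaberSchack

/-! ### The cohomology -/

section Cohomology

set_option linter.unusedSectionVars false

open scoped TensorProduct

variable {K : Type*} [Field K] [CharZero K] {ι : Type*} {deg : ι → ℤ} [Fintype ι] [LinearOrder ι]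

/-- The linear form on symbols dual to a pair of classes. -/
def symbolForm (m n : ℕ) (α β : ι → ℕ) : Symbol K deg m n →ₗ[K] K :=
  (TensorProduct.lid K K).toLinearMap ∘ₗ
    TensorProduct.map (cobarForm K deg n α) (cobarForm K deg m β ∘ₗ (polys K _).subtype)

lemma symbolForm_tmul {m n : ℕ} (α β : ι → ℕ) (P : OTensor K deg n)
    (G : polys K (tensorDeg deg m)) : symbolForm m n α β (P ⊗ₜ G) =
      cobarForm K deg n α P * cobarForm K deg m β G.1 := by
  simp [symbolForm]

lemma symbolForm_degree {m n : ℕ} {α β : ι → ℕ} {e : ℤ} {t : Symbol K deg m n}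
    (ht : t ∈ symbolDegree K deg m n e) (h : symbolForm m n α β t ≠ 0) :
    degree deg α - degree deg β = e := by
  by_contra he
  refine h ?_
  clear h
  induction ht using Submodule.span_induction with
  | mem t h =>
    obtain ⟨P, G, d, d', hP, hG, rfl, rfl⟩ := h
    rw [symbolForm_tmul]
    by_contra h
    obtain ⟨a, rfl, ha⟩ := cobarForm_support (left_ne_zero_of_mul h)
    obtain ⟨b, rfl, hb⟩ := cobarForm_support (right_ne_zero_of_mul h)
    exact he (by rw [← hP a ha, ← hG b hb, degree_wt, degree_wt])
  | zero => exact map_zero _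
  | add t t' _ _ h h' => rw [map_add, h, h', add_zero]
  | smul c t _ h => rw [map_smul, h, smul_zero]

variable (K deg) in
/-- The class of a pair of multidegrees. -/
def symbolClass (m n : ℕ) (α β : ι → ℕ) : Symbol K deg m n :=
  cobarCocycle K deg n α ⊗ₜ ⟨cobarCocycle K deg m β, cobarCocycle_mem_polys m β⟩

lemma map_proj_eq_sum {m n : ℕ} (t : Symbol K deg m n) :
    TensorProduct.map (cobarProj K deg n) (polyProj K deg m) t =
      ∑ α ∈ classIndex deg n, ∑ β ∈ classIndex deg m,
        symbolForm m n α β t • symbolClass K deg m n α β := by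
  induction t using TensorProduct.induction_on with
  | zero => simp
  | tmul P G =>
    have h : polyProj K deg m G = ∑ β ∈ classIndex deg m, cobarForm K deg m β G.1 •
        (⟨cobarCocycle K deg m β, cobarCocycle_mem_polys m β⟩ : polys K (tensorDeg deg m)) := by
      refine Subtype.ext ?_
      rw [Submodule.coe_sum]
      exact cobarProj_apply m G.1
    rw [TensorProduct.map_tmul, h, cobarProj_apply, TensorProduct.sum_tmul]
    refine Finset.sum_congr rfl fun α _ => ?_
    rw [TensorProduct.tmul_sum]
    refine Finset.sum_congr rfl fun β _ => ?_
    rw [symbolForm_tmul, symbolClass, TensorProduct.tmul_smul, TensorProduct.smul_tmul', smul_smul,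
      mul_comm]
    rfl
  | add t t' h h' => simp only [map_add, h, h', add_smul, Finset.sum_add_distrib]

lemma symbolForm_symbolClass {m n : ℕ} {α β : ι → ℕ} (hα : α ∈ classIndex deg n)
    (hβ : β ∈ classIndex deg m) (α' β' : ι → ℕ) :
    symbolForm m n α β (symbolClass K deg m n α' β') = if α' = α ∧ β' = β then 1 else 0 := by
  rw [mem_classIndex] at hα hβ
  rw [symbolClass, symbolForm_tmul]
  by_cases h : α' = α
  · by_cases h' : β' = β
    · rw [h, h', cobarForm_cocycle hα.1 hα.2, cobarForm_cocycle hβ.1 hβ.2, if_pos ⟨rfl, rfl⟩, mul_one]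
    · rw [cobarForm_cocycle_of_ne (Ne.symm h'), mul_zero, if_neg fun h => h' h.2]
  · rw [cobarForm_cocycle_of_ne (Ne.symm h), zero_mul, if_neg fun h' => h h'.1]

lemma symbolClass_mem {m n : ℕ} {α β : ι → ℕ} :
    symbolClass K deg m n α β ∈ symbolDegree K deg m n (degree deg α - degree deg β) :=
  Submodule.subset_span ⟨_, _, _, _, isHomogeneous_cobarCocycle n α, isHomogeneous_cobarCocycle m β,
    rfl, rfl⟩

/-- Each part of the differential puts a coboundary into one tensor factor, where a form in the
dimension equal to the length of its multidegree vanishes. -/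
lemma symbolForm_symbolD {m n : ℕ} {α β : ι → ℕ} (hα : n + 1 = ∑ i, α i) (hβ : m + 1 = ∑ i, β i)
    (t : SymbolFamilies K deg) : symbolForm (m + 1) (n + 1) α β (symbolD t m n) = 0 := by
  have h1 : ∀ {m n : ℕ} (_ : m + 1 = ∑ i, β i) (t : Symbol K deg m n),
      symbolForm (m + 1) n α β (LinearMap.lTensor _ (polyCobar K deg m) t) = 0 := by
    intro m n h t
    induction t using TensorProduct.induction_on with
    | zero => simp
    | tmul P G =>
      rw [LinearMap.lTensor_tmul, symbolForm_tmul]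
      exact mul_eq_zero_of_right _ (cobarForm_cobar h G.1)
    | add t t' h h' => rw [map_add, map_add, h, h', add_zero]
  have h2 : ∀ {m n : ℕ} (_ : n + 1 = ∑ i, α i) (t : Symbol K deg m n),
      symbolForm m (n + 1) α β (LinearMap.rTensor _ (cobar K deg n) t) = 0 := by
    intro m n h t
    induction t using TensorProduct.induction_on with
    | zero => simp
    | tmul P G =>
      rw [LinearMap.rTensor_tmul, symbolForm_tmul]
      exact mul_eq_zero_of_left (cobarForm_cobar h P) _
    | add t t' h h' => rw [map_add, map_add, h, h', add_zero]
  rw [symbolD_apply, map_add]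
  have h3 : symbolForm (m + 1) (n + 1) α β (symbolD₁ t m n) = 0 := by
    cases m with
    | zero => exact map_zero _
    | succ m => exact h1 hβ _
  have h4 : symbolForm (m + 1) (n + 1) α β (symbolD₂ t m n) = 0 := by
    cases n with
    | zero => exact map_zero _
    | succ n => rw [symbolD₂_succ, map_smul, h2 hα, smul_zero]
  rw [h3, h4, add_zero]

open Classical in
/-- The coefficients of the series of classes. -/
def classCoeff (t : SymbolFamilies K deg) (a : ι ⊕ ι → ℕ) : K :=
  -- Families are indexed by one less than the numbers of inputs and outputs; the condition makes
  -- the truncated subtractions exact.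
  if ∑ i, a (Sum.inl i) ≠ 0 ∧ ∑ i, a (Sum.inr i) ≠ 0 then
    symbolForm _ _ (fun i => a (Sum.inl i)) (fun i => a (Sum.inr i))
      (t (∑ i, a (Sum.inr i) - 1) (∑ i, a (Sum.inl i) - 1)) else 0

variable (K deg) in
/-- The series of classes of a family of symbols. -/
def classSeries : SymbolFamilies K deg →ₗ[K] Series K (shiftedDeg deg) where
  toFun t := ofCoeff (classCoeff t)
  map_add' s t := by
    rw [← ofCoeff_add]
    congr 1
    funext a
    simp only [classCoeff]
    split_ifs <;> simp
  map_smul' c t := by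
    simp only [RingHom.id_apply]
    rw [← ofCoeff_smul]
    congr 1
    funext a
    simp only [classCoeff]
    split_ifs <;> simp

lemma coeff_classSeries {t : SymbolFamilies K deg} {a : ι ⊕ ι → ℕ}
    (ha : Admissible (shiftedDeg deg) a) {m n : ℕ} (hn : n + 1 = ∑ i, a (Sum.inl i))
    (hm : m + 1 = ∑ i, a (Sum.inr i)) : coeff (classSeries K deg t) a =
      symbolForm (m + 1) (n + 1) (fun i => a (Sum.inl i)) (fun i => a (Sum.inr i)) (t m n) := by
  obtain rfl : n = ∑ i, a (Sum.inl i) - 1 := by omega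
  obtain rfl : m = ∑ i, a (Sum.inr i) - 1 := by omega
  exact (coeff_ofCoeff (g := classCoeff t) ha).trans (if_pos ⟨by omega, by omega⟩)

lemma sum_ne_zero_of_coeff_classSeries {t : SymbolFamilies K deg} {a : ι ⊕ ι → ℕ}
    (h : coeff (classSeries K deg t) a ≠ 0) :
    ∑ i, a (Sum.inl i) ≠ 0 ∧ ∑ i, a (Sum.inr i) ≠ 0 := by
  by_contra h'
  refine h ?_
  by_cases ha : Admissible (shiftedDeg deg) a
  · exact (coeff_ofCoeff (g := classCoeff t) ha).trans (if_neg h')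
  · exact coeff_of_not_admissible ha

/-- The shift by one exchanges even and odd, so the condition selecting the cobar classes is the
admissibility of monomials in the shifted variables. -/
lemma admissible_shiftedDeg_iff {a : ι ⊕ ι → ℕ} : Admissible (shiftedDeg deg) a ↔
    ShiftAdmissible deg (fun i => a (Sum.inl i)) ∧ ShiftAdmissible deg fun i => a (Sum.inr i) := by
  have h : ∀ d : ℤ, Odd (d + 1) ↔ Even d := fun d => by simp
  simp only [Admissible, Sum.forall, shiftedDeg, Sum.elim_inl, Sum.elim_inr, h, even_neg]
  rfl

lemma degree_shiftedDeg (a : ι ⊕ ι → ℕ) : degree (shiftedDeg deg) a =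
    degree deg (fun i => a (Sum.inl i)) - degree deg (fun i => a (Sum.inr i)) +
      (∑ i, a (Sum.inl i) : ℕ) + (∑ i, a (Sum.inr i) : ℕ) := by
  simp only [degree, Fintype.sum_sum_type, shiftedDeg, Sum.elim_inl, Sum.elim_inr, mul_add, mul_neg,
    mul_one, Finset.sum_add_distrib, Finset.sum_neg_distrib]
  push_cast
  ring

/-- The internal degree `k - m - n` is raised by one for each of the `n + 1` shifted coordinates of
`V` and the `m + 1` of `V*`, which gives `k + 2`. -/
lemma classSeries_mem {k : ℤ} {t : SymbolFamilies K deg} (ht : t ∈ symbolGs K deg k) :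
    classSeries K deg t ∈ shiftedFunctions K deg (k + 2) := by
  constructor
  · intro a ha
    have hadm : Admissible (shiftedDeg deg) a := by
      by_contra h
      exact ha (coeff_of_not_admissible h)
    obtain ⟨h1, h2⟩ := sum_ne_zero_of_coeff_classSeries ha
    obtain ⟨n, hn⟩ := Nat.exists_eq_succ_of_ne_zero h1
    obtain ⟨m, hm⟩ := Nat.exists_eq_succ_of_ne_zero h2
    rw [coeff_classSeries hadm hn.symm hm.symm] at ha
    rw [degree_shiftedDeg, symbolForm_degree (ht m n) ha, hn, hm]
    push_cast
    ring
  · intro a ha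
    obtain ⟨h1, h2⟩ := sum_ne_zero_of_coeff_classSeries ha
    obtain ⟨i, -, hi⟩ := Finset.exists_ne_zero_of_sum_ne_zero h1
    obtain ⟨j, -, hj⟩ := Finset.exists_ne_zero_of_sum_ne_zero h2
    exact ⟨⟨i, hi⟩, j, hj⟩

lemma classSeries_symbolD (t : SymbolFamilies K deg) : classSeries K deg (symbolD t) = 0 := by
  refine series_ext fun a ha => ?_
  rw [coeff_zero]
  by_contra h
  obtain ⟨h1, h2⟩ := sum_ne_zero_of_coeff_classSeries h
  obtain ⟨n, hn⟩ := Nat.exists_eq_succ_of_ne_zero h1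
  obtain ⟨m, hm⟩ := Nat.exists_eq_succ_of_ne_zero h2
  rw [coeff_classSeries ha hn.symm hm.symm, symbolForm_symbolD hn.symm hm.symm] at h
  exact h rfl

/-- On a cocycle the homotopy identity exhibits the difference from its projection as a coboundary,
and the projection is determined by the series of classes. -/
lemma exists_symbolD_eq {k : ℤ} {t : SymbolFamilies K deg} (ht : t ∈ symbolGs K deg k)
    (hD : symbolD t = 0) (hc : classSeries K deg t = 0) :
    ∃ s ∈ symbolGs K deg (k - 1), symbolD s = t := by
  refine ⟨symbolHtpy t, symbolHtpy_mem ht, funext fun m => funext fun n => ?_⟩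
  have h := symbolHtpy_spec t m n
  have h0 : symbolHtpy (0 : SymbolFamilies K deg) m n = 0 := by
    simp [symbolHtpy_apply]
  rw [hD, h0, add_zero, map_proj_eq_sum] at h
  rw [h, Finset.sum_eq_zero, sub_zero]
  intro α hα
  refine Finset.sum_eq_zero fun β hβ => ?_
  rw [mem_classIndex] at hα hβ
  have h1 := coeff_classSeries (t := t) (a := Sum.elim α β) (m := m) (n := n)
    (admissible_shiftedDeg_iff.2 ⟨hα.2, hβ.2⟩) hα.1 hβ.1
  rw [hc, coeff_zero] at h1
  simp only [Sum.elim_inl, Sum.elim_inr] at h1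
  rw [← h1, zero_smul]

/-- A cocycle with a given series of classes. -/
def classFamily (F : Series K (shiftedDeg deg)) : SymbolFamilies K deg := fun m n =>
  ∑ α ∈ classIndex deg (n + 1), ∑ β ∈ classIndex deg (m + 1),
    coeff F (Sum.elim α β) • symbolClass K deg (m + 1) (n + 1) α β

lemma classFamily_mem {k : ℤ} {F : Series K (shiftedDeg deg)}
    (hF : F ∈ shiftedFunctions K deg (k + 2)) : classFamily F ∈ symbolGs K deg k := by
  intro m n
  refine Submodule.sum_mem _ fun α hα => Submodule.sum_mem _ fun β hβ => ?_
  by_cases h : coeff F (Sum.elim α β) = 0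
  · rw [h, zero_smul]
    exact zero_mem _
  · refine Submodule.smul_mem _ _ ?_
    have h1 := hF.1 _ h
    rw [mem_classIndex] at hα hβ
    rw [degree_shiftedDeg] at h1
    simp only [Sum.elim_inl, Sum.elim_inr, ← hα.1, ← hβ.1] at h1
    push_cast at h1
    rw [show k - (m : ℤ) - n = degree deg α - degree deg β by linarith]
    exact symbolClass_mem

lemma symbolD_classFamily (F : Series K (shiftedDeg deg)) : symbolD (classFamily F) = 0 := by
  funext m n
  rw [symbolD_apply]
  have h1 : symbolD₁ (classFamily F) m n = 0 := by
    cases m with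
    | zero => rfl
    | succ m =>
      rw [symbolD₁_succ, classFamily, map_sum]
      refine Finset.sum_eq_zero fun α _ => ?_
      rw [map_sum]
      refine Finset.sum_eq_zero fun β hβ => ?_
      have h : polyCobar K deg (m + 1) ⟨cobarCocycle K deg (m + 1) β, cobarCocycle_mem_polys _ β⟩ = 0 :=
        Subtype.ext (cobar_cobarCocycle (mem_classIndex.1 hβ).1)
      rw [map_smul, symbolClass, LinearMap.lTensor_tmul, h, TensorProduct.tmul_zero, smul_zero]
  have h2 : symbolD₂ (classFamily F) m n = 0 := by
    cases n with
    | zero => rfl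
    | succ n =>
      rw [symbolD₂_succ, classFamily, map_sum, Finset.sum_eq_zero, smul_zero]
      intro α hα
      rw [map_sum]
      refine Finset.sum_eq_zero fun β _ => ?_
      rw [map_smul, symbolClass, LinearMap.rTensor_tmul, cobar_cobarCocycle (mem_classIndex.1 hα).1,
        TensorProduct.zero_tmul, smul_zero]
  rw [h1, h2, add_zero]
  rfl

/-- Forms and cocycles are dual to each other. The monomials missing one of the two kinds of
variables are never read by `classSeries`, and by hypothesis they do not occur in `F`. -/
lemma classSeries_classFamily {k : ℤ} {F : Series K (shiftedDeg deg)}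
    (hF : F ∈ shiftedFunctions K deg k) : classSeries K deg (classFamily F) = F := by
  refine series_ext fun a ha => ?_
  by_cases h : ∑ i, a (Sum.inl i) ≠ 0 ∧ ∑ i, a (Sum.inr i) ≠ 0
  · obtain ⟨n, hn⟩ := Nat.exists_eq_succ_of_ne_zero h.1
    obtain ⟨m, hm⟩ := Nat.exists_eq_succ_of_ne_zero h.2
    have hadm := admissible_shiftedDeg_iff.1 ha
    have hα : (fun i => a (Sum.inl i)) ∈ classIndex deg (n + 1) := mem_classIndex.2 ⟨hn.symm, hadm.1⟩
    have hβ : (fun i => a (Sum.inr i)) ∈ classIndex deg (m + 1) := mem_classIndex.2 ⟨hm.symm, hadm.2⟩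
    rw [coeff_classSeries ha hn.symm hm.symm, classFamily, map_sum, Finset.sum_eq_single_of_mem _ hα,
      map_sum, Finset.sum_eq_single_of_mem _ hβ]
    · rw [map_smul, symbolForm_symbolClass hα hβ, if_pos ⟨rfl, rfl⟩, smul_eq_mul, mul_one]
      congr 1
      funext s
      cases s <;> rfl
    · intro β _ hne
      rw [map_smul, symbolForm_symbolClass hα hβ, if_neg fun h => hne h.2, smul_zero]
    · intro α _ hne
      rw [map_sum]
      refine Finset.sum_eq_zero fun β _ => ?_
      rw [map_smul, symbolForm_symbolClass hα hβ, if_neg fun h => hne h.1, smul_zero]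
  · have h1 : coeff (classSeries K deg (classFamily F)) a = 0 := by
      by_contra h'
      exact h (sum_ne_zero_of_coeff_classSeries h')
    have h2 : coeff F a = 0 := by
      by_contra h'
      obtain ⟨⟨i, hi⟩, j, hj⟩ := hF.2 a h'
      exact h ⟨fun h => hi (Finset.sum_eq_zero_iff.1 h i (Finset.mem_univ i)),
        fun h => hj (Finset.sum_eq_zero_iff.1 h j (Finset.mem_univ j))⟩
    rw [h1, h2]

/-- A linear map that is onto a subspace `T` and has kernel `B` on a subspace `Z` identifies the
subquotient with `T`. -/
lemma nonempty_subquotient_equiv {M N : Type*} [AddCommGroup M] [Module K M] [AddCommGroup N]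
    [Module K N] (c : M →ₗ[K] N) (Z B : Submodule K M) (T : Submodule K N)
    (h1 : ∀ x ∈ Z, c x ∈ T) (h2 : ∀ y ∈ T, ∃ x ∈ Z, c x = y) (h3 : ∀ x ∈ Z, c x = 0 ↔ x ∈ B) :
    Nonempty ((Z ⧸ B.submoduleOf Z) ≃ₗ[K] T) := by
  have hk : LinearMap.ker (c.restrict h1) = B.submoduleOf Z := by
    ext x
    rw [LinearMap.mem_ker]
    exact Subtype.ext_iff.trans (h3 x.1 x.2)
  rw [← hk]
  refine ⟨(c.restrict h1).quotKerEquivOfSurjective fun y => ?_⟩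
  obtain ⟨x, hx, hxy⟩ := h2 y.1 y.2
  exact ⟨⟨x, hx⟩, Subtype.ext hxy⟩

theorem nonempty_gsCohomology_equiv (k : ℤ) :
    Nonempty (gsCohomology K deg k ≃ₗ[K] shiftedFunctions K deg (k + 2)) := by
  -- A linear choice of symbols on all families of maps lets the series of classes be defined on the
  -- ambient space; only its values on operators with symbols matter.
  obtain ⟨g, hg⟩ := LinearMap.exists_leftInverse_of_injective (familyOp K deg)
    (LinearMap.ker_eq_bot.2 familyOp_injective)
  have hg' : ∀ t, g (familyOp K deg t) = t := LinearMap.congr_fun hg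
  have hZ : ∀ f, f ∈ gsCocycles K deg k ↔
      ∃ t ∈ symbolGs K deg k, symbolD t = 0 ∧ familyOp K deg t = f := by
    intro f
    rw [gsCocycles, Submodule.mem_inf, LinearMap.mem_ker, mem_gs_iff]
    constructor
    · rintro ⟨⟨t, ht, rfl⟩, h⟩
      rw [gsD_familyOp, ← map_zero (familyOp K deg)] at h
      exact ⟨t, ht, familyOp_injective h, rfl⟩
    · rintro ⟨t, ht, h, rfl⟩
      exact ⟨⟨t, ht, rfl⟩, by rw [gsD_familyOp, h, map_zero]⟩
  refine nonempty_subquotient_equiv (classSeries K deg ∘ₗ g) _ _ _ ?_ ?_ ?_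
  · intro f hf
    obtain ⟨t, ht, -, rfl⟩ := (hZ f).1 hf
    rw [LinearMap.comp_apply, hg']
    exact classSeries_mem ht
  · intro F hF
    refine ⟨familyOp K deg (classFamily F), (hZ _).2
      ⟨_, classFamily_mem hF, symbolD_classFamily F, rfl⟩, ?_⟩
    rw [LinearMap.comp_apply, hg', classSeries_classFamily hF]
  · intro f hf
    obtain ⟨t, ht, hD, rfl⟩ := (hZ f).1 hf
    rw [LinearMap.comp_apply, hg', gsCoboundaries, Submodule.mem_map]
    constructor
    · intro hc
      obtain ⟨s, hs, rfl⟩ := exists_symbolD_eq ht hD hc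
      exact ⟨familyOp K deg s, mem_gs_iff.2 ⟨s, hs, rfl⟩, gsD_familyOp s⟩
    · rintro ⟨f, hf, h⟩
      obtain ⟨s, -, rfl⟩ := mem_gs_iff.1 hf
      rw [gsD_familyOp] at h
      rw [← familyOp_injective h, classSeries_symbolD]

lemma gsD_mem_gs {k : ℤ} {f : Families K deg} (hf : f ∈ gs K deg k) :
    gsD K deg f ∈ gs K deg (k + 1) := by
  obtain ⟨t, ht, rfl⟩ := mem_gs_iff.1 hf
  exact mem_gs_iff.2 ⟨symbolD t, symbolD_mem ht, (gsD_familyOp t).symm⟩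

lemma gsD_gsD {k : ℤ} {f : Families K deg} (hf : f ∈ gs K deg k) :
    gsD K deg (gsD K deg f) = 0 := by
  obtain ⟨t, -, rfl⟩ := mem_gs_iff.1 hf
  rw [gsD_familyOp, gsD_familyOp, symbolD_symbolD, map_zero]

end Cohomology

end GerstenhaberSchack

end

theorem mainTheorem5 {K : Type*} [Field K] [CharZero K] {ι : Type*} [Fintype ι] [LinearOrder ι]
    (deg : ι → ℤ) :
    (∀ k : ℤ, ∀ f ∈ GerstenhaberSchack.gs K deg k,
      GerstenhaberSchack.gsD K deg f ∈ GerstenhaberSchack.gs K deg (k + 1)) ∧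
    (∀ k : ℤ, ∀ f ∈ GerstenhaberSchack.gs K deg k,
      GerstenhaberSchack.gsD K deg (GerstenhaberSchack.gsD K deg f) = 0) ∧
    ∀ k : ℤ, Nonempty (GerstenhaberSchack.gsCohomology K deg k ≃ₗ[K]
      GerstenhaberSchack.shiftedFunctions K deg (k + 2)) :=
  ⟨fun _ _ hf => GerstenhaberSchack.gsD_mem_gs hf, fun _ _ hf => GerstenhaberSchack.gsD_gsD hf,
    GerstenhaberSchack.nonempty_gsCohomology_equiv⟩
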